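/- **Setting.** Let $m\ge 1$, $n,r\ge 0$, and let $P(\lambda)=\sum_{j=0}^m\lambda^jA_j$ with $A_j\in\mathbb C^{n\times n}$, $A_m\neq0$. A *realization* of a rational matrix $G(\lambda)$ of size $r$ is a representation $G(\lambda)=P(\lambda)+C(\lambda E-A)^{-1}B$ with a matrix polynomial $P$ and constant matrices $A,E\in\mathbb C^{r\times r}$, $B$, $C$, with $E$ nonsingular; it is *minimal* if $r$ is the smallest size among all realizations of $G(\lambda)$. Its system matrix is $\mathcal S(\lambda)=\begin{bmatrix}P(\lambda)&C\\B&A-\lambda E\end{bmatrix}$, with transfer function $G(\lambda)$; it is *irreducible* if the realization is minimal. **Rosenbrock strong linearization.** An irreducible system matrix $\mathbb L(\lambda)=\begin{bmatrix}X_1-\lambda Y_1&C_1\\B_1&H-\lambda K\end{bmatrix}$ of order $mn+r$, with $X_1,Y_1\in\mathbb C^{mn\times mn}$, $H,K\in\mathbb C^{r\times r}$, $K$ nonsingular, and transfer function $\mathbb G(\lambda)=X_1-\lambda Y_1+C_1(\lambda K-H)^{-1}B_1$, is a Rosenbrock strong linearization of $G(\lambda)=P(\lambda)+C(\lambda E-A)^{-1}B$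 if (a) $\operatorname{diag}(U(\lambda),U_0)\,\mathbb L(\lambda)\,\operatorname{diag}(V(\lambda),V_0)=\operatorname{diag}(I_{(m-1)n},\mathcal S(\lambda))$ for some unimodular $mn\times mn$ matrix polynomials $U,V$ and nonsingular $U_0,V_0\in\mathbb C^{r\times r}$; and (b) $\mathcal O_\ell(\lambda)\,\lambda^{-1}\mathbb G(\lambda)\,\mathcal O_r(\lambda)=\operatorname{diag}(I_{(m-1)n},\lambda^{-m}G(\lambda))$ for some biproper rational matrices $\mathcal O_\ell,\mathcal O_r$ (those tending to a nonsingular constant matrix as $\lambda\to\infty$). **Elementary matrices.** For $X\in\mathbb C^{n\times n}$ put $M_0(X)=\operatorname{diag}(I_{(m-1)n},X)$, $M_{-m}(X)=\operatorname{diag}(X,I_{(m-1)n})$, and for $1\le i\le m-1$ $$M_i(X)=\operatorname{diag}\Big(I_{(m-i-1)n},\begin{bmatrix}X&I_n\\I_n&0\end{bmatrix},I_{(i-1)n}\Big),\qquad M_{-i}(X)=\operatorname{diag}\Big(I_{(m-i-1)n},\begin{bmatrix}0&I_n\\I_n&X\end{bmatrix},I_{(i-1)n}\Big).$$ Put $M_i^P=M_i(-A_i)$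 for $0\le i\le m-1$, $M_i^P=M_i(A_{-i})$ for $-m\le i\le-1$, $\mathbb M_i(X)=\operatorname{diag}(M_i(X),I_r)$, $\mathbb M_i^P=\operatorname{diag}(M_i^P,I_r)$, and $$\mathbb M^{\mathcal S}_0=\begin{bmatrix}M_0^P&-e_m\otimes C\\-e_m^T\otimes B&-A\end{bmatrix},\quad \mathbb M^{\mathcal S}_{-m}=\operatorname{diag}(M^P_{-m},-E),\quad \mathbb M^{\mathcal S}_i=\operatorname{diag}(M_i^P,I_r),\quad \mathbb M^{\mathcal S}_{-i}=(\mathbb M^{\mathcal S}_i)^{-1}\ (1\le i\le m-1),$$ where $e_k$ is the $k$-th column of $I_m$. For an index tuple $\mathbf t=(t_1,\dots,t_k)$ with entries in $\{-m,\dots,m-1\}$ and a matrix assignment $\mathcal X=(X_1,\dots,X_k)$ of $n\times n$ matrices, $M_{\mathbf t}(\mathcal X)=M_{t_1}(X_1)\cdots M_{t_k}(X_k)$; similarly $\mathbb M_{\mathbf t}(\mathcal X)$, $M^P_{\mathbf t}$, $\mathbb M^P_{\mathbf t}$, $\mathbb M^{\mathcal S}_{\mathbf t}$. The assignment is *nonsingular*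 if the matrices at the positions of $\mathbf t$ occupied by $0$ and $-m$ are nonsingular. Reversal of a tuple is denoted $rev$, and $\mathbf t+k$ is the entrywise translate. **Index tuples.** $(k:l)$ is the string $(k,k+1,\dots,l)$, empty if $k>l$. The *simple admissible tuple* of $\{0:h\}$ is $(h-1:h,\,h-3:h-2,\dots,\,p+1:p+2,\,0:p)$, where $p\in\{0,1\}$ has the parity of $h$; its *symmetric complement* is $(h-1,h-3,\dots,1)$ if $p=0$ (empty if $h=0$) and $(h-1,h-3,\dots,2,0)$ if $p=1$. A tuple is *in canonical form for $h$* if it is $(a_1:h-2,\,a_2:h-4,\dots,\,a_{\lfloor h/2\rfloor}:h-2\lfloor h/2\rfloor)$ with integers $a_i\ge0$. For a tuple $\beta$ containing $0$, $i_0(\beta)$ is the largest $s\ge 0$ such that $(s,s-1,\dots,1,0)$ is a subtuple (not necessarily contiguous) of $\beta$. **The pencils.** Let $0\le h\le m-1$. Let $\mathbf w$ and $\mathbf v+m$ be the simple admissible tuples of $\{0:h\}$ and $\{0:m-h-1\}$, with symmetric complements $\mathbf c_w$ and $\mathbf c_v+m$. Let $\mathbf t_w$ and $\mathbf t_v+m$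 be in canonical form for $h$ and $m-h-1$, and let $\mathcal X,\mathcal Y$ be nonsingular matrix assignments for $\mathbf t_w,\mathbf t_v$. Define $$L_P(h,\mathbf t_w,\mathbf t_v,\mathcal X,\mathcal Y)=M_{(\mathbf t_v,\mathbf t_w)}(\mathcal Y,\mathcal X)\,(\lambda M^P_{\mathbf v}-M^P_{\mathbf w})\,M^P_{(\mathbf c_w,\mathbf c_v)}\,M_{(rev\,\mathbf t_w,rev\,\mathbf t_v)}(rev\,\mathcal X,rev\,\mathcal Y),$$ $$\mathbb L_{\mathcal S}(h,\mathbf t_w,\mathbf t_v,\mathcal X,\mathcal Y)=\mathbb M_{(\mathbf t_v,\mathbf t_w)}(\mathcal Y,\mathcal X)\,(\lambda \mathbb M^{\mathcal S}_{\mathbf v}-\mathbb M^{\mathcal S}_{\mathbf w})\,\mathbb M^P_{(\mathbf c_w,\mathbf c_v)}\,\mathbb M_{(rev\,\mathbf t_w,rev\,\mathbf t_v)}(rev\,\mathcal X,rev\,\mathcal Y).$$ **Statement.** Let $G(\lambda)\in\mathbb C(\lambda)^{n\times n}$ be symmetric, $G(\lambda)^T=G(\lambda)$, with a minimal realization $G(\lambda)=P(\lambda)+B^T(\lambda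 E-A)^{-1}B$ in which $A$ and $E$ are symmetric and $E$ is nonsingular, and let $\mathcal S(\lambda)=\begin{bmatrix}P(\lambda)&B^T\\B&A-\lambda E\end{bmatrix}$. Let $0\le h\le m-1$ be even, and let $\mathbf t_w,\mathbf t_v,\mathcal X,\mathcal Y$ be as above with all matrices in $\mathcal X$ and $\mathcal Y$ symmetric. Put $\alpha=i_0(\mathbf t_w,\mathbf w)$, $L(\lambda)=L_P(h,\mathbf t_w,\mathbf t_v,\mathcal X,\mathcal Y)$ and $\mathbb L(\lambda)=\mathbb L_{\mathcal S}(h,\mathbf t_w,\mathbf t_v,\mathcal X,\mathcal Y)$. Then $$\mathbb L(\lambda)=\begin{bmatrix}L(\lambda)&e_{m-\alpha}\otimes B^T\\ e_{m-\alpha}^T\otimes B&A-\lambda E\end{bmatrix},$$ and $\mathbb L(\lambda)$ is symmetric. If $m$ is odd, then $\mathbb L(\lambda)$ is a (symmetric) Rosenbrock strong linearization of $G(\lambda)$. If $m$ is even and $A_m$ is nonsingular, then $\mathbb L(\lambda)$ is a (symmetric) Rosenbrock strong linearization of $G(\lambda)$. Moreover, the transfer function $\mathbb G(\lambda)=L(\lambda)+(e_{m-\alpha}\otimes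 B^T)(\lambda E-A)^{-1}(e_{m-\alpha}^T\otimes B)$ of $\mathbb L(\lambda)$ is symmetric. -/

import Mathlib

open Matrix Polynomial Filter Topology

namespace RosenbrockGFPR

/-! ### Realizations, system matrices, Rosenbrock strong linearizations -/

/-- A complex matrix viewed as a constant matrix polynomial. -/
noncomputable def cPoly {ι κ : Type} (M : Matrix ι κ ℂ) : Matrix ι κ ℂ[X] :=
  M.map Polynomial.C

/-- A complex matrix viewed as a constant rational matrix. -/
noncomputable def cRat {ι κ : Type} (M : Matrix ι κ ℂ) : Matrix ι κ (RatFunc ℂ) :=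
  M.map RatFunc.C

/-- A matrix polynomial viewed as a rational matrix. -/
noncomputable def polyToRat {ι κ : Type} (M : Matrix ι κ ℂ[X]) : Matrix ι κ (RatFunc ℂ) :=
  M.map (algebraMap ℂ[X] (RatFunc ℂ))

/-- The rational matrix `P(λ) + C (λ E - A)⁻¹ B`. -/
noncomputable def transferFunction {ι : Type} {r : ℕ} (P : Matrix ι ι ℂ[X])
    (A : Matrix (Fin r) (Fin r) ℂ) (B : Matrix (Fin r) ι ℂ) (C : Matrix ι (Fin r) ℂ)
    (E : Matrix (Fin r) (Fin r) ℂ) : Matrix ι ι (RatFunc ℂ) :=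
  polyToRat P + cRat C * ((RatFunc.X : RatFunc ℂ) • cRat E - cRat A)⁻¹ * cRat B

/-- `G(λ) = P(λ) + C (λ E - A)⁻¹ B` is a realization of `G(λ)` of size `r`
(with `E` nonsingular). -/
def IsRealization {ι : Type} {r : ℕ} (G : Matrix ι ι (RatFunc ℂ)) (P : Matrix ι ι ℂ[X])
    (A : Matrix (Fin r) (Fin r) ℂ) (B : Matrix (Fin r) ι ℂ) (C : Matrix ι (Fin r) ℂ)
    (E : Matrix (Fin r) (Fin r) ℂ) : Prop :=
  E.det ≠ 0 ∧ G = transferFunction P A B C E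

/-- A realization is minimal if the size of the pencil `λ E - A` is the smallest among all
realizations of `G(λ)`. The associated system matrix is then called irreducible. -/
def IsMinimalRealization {ι : Type} {r : ℕ} (G : Matrix ι ι (RatFunc ℂ)) (P : Matrix ι ι ℂ[X])
    (A : Matrix (Fin r) (Fin r) ℂ) (B : Matrix (Fin r) ι ℂ) (C : Matrix ι (Fin r) ℂ)
    (E : Matrix (Fin r) (Fin r) ℂ) : Prop :=
  IsRealization G P A B C E ∧
    ∀ (r' : ℕ) (P' : Matrix ι ι ℂ[X]) (A' : Matrix (Fin r') (Fin r') ℂ)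
      (B' : Matrix (Fin r') ι ℂ) (C' : Matrix ι (Fin r') ℂ) (E' : Matrix (Fin r') (Fin r') ℂ),
      IsRealization G P' A' B' C' E' → r ≤ r'

/-- The system matrix `[P(λ), C; B, A - λ E]`. -/
noncomputable def systemMatrix {ι : Type} {r : ℕ} (P : Matrix ι ι ℂ[X])
    (A : Matrix (Fin r) (Fin r) ℂ) (B : Matrix (Fin r) ι ℂ) (C : Matrix ι (Fin r) ℂ)
    (E : Matrix (Fin r) (Fin r) ℂ) : Matrix (ι ⊕ Fin r) (ι ⊕ Fin r) ℂ[X] :=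
  fromBlocks P (cPoly C) (cPoly B) (cPoly A - (Polynomial.X : ℂ[X]) • cPoly E)

/-- A matrix polynomial whose determinant is a nonzero constant. -/
def IsUnimodular {ι : Type} [Fintype ι] [DecidableEq ι] (U : Matrix ι ι ℂ[X]) : Prop :=
  ∃ c : ℂ, c ≠ 0 ∧ U.det = Polynomial.C c

/-- A rational matrix `F(λ)` that tends to a nonsingular constant matrix as `λ → ∞`. -/
def IsBiproper {ι : Type} [Fintype ι] [DecidableEq ι] (F : Matrix ι ι (RatFunc ℂ)) : Prop :=
  ∃ D : Matrix ι ι ℂ, D.det ≠ 0 ∧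
    Tendsto (fun z : ℂ => F.map (RatFunc.eval (RingHom.id ℂ) z)) (Bornology.cobounded ℂ) (𝓝 D)

/-- The `mn × mn` matrix `diag(I_{(m-1)n}, X)`. Here and below, an `mn × mn` matrix is indexed by
pairs (block number, position in the block); the block number `k = 1, …, m`
corresponds to the element `k - 1` of `Fin m`. -/
def diagLast {R : Type} [Zero R] [One R] {n : ℕ} (m : ℕ) (X : Matrix (Fin n) (Fin n) R) :
    Matrix (Fin m × Fin n) (Fin m × Fin n) R :=
  Matrix.of fun p q =>
    if p.1 = q.1 then (if (p.1 : ℕ) + 1 = m then X else 1) p.2 q.2 else 0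

/-- The `mn × r` matrix `e_k ⊗ C`, where `e_k` is the `k`-th column of `I_m`, `1 ≤ k ≤ m`. -/
def colKron {n r : ℕ} (m : ℕ) (k : ℤ) (C : Matrix (Fin n) (Fin r) ℂ) :
    Matrix (Fin m × Fin n) (Fin r) ℂ :=
  Matrix.of fun p j => if ((p.1 : ℕ) : ℤ) + 1 = k then C p.2 j else 0

/-- The `r × mn` matrix `e_kᵀ ⊗ B`, where `e_k` is the `k`-th column of `I_m`, `1 ≤ k ≤ m`. -/
def rowKron {n r : ℕ} (m : ℕ) (k : ℤ) (B : Matrix (Fin r) (Fin n) ℂ) :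
    Matrix (Fin r) (Fin m × Fin n) ℂ :=
  Matrix.of fun i q => if ((q.1 : ℕ) : ℤ) + 1 = k then B i q.2 else 0

/-- `𝕃` is a Rosenbrock strong linearization of `G(λ) = P(λ) + C (λ E - A)⁻¹ B`
(that is, of its system matrix), `m` being the degree of `P(λ)`.
In (a), the right-hand side is `diag(I_{(m-1)n}, 𝒮(λ))` where `𝒮(λ) = [P(λ), C; B, A - λ E]`
occupies the `m`-th block and the last `r` coordinates. -/
def IsRosenbrockStrongLinearization {m n r : ℕ}
    (𝕃 : Matrix ((Fin m × Fin n) ⊕ Fin r) ((Fin m × Fin n) ⊕ Fin r) ℂ[X])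
    (G : Matrix (Fin n) (Fin n) (RatFunc ℂ)) (P : Matrix (Fin n) (Fin n) ℂ[X])
    (A : Matrix (Fin r) (Fin r) ℂ) (B : Matrix (Fin r) (Fin n) ℂ)
    (C : Matrix (Fin n) (Fin r) ℂ) (E : Matrix (Fin r) (Fin r) ℂ) : Prop :=
  ∃ (X₁ Y₁ : Matrix (Fin m × Fin n) (Fin m × Fin n) ℂ)
    (C₁ : Matrix (Fin m × Fin n) (Fin r) ℂ) (B₁ : Matrix (Fin r) (Fin m × Fin n) ℂ)
    (H K : Matrix (Fin r) (Fin r) ℂ)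
    (𝔾 : Matrix (Fin m × Fin n) (Fin m × Fin n) (RatFunc ℂ)),
    -- the form of `𝕃`, and its transfer function
    𝕃 = systemMatrix (cPoly X₁ - (Polynomial.X : ℂ[X]) • cPoly Y₁) H B₁ C₁ K ∧
    𝔾 = transferFunction (cPoly X₁ - (Polynomial.X : ℂ[X]) • cPoly Y₁) H B₁ C₁ K ∧
    -- `K` is nonsingular and `𝕃` is irreducible
    IsMinimalRealization 𝔾 (cPoly X₁ - (Polynomial.X : ℂ[X]) • cPoly Y₁) H B₁ C₁ K ∧
    -- (a)
    (∃ (U V : Matrix (Fin m × Fin n) (Fin m × Fin n) ℂ[X]) (U₀ V₀ : Matrix (Fin r) (Fin r) ℂ),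
      IsUnimodular U ∧ IsUnimodular V ∧ U₀.det ≠ 0 ∧ V₀.det ≠ 0 ∧
      fromBlocks U 0 0 (cPoly U₀) * 𝕃 * fromBlocks V 0 0 (cPoly V₀) =
        systemMatrix (diagLast m P) A (rowKron m m B) (colKron m m C) E) ∧
    -- (b)
    (∃ Oₗ Oᵣ : Matrix (Fin m × Fin n) (Fin m × Fin n) (RatFunc ℂ),
      IsBiproper Oₗ ∧ IsBiproper Oᵣ ∧
      Oₗ * ((RatFunc.X : RatFunc ℂ)⁻¹ • 𝔾) * Oᵣ =
        diagLast m (((RatFunc.X : RatFunc ℂ)⁻¹ ^ m) • G))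

/-! ### Elementary matrices and Fiedler matrices -/

/-- The matrix polynomial `∑_{j=0}^m λ^j A_j`. -/
noncomputable def matPoly {n : ℕ} (m : ℕ) (a : ℕ → Matrix (Fin n) (Fin n) ℂ) :
    Matrix (Fin n) (Fin n) ℂ[X] :=
  ∑ j ∈ Finset.range (m + 1), (Polynomial.X : ℂ[X]) ^ j • cPoly (a j)

/-- The `(p, q)` block of the elementary matrix `M_i(X)`, for `i ∈ {-m, …, m-1}`
(the identity for other `i`). For `1 ≤ |i| ≤ m-1`, the nontrivial `2 × 2` block part sits in
the blocks numbered `m-i-1` and `m-i` when counting from `0`. -/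
def elemBlock {n : ℕ} (m : ℕ) (i : ℤ) (X : Matrix (Fin n) (Fin n) ℂ) (p q : Fin m) :
    Matrix (Fin n) (Fin n) ℂ :=
  if i = 0 then
    -- diag(I_{(m-1)n}, X)
    if p = q then (if (p : ℕ) + 1 = m then X else 1) else 0
  else if i = -(m : ℤ) then
    -- diag(X, I_{(m-1)n})
    if p = q then (if (p : ℕ) = 0 then X else 1) else 0
  else if i.natAbs < m then
    -- diag(I, [X, I; I, 0], I) if i > 0,  diag(I, [0, I; I, X], I) if i < 0
    if (p : ℕ) + i.natAbs + 1 = m ∧ (q : ℕ) + i.natAbs + 1 = m then (if 0 < i then X else 0)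
    else if (p : ℕ) + i.natAbs + 1 = m ∧ (q : ℕ) + i.natAbs = m then 1
    else if (p : ℕ) + i.natAbs = m ∧ (q : ℕ) + i.natAbs + 1 = m then 1
    else if (p : ℕ) + i.natAbs = m ∧ (q : ℕ) + i.natAbs = m then (if 0 < i then 0 else X)
    else if p = q then 1 else 0
  else
    if p = q then 1 else 0

/-- The `mn × mn` elementary matrix `M_i(X)`. -/
def elemM {n : ℕ} (m : ℕ) (i : ℤ) (X : Matrix (Fin n) (Fin n) ℂ) :
    Matrix (Fin m × Fin n) (Fin m × Fin n) ℂ :=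
  Matrix.of fun p q => elemBlock m i X p.1 q.1 p.2 q.2

/-- The Fiedler matrix `M_i^P`: it is `M_i(-A_i)` if `i ≥ 0` and `M_i(A_{-i})` if `i < 0`. -/
noncomputable def fiedlerP {n : ℕ} (m : ℕ) (a : ℕ → Matrix (Fin n) (Fin n) ℂ) (i : ℤ) :
    Matrix (Fin m × Fin n) (Fin m × Fin n) ℂ :=
  elemM m i (if 0 ≤ i then -a i.natAbs else a i.natAbs)

/-- `diag(M, I_r)`. -/
def extendOne {m n : ℕ} (r : ℕ) (M : Matrix (Fin m × Fin n) (Fin m × Fin n) ℂ) :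
    Matrix ((Fin m × Fin n) ⊕ Fin r) ((Fin m × Fin n) ⊕ Fin r) ℂ :=
  fromBlocks M 0 0 1

/-- The Fiedler matrices `𝕄_i^𝒮` of the system matrix `𝒮(λ) = [P(λ), C; B, A - λ E]`,
`i ∈ {-m, …, m-1}`. -/
noncomputable def fiedlerS {n r : ℕ} (m : ℕ) (a : ℕ → Matrix (Fin n) (Fin n) ℂ)
    (A : Matrix (Fin r) (Fin r) ℂ) (B : Matrix (Fin r) (Fin n) ℂ)
    (C : Matrix (Fin n) (Fin r) ℂ) (E : Matrix (Fin r) (Fin r) ℂ) (i : ℤ) :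
    Matrix ((Fin m × Fin n) ⊕ Fin r) ((Fin m × Fin n) ⊕ Fin r) ℂ :=
  if i = 0 then fromBlocks (fiedlerP m a 0) (-colKron m m C) (-rowKron m m B) (-A)
  else if i = -(m : ℤ) then fromBlocks (fiedlerP m a (-(m : ℤ))) 0 0 (-E)
  else if 0 < i then extendOne r (fiedlerP m a i)
  else (extendOne r (fiedlerP m a (-i)))⁻¹

/-! ### Index tuples -/

/-- The string `(k : l) = (k, k+1, …, l)`, which is empty if `k > l`. -/
def str (k l : ℤ) : List ℤ := (List.range (l - k + 1).toNat).map fun s => k + (s : ℤ)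

/-- The admissible tuple `(h-1:h, h-3:h-2, …, p+1:p+2, 0:p)` of `{0:h}` with index `p`
(for `p ≤ h` and `h - p` even). -/
def admissibleTuple (h p : ℕ) : List ℤ :=
  ((List.range ((h - p) / 2)).flatMap fun k => str ((h : ℤ) - 2 * k - 1) ((h : ℤ) - 2 * k))
    ++ str 0 p

/-- The symmetric complement
`(h-1, h-3, …, p+1, 0:p-1, 0:p-2, …, 0:1, 0)` of the admissible tuple of `{0:h}` with index `p`. -/
def symmComplement (h p : ℕ) : List ℤ :=
  ((List.range ((h - p) / 2)).map fun k => (h : ℤ) - 2 * k - 1)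
    ++ (List.range p).flatMap fun k => str 0 ((p : ℤ) - 1 - k)

/-- The simple admissible tuple of `{0:h}`: its index is `0` or `1`, with the parity of `h`. -/
def simpleTuple (h : ℕ) : List ℤ := admissibleTuple h (h % 2)

/-- The symmetric complement of the simple admissible tuple of `{0:h}`. -/
def simpleComplement (h : ℕ) : List ℤ := symmComplement h (h % 2)

/-- The translate `t + k` of an index tuple. -/
def shift (k : ℤ) (t : List ℤ) : List ℤ := t.map (· + k)

/-- `t` is in canonical form for `h`:
`t = (a₁ : h-2, a₂ : h-4, …, a_{⌊h/2⌋} : h - 2⌊h/2⌋)` with `a_i ≥ 0`. -/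
def IsCanonical (h : ℕ) (t : List ℤ) : Prop :=
  ∃ c : ℕ → ℕ, t = (List.range (h / 2)).flatMap fun k => str (c k) ((h : ℤ) - 2 * ((k : ℤ) + 1))

/-- The number `i_t(α)` of consecutive inversions of `α` at `t`: the largest `s` for which
`(t+s, …, t+1, t)` is a subtuple of `α`, and `-1` if `t` does not occur in `α`. -/
def inversionsAt (t : ℤ) (α : List ℤ) : ℤ :=
  if t ∈ α then (Nat.findGreatest (fun s => (str t (t + s)).reverse.Sublist α) α.length : ℤ)
  else -1

/-- `𝒳` is a nonsingular matrix assignment for the index tuple `t`: one matrix for each position,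
nonsingular at the positions occupied by the indices `0` and `-m`. -/
def IsNonsingularAssignment {n : ℕ} (m : ℕ) (t : List ℤ) (𝒳 : List (Matrix (Fin n) (Fin n) ℂ)) :
    Prop :=
  𝒳.length = t.length ∧ ∀ x ∈ t.zip 𝒳, (x.1 = 0 ∨ x.1 = -(m : ℤ)) → x.2.det ≠ 0

/-! ### The pencils `L_P` and `𝕃_𝒮` -/

/-- `M_t(𝒳) = M_{t₁}(X₁) ⋯ M_{t_k}(X_k)`. -/
def prodM {n : ℕ} (m : ℕ) (t : List ℤ) (𝒳 : List (Matrix (Fin n) (Fin n) ℂ)) :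
    Matrix (Fin m × Fin n) (Fin m × Fin n) ℂ :=
  (List.zipWith (fun i X => elemM m i X) t 𝒳).prod

/-- `M_t^P = M_{t₁}^P ⋯ M_{t_k}^P`. -/
noncomputable def prodP {n : ℕ} (m : ℕ) (a : ℕ → Matrix (Fin n) (Fin n) ℂ) (t : List ℤ) :
    Matrix (Fin m × Fin n) (Fin m × Fin n) ℂ :=
  (t.map (fiedlerP m a)).prod

/-- `𝕄_t(𝒳) = 𝕄_{t₁}(X₁) ⋯ 𝕄_{t_k}(X_k)`, where `𝕄_i(X) = diag(M_i(X), I_r)`. -/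
def prodMM {n : ℕ} (m r : ℕ) (t : List ℤ) (𝒳 : List (Matrix (Fin n) (Fin n) ℂ)) :
    Matrix ((Fin m × Fin n) ⊕ Fin r) ((Fin m × Fin n) ⊕ Fin r) ℂ :=
  (List.zipWith (fun i X => extendOne r (elemM m i X)) t 𝒳).prod

/-- `𝕄_t^P = 𝕄_{t₁}^P ⋯ 𝕄_{t_k}^P`, where `𝕄_i^P = diag(M_i^P, I_r)`. -/
noncomputable def prodPP {n : ℕ} (m r : ℕ) (a : ℕ → Matrix (Fin n) (Fin n) ℂ) (t : List ℤ) :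
    Matrix ((Fin m × Fin n) ⊕ Fin r) ((Fin m × Fin n) ⊕ Fin r) ℂ :=
  (t.map fun i => extendOne r (fiedlerP m a i)).prod

/-- `𝕄_t^𝒮 = 𝕄_{t₁}^𝒮 ⋯ 𝕄_{t_k}^𝒮`. -/
noncomputable def prodSS {n r : ℕ} (m : ℕ) (a : ℕ → Matrix (Fin n) (Fin n) ℂ)
    (A : Matrix (Fin r) (Fin r) ℂ) (B : Matrix (Fin r) (Fin n) ℂ)
    (C : Matrix (Fin n) (Fin r) ℂ) (E : Matrix (Fin r) (Fin r) ℂ) (t : List ℤ) :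
    Matrix ((Fin m × Fin n) ⊕ Fin r) ((Fin m × Fin n) ⊕ Fin r) ℂ :=
  (t.map (fiedlerS m a A B C E)).prod

/-- The pencil `L_P(h, t_w, t_v, 𝒳, 𝒴)`, that is,
`M_{(t_v, t_w)}(𝒴, 𝒳) (λ M_v^P - M_w^P) M_{(c_w, c_v)}^P M_{(rev t_w, rev t_v)}(rev 𝒳, rev 𝒴)`,
where `w` and `v + m` are the simple admissible tuples of `{0:h}` and `{0:m-h-1}`, with symmetric
complements `c_w` and `c_v + m`. -/
noncomputable def pencilP {n : ℕ} (m h : ℕ) (a : ℕ → Matrix (Fin n) (Fin n) ℂ) (tw tv : List ℤ)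
    (𝒳 𝒴 : List (Matrix (Fin n) (Fin n) ℂ)) :
    Matrix (Fin m × Fin n) (Fin m × Fin n) ℂ[X] :=
  cPoly (prodM m (tv ++ tw) (𝒴 ++ 𝒳)) *
    ((Polynomial.X : ℂ[X]) • cPoly (prodP m a (shift (-m) (simpleTuple (m - h - 1))))
      - cPoly (prodP m a (simpleTuple h))) *
    cPoly (prodP m a (simpleComplement h ++ shift (-m) (simpleComplement (m - h - 1)))) *
    cPoly (prodM m (tw.reverse ++ tv.reverse) (𝒳.reverse ++ 𝒴.reverse))

/-- The pencil `𝕃_𝒮(h, t_w, t_v, 𝒳, 𝒴)`, that is,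
`𝕄_{(t_v, t_w)}(𝒴, 𝒳) (λ 𝕄_v^𝒮 - 𝕄_w^𝒮) 𝕄_{(c_w, c_v)}^P 𝕄_{(rev t_w, rev t_v)}(rev 𝒳, rev 𝒴)`,
associated with `𝒮(λ) = [P(λ), C; B, A - λ E]`. -/
noncomputable def pencilS {n r : ℕ} (m h : ℕ) (a : ℕ → Matrix (Fin n) (Fin n) ℂ)
    (A : Matrix (Fin r) (Fin r) ℂ) (B : Matrix (Fin r) (Fin n) ℂ)
    (C : Matrix (Fin n) (Fin r) ℂ) (E : Matrix (Fin r) (Fin r) ℂ) (tw tv : List ℤ)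
    (𝒳 𝒴 : List (Matrix (Fin n) (Fin n) ℂ)) :
    Matrix ((Fin m × Fin n) ⊕ Fin r) ((Fin m × Fin n) ⊕ Fin r) ℂ[X] :=
  cPoly (prodMM m r (tv ++ tw) (𝒴 ++ 𝒳)) *
    ((Polynomial.X : ℂ[X]) • cPoly (prodSS m a A B C E (shift (-m) (simpleTuple (m - h - 1))))
      - cPoly (prodSS m a A B C E (simpleTuple h))) *
    cPoly (prodPP m r a (simpleComplement h ++ shift (-m) (simpleComplement (m - h - 1)))) *
    cPoly (prodMM m r (tw.reverse ++ tv.reverse) (𝒳.reverse ++ 𝒴.reverse))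

end RosenbrockGFPR

open RosenbrockGFPR

/-! Number the blocks from the bottom (levels), so that $M_{\pm i}$ touches only the levels $i-1$
and $i$; factors whose indices differ by at least two in absolute value then commute. Sorting the
factors of $M^P_{\mathbf v}$ and $M^P_{\mathbf w}$ by parity, which works because $h$ is even, gives
$\lambda M^P_{\mathbf v}-M^P_{\mathbf w}=Q(\lambda M^P_{-m}\mathcal O-\mathcal E)$. Here $Q$ is
constant and nonsingular (`outerFactor`), and $\mathcal O$, $\mathcal E$ are the products of all odd
negative and of all even nonnegative Fiedler matrices. The bracket (`theta`) is block tridiagonal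
and independent of $h$, so $L$ is strictly equivalent to one fixed pencil (`exists_strict_equiv`).
The constant factor on the right contains $M^P_{-m}$ exactly when $m$ is even, and then $A_m$ must
be nonsingular.

Finite part: an explicit block column built from Horner shifts is mapped by `theta` to $P(\lambda)$
in level $0$ and to zero elsewhere (`sum_theta_mul_colUp`). Replacing a column of the identity by it
splits off $P$; what remains is unimodular, being triangular after a permutation
(`exists_equiv_diagLast`). The transformations fix the last block column and row, so $B$ and $C$
come along unchanged.

Infinity: $\lambda^{-1}\mathbb G$ is the same tridiagonal array at the parameters
$(1,\lambda^{-1})$, with $A_0$ replaced by $A_0+C(\lambda E-A)^{-1}B$ (`theta_cRat`). For odd $m$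
the mirrored column splits off $\lambda^{-m}G$ at the top level, and the remaining factor has a
nonsingular limit whatever $A_m$ is. If $A_m$ is nonsingular, the array itself has a nonsingular
limit (`exists_biproper_theta`).

Block form: $M_{s+1}(X)$ moves a block column from level $s$ to level $s+1$, and factors with
$|i|\notin\{s,s+1\}$ fix it. Reading a tuple from the right, the level reached is exactly the number
of consecutive inversions (`track`, `inversionsAt_zero`); canonical form ensures that the dangerous
index $s$ is never met (`track_canonical`). Rows follow by transposition.

Symmetry: both coefficients have the form $XSX$ with $X$ and $S$ products of commuting symmetric
matrices (`isSymm_coefficients`), and the outer factors act by congruence. Irreducibility is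
inherited by looking at the single block that contains $B$ and $C$
(`isMinimalRealization_of_block`). -/

namespace RosenbrockGFPR

/-! ### Block matrices described by levels -/

/-- The level of a block number: the last block has level `0`. -/
def lvl {m : ℕ} (p : Fin m) : ℕ := m - 1 - p

theorem lvl_lt {m : ℕ} (p : Fin m) : lvl p < m := by
  have := p.2
  unfold lvl
  omega

theorem lvl_inj {m : ℕ} {p q : Fin m} : lvl p = lvl q ↔ p = q := by
  have := p.2
  have := q.2
  rw [Fin.ext_iff]
  unfold lvl
  omega

theorem val_add_eq_iff_lvl {m : ℕ} (p : Fin m) (i : ℕ) : (p : ℕ) + i + 1 = m ↔ lvl p = i := by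
  have := p.2
  unfold lvl
  omega

theorem sum_lvl {m : ℕ} {M : Type*} [AddCommMonoid M] (F : ℕ → M) :
    ∑ p : Fin m, F (lvl p) = ∑ k ∈ Finset.range m, F k := by
  rw [← Finset.sum_range_reflect, ← Fin.sum_univ_eq_sum_range (fun k => F (m - 1 - k))]
  rfl

/-- The block matrix with given entries at each pair of levels. -/
def ofLvl {R : Type*} (m : ℕ) (θ : ℕ → ℕ → R) : Matrix (Fin m) (Fin m) R :=
  Matrix.of fun p q => θ (lvl p) (lvl q)

theorem one_apply_lvl {R : Type*} [Zero R] [One R] {m : ℕ} (p q : Fin m) :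
    (1 : Matrix (Fin m) (Fin m) R) p q = if lvl p = lvl q then 1 else 0 := by
  simp only [Matrix.one_apply, lvl_inj]

theorem sum_tridiagonal {R : Type*} [NonUnitalNonAssocSemiring R] (m : ℕ) (θ : ℕ → ℕ → R) (k : ℕ)
    (hk : k < m) (hθ : ∀ l, l ≠ k → l + 1 ≠ k → l ≠ k + 1 → θ k l = 0) (g : ℕ → R) :
    ∑ l ∈ Finset.range m, θ k l * g l = θ k k * g k
      + (if 1 ≤ k then θ k (k - 1) * g (k - 1) else 0)
      + (if k + 1 < m then θ k (k + 1) * g (k + 1) else 0) := by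
  have h : ∀ l, θ k l * g l = (if l = k then θ k k * g k else 0)
      + (if l = k - 1 then (if 1 ≤ k then θ k (k - 1) * g (k - 1) else 0) else 0)
      + (if l = k + 1 then θ k (k + 1) * g (k + 1) else 0) := by
    intro l
    by_cases h1 : l = k
    · subst h1
      by_cases h2 : 1 ≤ l
      · have : l ≠ l - 1 := by omega
        simp [this]
      · simp [h2]
    · by_cases h2 : l + 1 = k
      · subst h2
        have : l ≠ l + 1 + 1 := by omega
        simp [this]
      · by_cases h3 : l = k + 1
        · subst h3
          have : ¬ (k + 1 = k - 1) := by omega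
          simp [this]
        · rw [hθ l h1 h2 h3]
          by_cases h4 : 1 ≤ k
          · have : ¬ l = k - 1 := by omega
            simp [h1, h3, this]
          · simp [h1, h3, h4]
  rw [Finset.sum_congr rfl fun l _ => h l, Finset.sum_add_distrib, Finset.sum_add_distrib,
    Finset.sum_ite_eq', Finset.sum_ite_eq', Finset.sum_ite_eq']
  have : k - 1 < m := by omega
  simp [hk, this]

/-- The tridiagonal array with diagonal `d` and with `1` at the off-diagonal places
`(j-1, j)`, `(j, j-1)`, `j ∈ S`. -/
def tri {R : Type*} [Zero R] [One R] (S : ℕ → Prop) [DecidablePred S] (d : ℕ → R) (k l : ℕ) : R :=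
  if k = l then d k else if (k = l + 1 ∧ S k) ∨ (l = k + 1 ∧ S l) then 1 else 0

/-- At each level either the column of the left factor or the row of the right factor is that of the
identity. Hence $(M-1)(N-1)=0$ and $MN=M+N-1$, so the off-diagonal ones simply accumulate. -/
theorem ofLvl_tri_mul {R : Type*} [Ring R] (m : ℕ) (S T : ℕ → Prop) [DecidablePred S]
    [DecidablePred T] (d e : ℕ → R)
    (hd : ∀ k < m, (d k = 1 ∧ ¬ S k ∧ ¬ S (k + 1)) ∨ (e k = 1 ∧ ¬ T k ∧ ¬ T (k + 1))) :
    ofLvl m (tri S d) * ofLvl m (tri T e) =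
      ofLvl m (tri (fun k => S k ∨ T k) (fun k => d k * e k)) := by
  have h0 : (ofLvl m (tri S d) - 1) * (ofLvl m (tri T e) - 1) = 0 := by
    ext p q
    rw [Matrix.mul_apply]
    refine Finset.sum_eq_zero fun k _ => ?_
    rcases hd (lvl k) (lvl_lt k) with ⟨h1, h2, h3⟩ | ⟨h1, h2, h3⟩
    · have : (ofLvl m (tri S d) - 1) p k = 0 := by
        rw [Matrix.sub_apply, one_apply_lvl]
        simp only [ofLvl, tri, Matrix.of_apply]
        split_ifs with g1 g2
        · rw [g1, h1, sub_self]
        · rcases g2 with ⟨g, g'⟩ | ⟨g, g'⟩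
          · rw [g] at g'; exact absurd g' h3
          · exact absurd g' h2
        · simp
      rw [this, zero_mul]
    · have : (ofLvl m (tri T e) - 1) k q = 0 := by
        rw [Matrix.sub_apply, one_apply_lvl]
        simp only [ofLvl, tri, Matrix.of_apply]
        split_ifs with g1 g2
        · rw [h1, sub_self]
        · rcases g2 with ⟨g, g'⟩ | ⟨g, g'⟩
          · exact absurd g' h2
          · rw [g] at g'; exact absurd g' h3
        · simp
      rw [this, mul_zero]
  have h1 : ofLvl m (tri S d) * ofLvl m (tri T e) =
      ofLvl m (tri S d) + ofLvl m (tri T e) - 1 := by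
    rw [← sub_eq_zero, ← h0]
    noncomm_ring
  rw [h1]
  ext1 p q
  rw [Matrix.sub_apply, Matrix.add_apply, one_apply_lvl]
  simp only [ofLvl, tri, Matrix.of_apply]
  have hp := hd (lvl p) (lvl_lt p)
  have hq := hd (lvl q) (lvl_lt q)
  by_cases g1 : lvl p = lvl q
  · simp only [if_pos g1]
    rcases hp with ⟨h, -⟩ | ⟨h, -⟩ <;> rw [h] <;> simp
  · simp only [if_neg g1]
    by_cases g2 : lvl p = lvl q + 1
    · have g3 : ¬ lvl q = lvl p + 1 := by omega
      rw [← g2] at hq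
      simp only [g3, false_and, or_false]
      simp only [g2, true_and]
      simp only [← g2]
      rcases hp with ⟨-, h, -⟩ | ⟨-, h, -⟩ <;> simp [h]
    · by_cases g3 : lvl q = lvl p + 1
      · rw [← g3] at hp
        simp only [g2, false_and, false_or]
        simp only [g3, true_and]
        simp only [← g3]
        rcases hp with ⟨-, -, h⟩ | ⟨-, -, h⟩ <;> simp [h]
      · simp [g2, g3]

/-! ### Elementary matrices as block matrices -/

/-- The elementary matrix `M_i(X)` as an `m × m` matrix of blocks. -/
def elemB {n : ℕ} (m : ℕ) (i : ℤ) (X : Matrix (Fin n) (Fin n) ℂ) :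
    Matrix (Fin m) (Fin m) (Matrix (Fin n) (Fin n) ℂ) :=
  elemBlock m i X

theorem compRingEquiv_elemB {n : ℕ} (m : ℕ) (i : ℤ) (X : Matrix (Fin n) (Fin n) ℂ) :
    compRingEquiv (Fin m) (Fin n) ℂ (elemB m i X) = elemM m i X := rfl

/-- The diagonal blocks of the elementary matrix `M_i(X)`. -/
def elemDiag {n : ℕ} (i : ℤ) (X : Matrix (Fin n) (Fin n) ℂ) (k : ℕ) :
    Matrix (Fin n) (Fin n) ℂ :=
  if k = i.natAbs then (if 0 ≤ i then X else 0)
    else if k + 1 = i.natAbs then (if 0 ≤ i then 0 else X) else 1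

/-- Truncation to the levels $0,\dots,m-1$ absorbs the exceptional indices: for $i=0$ the level $-1$
is missing, for $i=-m$ the level $m$ is, and in either case only one diagonal block remains. -/
theorem elemB_eq {n : ℕ} (m : ℕ) (i : ℤ) (X : Matrix (Fin n) (Fin n) ℂ) (h1 : -(m : ℤ) ≤ i)
    (h2 : i < m) : elemB m i X = ofLvl m (tri (fun j => j = i.natAbs) (elemDiag i X)) := by
  ext1 p q
  have hp := lvl_lt p
  have hq := lvl_lt q
  have e1 : ∀ p : Fin m, ((p : ℕ) + i.natAbs + 1 = m) = (lvl p = i.natAbs) := fun p => by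
    rw [val_add_eq_iff_lvl]
  have e2 : ∀ p : Fin m, ((p : ℕ) + i.natAbs = m) = (lvl p + 1 = i.natAbs) := fun p => by
    have := p.2
    rw [eq_iff_iff]
    unfold lvl
    omega
  have e3 : ∀ p : Fin m, ((p : ℕ) + 1 = m) = (lvl p = 0) := fun p => by
    rw [← val_add_eq_iff_lvl, add_zero]
  have e4 : ((p : ℕ) = 0) = (lvl p + 1 = m) := by
    have := p.2
    rw [eq_iff_iff]
    unfold lvl
    omega
  simp only [elemB, elemBlock, e1, e2, e3, e4, ← lvl_inj, ofLvl, tri, elemDiag, Matrix.of_apply]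
  generalize lvl p = k at *
  generalize lvl q = l at *
  by_cases g1 : k = l
  · subst g1
    split_ifs <;> first | rfl | omega
  · split_ifs <;> first | rfl | omega

/-- Two indices are far apart when their elementary matrices act on different blocks. -/
def Far (i j : ℤ) : Prop := i.natAbs + 2 ≤ j.natAbs ∨ j.natAbs + 2 ≤ i.natAbs

theorem elemB_commute {n : ℕ} (m : ℕ) {i j : ℤ} (X Y : Matrix (Fin n) (Fin n) ℂ)
    (hi : -(m : ℤ) ≤ i) (hi' : i < m) (hj : -(m : ℤ) ≤ j) (hj' : j < m) (h : Far i j) :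
    Commute (elemB m i X) (elemB m j Y) := by
  have key : ∀ k < m, k ≠ i.natAbs ∧ k + 1 ≠ i.natAbs ∨ k ≠ j.natAbs ∧ k + 1 ≠ j.natAbs := by
    intro k _
    rcases h with h | h <;> omega
  unfold Commute SemiconjBy
  rw [elemB_eq m i X hi hi', elemB_eq m j Y hj hj', ofLvl_tri_mul, ofLvl_tri_mul]
  · congr 1
    ext1 k; ext1 l
    have : ∀ k, (k = i.natAbs ∨ k = j.natAbs) = (k = j.natAbs ∨ k = i.natAbs) := fun k => by
      rw [or_comm]
    by_cases hkl : k = l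
    · simp only [tri, if_pos hkl]
      simp only [elemDiag]
      split_ifs <;> first | simp | (exfalso; rcases h with h | h <;> omega)
    · simp only [tri, if_neg hkl, this]
  · intro k hk
    rcases key k hk with ⟨h1, h2⟩ | ⟨h1, h2⟩
    · right; simp [elemDiag, h1, h2]
    · left; simp [elemDiag, h1, h2]
  · intro k hk
    rcases key k hk with ⟨h1, h2⟩ | ⟨h1, h2⟩
    · left; simp [elemDiag, h1, h2]
    · right; simp [elemDiag, h1, h2]

theorem elemM_commute {n : ℕ} (m : ℕ) {i j : ℤ} (X Y : Matrix (Fin n) (Fin n) ℂ)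
    (hi : -(m : ℤ) ≤ i) (hi' : i < m) (hj : -(m : ℤ) ≤ j) (hj' : j < m) (h : Far i j) :
    Commute (elemM m i X) (elemM m j Y) := by
  rw [← compRingEquiv_elemB, ← compRingEquiv_elemB]
  exact (elemB_commute m X Y hi hi' hj hj' h).map (compRingEquiv (Fin m) (Fin n) ℂ)

/-- The product of elementary matrices with indices that are far apart. -/
theorem prod_elemB {n : ℕ} (m : ℕ) (x : ℤ → Matrix (Fin n) (Fin n) ℂ) (t : List ℤ)
    (ht : ∀ i ∈ t, -(m : ℤ) ≤ i ∧ i < m) (hf : t.Pairwise Far) (d : ℕ → Matrix (Fin n) (Fin n) ℂ)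
    (hd1 : ∀ i ∈ t, ∀ k < m, (k = i.natAbs ∨ k + 1 = i.natAbs) → d k = elemDiag i (x i) k)
    (hd2 : ∀ k < m, (∀ i ∈ t, k ≠ i.natAbs ∧ k + 1 ≠ i.natAbs) → d k = 1) :
    (t.map fun i => elemB m i (x i)).prod =
      ofLvl m (tri (fun k => k ∈ t.map Int.natAbs) d) := by
  induction t generalizing d with
  | nil =>
    ext1 p q
    simp only [List.map_nil, List.prod_nil, ofLvl, tri, Matrix.of_apply, one_apply_lvl]
    split_ifs with g1 g2
    · rw [hd2 _ (lvl_lt p)]; simp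
    · simp at g2
    · rfl
  | cons i t ih =>
    have hi := ht i (by simp)
    rw [List.pairwise_cons] at hf
    have key : ∀ k, (k = i.natAbs ∨ k + 1 = i.natAbs) → ∀ j ∈ t, k ≠ j.natAbs ∧ k + 1 ≠ j.natAbs := by
      intro k hk j hj
      rcases hf.1 j hj with h | h <;> omega
    -- The tail acts as the identity on the two levels of `i`, so its diagonal is `d` reset to `1`
    -- there.
    rw [List.map_cons, List.prod_cons, ih (fun j hj => ht j (by simp [hj])) hf.2
      (fun k => if k = i.natAbs ∨ k + 1 = i.natAbs then 1 else d k), elemB_eq m i _ hi.1 hi.2,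
      ofLvl_tri_mul]
    · ext1 p q
      simp only [ofLvl, tri, Matrix.of_apply, List.map_cons, List.mem_cons]
      by_cases hpq : lvl p = lvl q
      · simp only [if_pos hpq]
        by_cases h : lvl p = i.natAbs ∨ lvl p + 1 = i.natAbs
        · rw [if_pos h, mul_one, hd1 i (by simp) _ (lvl_lt p) h]
        · rw [if_neg h]
          push Not at h
          simp [elemDiag, h]
      · simp only [if_neg hpq]
    · intro k hk
      by_cases h : k = i.natAbs ∨ k + 1 = i.natAbs
      · right
        refine ⟨if_pos h, ?_, ?_⟩ <;> simp only [List.mem_map, not_exists, not_and]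
        · exact fun j hj => (key k h j hj).1.symm
        · exact fun j hj => (key k h j hj).2.symm
      · left
        push Not at h
        simp [elemDiag, h]
    · intro j hj k hk h
      have : ¬ (k = i.natAbs ∨ k + 1 = i.natAbs) := fun h' => by
        have := key k h' j hj
        omega
      rw [if_neg this]
      exact hd1 j (by simp [hj]) k hk h
    · intro k hk h
      split_ifs with g
      · rfl
      · push Not at g
        refine hd2 k hk fun j hj => ?_
        rcases List.mem_cons.1 hj with rfl | hj
        · exact g
        · exact h j hj

/-- The blocks $\begin{bmatrix}X&I\\I&0\end{bmatrix}$ and $\begin{bmatrix}0&I\\I&-X\end{bmatrix}$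
are mutually inverse. Negating an index thus inverts a Fiedler factor, the sign convention $-A_i$,
$A_{-i}$ being made for this. -/
theorem elemB_mul_elemB_neg {n : ℕ} (m : ℕ) {i : ℤ} (h0 : i ≠ 0) (h1 : i.natAbs < m)
    (X : Matrix (Fin n) (Fin n) ℂ) : elemB m i X * elemB m (-i) (-X) = 1 := by
  rw [elemB_eq m i X (by omega) (by omega), elemB_eq m (-i) (-X) (by omega) (by omega)]
  ext1 p q
  rw [Matrix.mul_apply, one_apply_lvl]
  simp only [ofLvl, Matrix.of_apply]
  have hp := lvl_lt p
  have hq := lvl_lt q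
  rw [sum_lvl (fun k => tri (fun j => j = i.natAbs) (elemDiag i X) (lvl p) k *
    tri (fun j => j = (-i).natAbs) (elemDiag (-i) (-X)) k (lvl q)), sum_tridiagonal m _ _ hp]
  swap
  · intro l _ _ _
    unfold tri
    rw [if_neg (by omega), if_neg (by omega)]
  generalize lvl p = k at *
  generalize lvl q = l at *
  simp only [Int.natAbs_neg, elemDiag, tri]
  obtain ⟨s, hs⟩ : ∃ s, i.natAbs = s + 1 := ⟨i.natAbs - 1, by omega⟩
  rw [hs] at h1 ⊢
  have hi : (0 ≤ i ∧ ¬ 0 ≤ -i) ∨ (¬ 0 ≤ i ∧ 0 ≤ -i) := by omega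
  by_cases k1 : k = s + 1
  · subst k1
    rcases hi with ⟨a, b⟩ | ⟨a, b⟩ <;> simp only [a, b]
    all_goals
      by_cases l1 : l = s + 1
      · subst l1; simp
      · by_cases l2 : l = s
        · subst l2; simp
        · have := Ne.symm l1
          have := Ne.symm l2
          simp [*]
  · by_cases k2 : k = s
    · subst k2
      have hk1 : 1 ≤ k → k ≠ k - 1 := by omega
      rcases hi with ⟨a, b⟩ | ⟨a, b⟩ <;> simp only [a, b]
      all_goals
        by_cases l1 : l = k + 1
        · subst l1
          simp [h1]
          try (intro c c'; exact absurd c' (hk1 c))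
        · by_cases l2 : l = k
          · subst l2
            simp [h1]
            try (intro c _ _ c'; exact absurd c' (hk1 c))
          · have := Ne.symm l1
            have := Ne.symm l2
            simp [*]
            try (intro c _ _ c'; exact absurd c' (hk1 c))
    · have b2 : k ≠ k - 1 ∨ ¬ 1 ≤ k := by omega
      have b4 : ∀ j, ¬ (j = k + 1 ∧ j = s + 1) := fun j => by omega
      simp only [k1, k2, b4, if_false, Nat.add_right_cancel_iff]
      rcases b2 with b2 | b2 <;> simp [b2]

theorem elemM_mul_elemM_neg {n : ℕ} (m : ℕ) {i : ℤ} (h0 : i ≠ 0) (h1 : i.natAbs < m)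
    (X : Matrix (Fin n) (Fin n) ℂ) : elemM m i X * elemM m (-i) (-X) = 1 := by
  rw [← compRingEquiv_elemB, ← compRingEquiv_elemB, ← map_mul, elemB_mul_elemB_neg m h0 h1,
    map_one]

theorem elemM_transpose {n : ℕ} (m : ℕ) (i : ℤ) (X : Matrix (Fin n) (Fin n) ℂ) :
    (elemM m i X)ᵀ = elemM m i Xᵀ := by
  ext ⟨p, c⟩ ⟨q, d⟩
  have hpq : ∀ A B : Matrix (Fin n) (Fin n) ℂ, (q = p → A d c = B c d) →
      (if q = p then A else 0) d c = (if p = q then B else 0) c d := by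
    intro A B h
    by_cases e : q = p
    · rw [if_pos e, if_pos e.symm, h e]
    · rw [if_neg e, if_neg (Ne.symm e)]; rfl
  have h1 : (1 : Matrix (Fin n) (Fin n) ℂ) d c = (1 : Matrix (Fin n) (Fin n) ℂ) c d := by
    simp only [Matrix.one_apply, eq_comm]
  simp only [elemM, elemBlock, Matrix.transpose_apply, Matrix.of_apply]
  split_ifs with g0 g1 g2
  all_goals first
    | rfl
    | exact h1
    | (exfalso; omega)

/-- Only the indices $0$ and $-m$ put $X$ on the diagonal of a block diagonal matrix; every other
elementary matrix is invertible for arbitrary $X$. -/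
theorem det_elemM_ne_zero {n : ℕ} (m : ℕ) (i : ℤ) (X : Matrix (Fin n) (Fin n) ℂ)
    (h : (i = 0 ∨ i = -(m : ℤ)) → X.det ≠ 0) : (elemM m i X).det ≠ 0 := by
  by_cases h0 : i = 0 ∨ i = -(m : ℤ)
  · have hX := Matrix.mul_nonsing_inv X (isUnit_iff_ne_zero.2 (h h0))
    have : elemM m i X * elemM m i X⁻¹ = 1 := by
      have hd : ∀ Z, elemM m i Z = compRingEquiv (Fin m) (Fin n) ℂ (Matrix.diagonal fun p =>
          if (if i = 0 then (p : ℕ) + 1 = m else (p : ℕ) = 0) then Z else 1) := fun Z => by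
        rw [← compRingEquiv_elemB]
        congr 1
        ext1 p q
        rw [Matrix.diagonal_apply]
        simp only [elemB, elemBlock]
        by_cases h1 : i = 0
        · simp only [h1, if_true]
        · simp only [h1, false_or] at h0
          have : ¬ -(m : ℤ) = 0 := by rwa [← h0]
          simp only [h0, this, if_true, if_false]
      rw [hd, hd, ← map_mul, Matrix.diagonal_mul_diagonal,
        ← map_one (compRingEquiv (Fin m) (Fin n) ℂ), ← Matrix.diagonal_one]
      congr 2
      ext1 p
      by_cases hp : (if i = 0 then (p : ℕ) + 1 = m else (p : ℕ) = 0)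
      · rw [if_pos hp, if_pos hp, hX]
      · rw [if_neg hp, if_neg hp]
        simp
    intro h'
    have := congrArg Matrix.det this
    rw [Matrix.det_mul, h', zero_mul, Matrix.det_one] at this
    exact zero_ne_one this
  · push Not at h0
    by_cases h1 : i.natAbs < m
    · have := congrArg Matrix.det (elemM_mul_elemM_neg m h0.1 h1 X)
      intro h'
      rw [Matrix.det_mul, h', zero_mul, Matrix.det_one] at this
      exact zero_ne_one this
    · have : elemM m i X = 1 := by
        rw [← compRingEquiv_elemB, ← map_one (compRingEquiv (Fin m) (Fin n) ℂ)]
        congr 1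
        ext1 p q
        simp only [elemB, elemBlock, h0, h1, if_false, Matrix.one_apply]
      rw [this, Matrix.det_one]
      exact one_ne_zero

/-! ### Index tuples -/

/-- The tuple `(k, k-2, …)` of positive integers. -/
def altTuple : ℕ → List ℤ
  | 0 => []
  | 1 => [1]
  | (k + 2) => ((k : ℤ) + 2) :: altTuple k

theorem mem_altTuple {k : ℕ} {i : ℤ} :
    i ∈ altTuple k ↔ 1 ≤ i ∧ i ≤ k ∧ i % 2 = (k : ℤ) % 2 := by
  induction k using Nat.twoStepInduction with
  | zero => simp [altTuple]; omega
  | one => simp [altTuple]; omega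
  | more k ih _ =>
    simp only [altTuple, List.mem_cons, ih]
    push_cast
    omega

theorem pairwise_altTuple (k : ℕ) : (altTuple k).Pairwise fun i j => j + 2 ≤ i := by
  induction k using Nat.twoStepInduction with
  | zero => simp [altTuple]
  | one => simp [altTuple]
  | more k ih _ =>
    rw [altTuple, List.pairwise_cons]
    refine ⟨fun j hj => ?_, ih⟩
    have := (mem_altTuple.1 hj).2.1
    omega

theorem altTuple_succ (k : ℕ) : altTuple (k + 1) = ((k : ℤ) + 1) :: altTuple (k - 1) := by
  rcases k with _ | k
  · rfl
  · simp only [altTuple, Nat.add_sub_cancel]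
    push_cast
    congr 1

theorem str_pair (k : ℤ) : str k (k + 1) = [k, k + 1] := by
  simp [str, List.range_succ]

theorem admissibleTuple_eq (h p : ℕ) : admissibleTuple h p =
    ((List.range ((h - p) / 2)).flatMap fun k : ℕ =>
      str ((h : ℤ) - 2 * (k : ℤ) - 1) ((h : ℤ) - 2 * (k : ℤ))) ++ str 0 p := by
  simp [admissibleTuple, List.flatMap_assoc]

theorem symmComplement_eq (h p : ℕ) : symmComplement h p =
    ((List.range ((h - p) / 2)).map fun k : ℕ => (h : ℤ) - 2 * (k : ℤ) - 1)
    ++ (List.range p).flatMap fun k : ℕ => str 0 ((p : ℤ) - 1 - (k : ℤ)) := by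
  simp [symmComplement, ← List.map_eq_flatMap, List.flatMap_map, Function.comp_def]

theorem simpleTuple_zero : simpleTuple 0 = [0] := by
  simp [simpleTuple, admissibleTuple, str]

theorem simpleTuple_one : simpleTuple 1 = [0, 1] := by
  simp [simpleTuple, admissibleTuple, str, List.range_succ]

theorem simpleTuple_add_two (k : ℕ) :
    simpleTuple (k + 2) = ((k : ℤ) + 1) :: ((k : ℤ) + 2) :: simpleTuple k := by
  have h1 : (k + 2) % 2 = k % 2 := by omega
  have h2 : (k + 2 - k % 2) / 2 = (k - k % 2) / 2 + 1 := by omega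
  have h3 : str ((((k + 2 : ℕ) : ℤ)) - 2 * ((0 : ℕ) : ℤ) - 1) (((k + 2 : ℕ) : ℤ) - 2 * ((0 : ℕ) : ℤ))
      = [(k : ℤ) + 1, (k : ℤ) + 2] := by
    have := str_pair ((k : ℤ) + 1)
    rw [show (k : ℤ) + 1 + 1 = k + 2 by ring] at this
    rw [← this]
    congr 1
    push_cast
    ring
  unfold simpleTuple
  rw [admissibleTuple_eq, admissibleTuple_eq, h1, h2, List.range_succ_eq_map, List.flatMap_cons, h3, List.flatMap_map]
  simp only [List.cons_append, List.nil_append]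
  congr 4
  ext1 j
  congr 1 <;> (push_cast; ring)

theorem simpleComplement_zero : simpleComplement 0 = [] := by
  simp [simpleComplement, symmComplement]

theorem simpleComplement_one : simpleComplement 1 = [0] := by
  simp [simpleComplement, symmComplement, str]

theorem simpleComplement_add_two (k : ℕ) :
    simpleComplement (k + 2) = ((k : ℤ) + 1) :: simpleComplement k := by
  have h1 : (k + 2) % 2 = k % 2 := by omega
  have h2 : (k + 2 - k % 2) / 2 = (k - k % 2) / 2 + 1 := by omega
  unfold simpleComplement
  rw [symmComplement_eq, symmComplement_eq, h1, h2, List.range_succ_eq_map, List.map_cons, List.map_map]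
  simp only [List.cons_append]
  congr 1
  · push_cast; ring
  · congr 2
    ext1 j
    simp only [Function.comp_apply]
    push_cast; ring

theorem simpleComplement_eq (k : ℕ) :
    simpleComplement k = altTuple (k - 1) ++ (if k % 2 = 1 then [0] else []) := by
  induction k using Nat.twoStepInduction with
  | zero => simp [simpleComplement_zero, altTuple]
  | one => simp [simpleComplement_one, altTuple]
  | more k ih _ =>
    rw [simpleComplement_add_two, ih, show k + 2 - 1 = k + 1 by omega, altTuple_succ]
    simp

/-- The simple admissible tuple of `{0 : 2 q}` without its last entry `0`. -/
def simpleInit : ℕ → List ℤ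
  | 0 => []
  | (q + 1) => (2 * (q : ℤ) + 1) :: (2 * (q : ℤ) + 2) :: simpleInit q

theorem simpleTuple_two_mul (q : ℕ) : simpleTuple (2 * q) = simpleInit q ++ [0] := by
  induction q with
  | zero => simp [simpleTuple_zero, simpleInit]
  | succ q ih =>
    rw [show 2 * (q + 1) = 2 * q + 2 by ring, simpleTuple_add_two, ih]
    simp [simpleInit]

theorem mem_simpleInit {q : ℕ} {i : ℤ} : i ∈ simpleInit q ↔ 1 ≤ i ∧ i ≤ 2 * q := by
  induction q with
  | zero => simp [simpleInit]; omega
  | succ q ih =>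
    simp only [simpleInit, List.mem_cons, ih]
    push_cast
    omega

theorem mem_simpleTuple {k : ℕ} {i : ℤ} : i ∈ simpleTuple k ↔ 0 ≤ i ∧ i ≤ k := by
  induction k using Nat.twoStepInduction with
  | zero => simp [simpleTuple_zero]; omega
  | one => simp [simpleTuple_one]; omega
  | more k ih _ =>
    simp only [simpleTuple_add_two, List.mem_cons, ih]
    push_cast
    omega

theorem count_zero_simpleTuple (k : ℕ) : (simpleTuple k).count 0 = 1 := by
  induction k using Nat.twoStepInduction with
  | zero => simp [simpleTuple_zero]
  | one => simp [simpleTuple_one]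
  | more k ih _ =>
    rw [simpleTuple_add_two, List.count_cons_of_ne (by omega), List.count_cons_of_ne (by omega), ih]

/-- The leading even-step entry $k+2$ can be slid to the right past $0$ and past all entries of the
opposite parity, which are at most $k-1$. Repeating this separates the two parities. -/
theorem prod_map_simpleTuple {A : Type*} [Monoid A] (N : ℤ → A) (k : ℕ)
    (hN : ∀ i j : ℤ, 0 ≤ i → i + 2 ≤ j → j ≤ k → Commute (N i) (N j)) :
    ((simpleTuple k).map N).prod =
      ((altTuple (k - 1)).map N).prod * N 0 * ((altTuple k).map N).prod := by
  induction k using Nat.twoStepInduction with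
  | zero => simp [simpleTuple_zero, altTuple]
  | one => simp [simpleTuple_one, altTuple]
  | more k ih _ =>
    have hc : Commute (N ((k : ℤ) + 2)) (((altTuple (k - 1)).map N).prod * N 0) := by
      refine Commute.mul_right (Commute.list_prod_right _ _ fun x hx => ?_)
        (hN _ _ le_rfl (by omega) (by push_cast; omega)).symm
      obtain ⟨j, hj, rfl⟩ := List.mem_map.1 hx
      have := mem_altTuple.1 hj
      exact (hN _ _ (by omega) (by omega) (by push_cast; omega)).symm
    rw [simpleTuple_add_two, show k + 2 - 1 = k + 1 by omega, altTuple_succ, altTuple]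
    simp only [List.map_cons, List.prod_cons]
    rw [ih fun i j h1 h2 h3 => hN i j h1 h2 (by push_cast; omega)]
    simp only [mul_assoc]
    congr 1
    have h := hc.eq
    rw [mul_assoc] at h
    rw [← mul_assoc (N 0) (N ((k : ℤ) + 2)), ← mul_assoc _ (N 0 * N ((k : ℤ) + 2)), ← h]
    simp only [mul_assoc]

/-- The same sorting with the last entry $0$ removed: in the system version the factor of index $0$
is the only one that couples to the state space, so it has to be kept apart. -/
theorem prod_map_simpleInit {A : Type*} [Monoid A] (N : ℤ → A) (q : ℕ)
    (hN : ∀ i j : ℤ, 0 ≤ i → i + 2 ≤ j → j ≤ 2 * q → Commute (N i) (N j)) :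
    ((simpleInit q).map N).prod =
      ((altTuple (2 * q - 1)).map N).prod * ((altTuple (2 * q)).map N).prod := by
  induction q with
  | zero => simp [simpleInit, altTuple]
  | succ q ih =>
    have hc : Commute (N (2 * (q : ℤ) + 2)) ((altTuple (2 * q - 1)).map N).prod := by
      refine Commute.list_prod_right _ _ fun x hx => ?_
      obtain ⟨j, hj, rfl⟩ := List.mem_map.1 hx
      have := mem_altTuple.1 hj
      exact (hN _ _ (by omega) (by omega) (by push_cast; omega)).symm
    rw [simpleInit, show 2 * (q + 1) - 1 = 2 * q + 1 by omega, altTuple_succ,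
      show 2 * (q + 1) = 2 * q + 2 by ring, altTuple]
    simp only [List.map_cons, List.prod_cons]
    rw [ih fun i j h1 h2 h3 => hN i j h1 h2 (by push_cast; omega)]
    push_cast
    simp only [mul_assoc]
    congr 1
    rw [← mul_assoc, hc.eq, mul_assoc]

/-! ### Products of Fiedler matrices -/

section
variable {n : ℕ} (m : ℕ) (a : ℕ → Matrix (Fin n) (Fin n) ℂ)

/-- The matrix assigned to the index `i` in the Fiedler matrix `M_i^P`. -/
def coeffP (a : ℕ → Matrix (Fin n) (Fin n) ℂ) (i : ℤ) : Matrix (Fin n) (Fin n) ℂ :=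
  if 0 ≤ i then -a i.natAbs else a i.natAbs

theorem prodP_append (s t : List ℤ) : prodP m a (s ++ t) = prodP m a s * prodP m a t := by
  simp [prodP]

theorem prodP_singleton (i : ℤ) : prodP m a [i] = fiedlerP m a i := by
  simp [prodP]

theorem prodP_eq (t : List ℤ) : prodP m a t = compRingEquiv (Fin m) (Fin n) ℂ
    (t.map fun i => elemB m i (coeffP a i)).prod := by
  rw [map_list_prod, List.map_map]
  rfl

theorem prodP_commute {s t : List ℤ} (hs : ∀ i ∈ s, -(m : ℤ) ≤ i ∧ i < m)
    (ht : ∀ i ∈ t, -(m : ℤ) ≤ i ∧ i < m) (h : ∀ i ∈ s, ∀ j ∈ t, Far i j) :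
    Commute (prodP m a s) (prodP m a t) := by
  refine Commute.list_prod_right _ _ fun x hx => Commute.list_prod_left _ _ fun y hy => ?_
  obtain ⟨j, hj, rfl⟩ := List.mem_map.1 hx
  obtain ⟨i, hi, rfl⟩ := List.mem_map.1 hy
  exact elemM_commute m _ _ (hs i hi).1 (hs i hi).2 (ht j hj).1 (ht j hj).2 (h i hi j hj)

/-- The tuple of the factors of the inverse of `M_t^P`. -/
def invTuple (t : List ℤ) : List ℤ := (t.map fun i => -i).reverse

theorem mem_invTuple {t : List ℤ} {i : ℤ} : i ∈ invTuple t ↔ -i ∈ t := by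
  simp only [invTuple, List.mem_reverse, List.mem_map]
  exact ⟨fun ⟨j, hj, h⟩ => by rwa [← h, neg_neg], fun h => ⟨-i, h, neg_neg i⟩⟩

theorem pairwise_far_invTuple {t : List ℤ} (h : t.Pairwise Far) : (invTuple t).Pairwise Far := by
  rw [invTuple, List.pairwise_reverse, List.pairwise_map]
  refine h.imp fun {i j} h => ?_
  unfold Far at *
  simp only [Int.natAbs_neg]
  omega

theorem prodP_mul_invTuple {t : List ℤ} (ht : ∀ i ∈ t, i ≠ 0 ∧ i.natAbs < m) :
    prodP m a t * prodP m a (invTuple t) = 1 := by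
  induction t with
  | nil => simp [prodP, invTuple]
  | cons i t ih =>
    have hi := ht i (by simp)
    have e : invTuple (i :: t) = invTuple t ++ [-i] := by simp [invTuple]
    have hf : fiedlerP m a i * fiedlerP m a (-i) = 1 := by
      have := elemM_mul_elemM_neg m hi.1 hi.2 (coeffP a i)
      have e : -coeffP a i = coeffP a (-i) := by
        unfold coeffP
        rcases lt_or_gt_of_ne hi.1 with h | h
        · rw [if_neg (by omega), if_pos (by omega), Int.natAbs_neg]
        · rw [if_pos (by omega), if_neg (by omega), Int.natAbs_neg, neg_neg]
      rw [e] at this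
      exact this
    rw [e, prodP_append, prodP_singleton, show i :: t = [i] ++ t from rfl, prodP_append,
      prodP_singleton, mul_assoc, ← mul_assoc (prodP m a t), ih fun j hj => ht j (by simp [hj]),
      one_mul, hf]

theorem mem_shift {k i : ℤ} {t : List ℤ} : i ∈ shift k t ↔ i - k ∈ t := by
  simp only [shift, List.mem_map]
  exact ⟨fun ⟨j, hj, h⟩ => by rw [← h]; simpa using hj, fun h => ⟨i - k, h, by ring⟩⟩

/-! ### Regrouping the Fiedler factors by parity. -/

variable (h : ℕ)

/-- The positive and negative outer factors of the Fiedler pencil. -/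
noncomputable def outerFactor : Matrix (Fin m × Fin n) (Fin m × Fin n) ℂ :=
  prodP m a (altTuple (h - 1)) * prodP m a (shift (-m) (altTuple (m - h - 1 - 1)))

/-- The indices of the odd Fiedler matrices, all negative. -/
def oddTuple : List ℤ := shift (-m) (altTuple (m - h - 1)) ++ invTuple (altTuple (h - 1))

/-- The indices of the even Fiedler matrices, all nonnegative. -/
def evenTuple : List ℤ :=
  altTuple h ++ invTuple (shift (-m) (altTuple (m - h - 1 - 1))) ++ [0]

variable {h} (hh : Even h) (hm : h < m)
include hh hm

/-- For even $h$ the runs $-h-1,-h-3,\dots$ and $-(h-1),\dots,-1$ fit together into all odd negative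
indices, with no trace of $h$ left. -/
theorem mem_oddTuple {i : ℤ} : i ∈ oddTuple m h ↔ -(m : ℤ) < i ∧ i < 0 ∧ i % 2 = 1 := by
  obtain ⟨q, hq⟩ := hh
  simp only [oddTuple, List.mem_append, mem_shift, mem_invTuple, mem_altTuple]
  omega

theorem mem_evenTuple {i : ℤ} : i ∈ evenTuple m h ↔ 0 ≤ i ∧ i < m ∧ i % 2 = 0 := by
  obtain ⟨q, hq⟩ := hh
  simp only [evenTuple, List.mem_append, mem_shift, mem_invTuple, mem_altTuple,
    List.mem_singleton]
  omega

omit hh hm in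
theorem pairwise_far_altTuple (k : ℕ) : (altTuple k).Pairwise Far := by
  refine (pairwise_altTuple k).imp_of_mem fun {i j} hi hj h => ?_
  have := mem_altTuple.1 hi
  have := mem_altTuple.1 hj
  unfold Far
  omega

omit hh hm in
theorem pairwise_far_shift {k : ℕ} (hk : k ≤ m) : (shift (-m) (altTuple k)).Pairwise Far := by
  rw [shift, List.pairwise_map]
  refine (pairwise_altTuple k).imp_of_mem fun {i j} hi hj h => ?_
  have := mem_altTuple.1 hi
  have := mem_altTuple.1 hj
  unfold Far
  omega

theorem pairwise_oddTuple : (oddTuple m h).Pairwise Far := by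
  obtain ⟨q, hq⟩ := hh
  rw [oddTuple, List.pairwise_append]
  refine ⟨pairwise_far_shift m (by omega), pairwise_far_invTuple (pairwise_far_altTuple _), ?_⟩
  intro i hi j hj
  rw [mem_shift, mem_altTuple] at hi
  rw [mem_invTuple, mem_altTuple] at hj
  unfold Far
  omega

theorem pairwise_evenTuple : (evenTuple m h).Pairwise Far := by
  obtain ⟨q, hq⟩ := hh
  rw [evenTuple, List.pairwise_append, List.pairwise_append]
  refine ⟨⟨pairwise_far_altTuple _, pairwise_far_invTuple (pairwise_far_shift m (by omega)), ?_⟩,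
    by simp, ?_⟩
  · intro i hi j hj
    rw [mem_altTuple] at hi
    rw [mem_invTuple, mem_shift, mem_altTuple] at hj
    unfold Far
    omega
  · intro i hi j hj
    rw [List.mem_append, mem_altTuple, mem_invTuple, mem_shift, mem_altTuple] at hi
    rw [List.mem_singleton] at hj
    unfold Far
    omega

/-- A product $M\,M^{-1}=1$ over $h-1,h-3,\dots,1$ is inserted at the right end and $M$ is commuted
to the front. Its indices are at most $h-1$, those of $\mathbf v$ at least $h+1$ in absolute value.
-/
theorem prodP_shift_simpleTuple : prodP m a (shift (-m) (simpleTuple (m - h - 1))) =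
    outerFactor m a h * (fiedlerP m a (-m) * prodP m a (oddTuple m h)) := by
  obtain ⟨q, hq⟩ := hh
  have e : ∀ t, prodP m a (shift (-m) t) = (t.map fun i => fiedlerP m a (i + -m)).prod := fun t => by
    simp [prodP, shift, List.map_map, Function.comp_def]
  rw [e, prod_map_simpleTuple (fun i => fiedlerP m a (i + -m))]
  · rw [← e, ← e, zero_add, outerFactor, oddTuple, prodP_append]
    have hi := prodP_mul_invTuple m a (t := altTuple (h - 1)) fun i hi => by
      rw [mem_altTuple] at hi
      omega
    have hc : Commute (prodP m a (altTuple (h - 1)))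
        (prodP m a (shift (-m) (altTuple (m - h - 1 - 1)) ++ [-(m : ℤ)] ++
          shift (-m) (altTuple (m - h - 1)))) := by
      refine prodP_commute m a (fun i hi => ?_) (fun i hi => ?_) (fun i hi j hj => ?_)
      · rw [mem_altTuple] at hi
        omega
      · simp only [List.mem_append, mem_shift, mem_altTuple, List.mem_singleton] at hi
        omega
      · simp only [List.mem_append, mem_shift, mem_altTuple, List.mem_singleton] at hi hj
        unfold Far
        omega
    rw [prodP_append, prodP_append, prodP_singleton] at hc
    calc _ = prodP m a (shift (-m) (altTuple (m - h - 1 - 1))) * fiedlerP m a (-m) *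
          prodP m a (shift (-m) (altTuple (m - h - 1))) *
          (prodP m a (altTuple (h - 1)) * prodP m a (invTuple (altTuple (h - 1)))) := by
            rw [hi, mul_one]
      _ = _ := by
        rw [← mul_assoc, ← hc.eq]
        simp only [mul_assoc]
  · intro i j h1 h2 h3
    refine elemM_commute m _ _ (by omega) (by omega) (by omega) (by omega) ?_
    unfold Far
    omega

/-- Here the inserted pair consists of the negative indices $-h-2,-h-4,\dots$ and their inverses; it
goes in just before the final factor of index $0$, and its first half commutes with $h,h-2,\dots,2$.
-/
theorem prodP_simpleTuple : prodP m a (simpleTuple h) =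
    outerFactor m a h * prodP m a (evenTuple m h) := by
  obtain ⟨q, hq⟩ := hh
  have hq' : h = 2 * q := by omega
  have hi := prodP_mul_invTuple m a (t := shift (-m) (altTuple (m - h - 1 - 1))) fun i hi => by
    rw [mem_shift, mem_altTuple] at hi
    omega
  have hc : Commute (prodP m a (altTuple h))
      (prodP m a (shift (-m) (altTuple (m - h - 1 - 1)))) := by
    refine prodP_commute m a (fun i hi => ?_) (fun i hi => ?_) (fun i hi j hj => ?_)
    · rw [mem_altTuple] at hi
      omega
    · simp only [mem_shift, mem_altTuple] at hi
      omega
    · simp only [mem_shift, mem_altTuple] at hi hj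
      unfold Far
      omega
  have e : prodP m a (simpleTuple h) =
      prodP m a (altTuple (h - 1)) * prodP m a (altTuple h) * fiedlerP m a 0 := by
    rw [hq', simpleTuple_two_mul, prodP_append, prodP_singleton]
    congr 1
    refine prod_map_simpleInit (fiedlerP m a) q fun i j h1 h2 h3 => ?_
    refine elemM_commute m _ _ (by omega) (by omega) (by omega) (by omega) ?_
    unfold Far
    omega
  rw [e, outerFactor, evenTuple, prodP_append, prodP_append, prodP_singleton]
  calc _ = prodP m a (altTuple (h - 1)) * (prodP m a (altTuple h) *
        (prodP m a (shift (-m) (altTuple (m - h - 1 - 1))) *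
        prodP m a (invTuple (shift (-m) (altTuple (m - h - 1 - 1)))))) * fiedlerP m a 0 := by
          rw [hi, mul_one]
    _ = _ := by
      rw [← mul_assoc (prodP m a (altTuple h)), hc.eq]
      simp only [mul_assoc]

end

/-! ### The tridiagonal pencil -/

/-- The blocks of the tridiagonal pencil `s 𝒪 - t ℰ`, where `𝒪` and `ℰ` are the products of the
odd and of the even Fiedler matrices. -/
def theta {R : Type*} [CommRing R] {n : ℕ} (m : ℕ) (s t : R) (a : ℕ → Matrix (Fin n) (Fin n) R)
    (k l : ℕ) : Matrix (Fin n) (Fin n) R :=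
  if k = l then
    if k % 2 = 0 then s • a (k + 1) + t • a k else if k + 1 = m then (-t) • 1 else 0
  else if k = l + 1 then
    if k % 2 = 0 then (-t) • 1 else if k + 1 = m then s • a (k + 1) else s • 1
  else if l = k + 1 then
    if l % 2 = 0 then (-t) • 1 else s • 1
  else 0

section explicit
variable {n : ℕ} (m : ℕ) (a : ℕ → Matrix (Fin n) (Fin n) ℂ) {h : ℕ} (hh : Even h) (hm : h < m)
include hh hm

/-- The odd indices pair the levels as $\{0,1\},\{2,3\},\dots$; only for odd $m$ is the top level
left unpaired, whence the diagonal block `1` there. -/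
theorem prodP_oddTuple : prodP m a (oddTuple m h) = compRingEquiv (Fin m) (Fin n) ℂ
    (ofLvl m (tri (fun k => k % 2 = 1)
      (fun k => if k % 2 = 0 then (if k + 1 = m then 1 else a (k + 1)) else 0))) := by
  rw [prodP_eq, prod_elemB m (coeffP a) (oddTuple m h) (fun i hi => ?_)
    (pairwise_oddTuple m hh hm)
    (fun k => if k % 2 = 0 then (if k + 1 = m then 1 else a (k + 1)) else
      if k < m then 0 else 1)]
  · congr 1
    ext1 p q
    have hp := lvl_lt p
    have hq := lvl_lt q
    have e : ∀ k, k < m → ((k ∈ (oddTuple m h).map Int.natAbs) = (k % 2 = 1)) := by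
      intro k hk
      rw [List.mem_map, eq_iff_iff]
      constructor
      · rintro ⟨i, hi, rfl⟩
        rw [mem_oddTuple m hh hm] at hi
        omega
      · intro hk'
        exact ⟨-k, by rw [mem_oddTuple m hh hm]; omega, by omega⟩
    simp only [ofLvl, tri, Matrix.of_apply, e _ hp, e _ hq, hp, if_true]
  · intro i hi k hk h
    rw [mem_oddTuple m hh hm] at hi
    simp only [elemDiag, coeffP]
    rcases h with h | h
    · rw [if_neg (by omega), if_pos hk, if_pos h, if_neg (by omega)]
    · rw [if_pos (by omega), if_neg (by omega), if_neg (by omega), if_pos h, if_neg (by omega),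
        if_neg (by omega), h]
  · intro k hk h
    by_cases h1 : k % 2 = 0
    · rw [if_pos h1]
      by_cases h2 : k + 1 = m
      · rw [if_pos h2]
      · exfalso
        exact (h (-((k : ℤ) + 1)) (by rw [mem_oddTuple m hh hm]; omega)).2 (by omega)
    · exfalso
      exact (h (-(k : ℤ)) (by rw [mem_oddTuple m hh hm]; omega)).1 (by omega)
  · rw [mem_oddTuple m hh hm] at hi
    omega

theorem prodP_evenTuple : prodP m a (evenTuple m h) = compRingEquiv (Fin m) (Fin n) ℂ
    (ofLvl m (theta m (0 : ℂ) (-1) a)) := by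
  rw [prodP_eq, prod_elemB m (coeffP a) (evenTuple m h) (fun i hi => ?_)
    (pairwise_evenTuple m hh hm)
    (fun k => if k % 2 = 0 then -a k else if k + 1 = m then 1 else 0)]
  · congr 1
    ext1 p q
    have hp := lvl_lt p
    have hq := lvl_lt q
    have e : ∀ k, k < m → ((k ∈ (evenTuple m h).map Int.natAbs) = (k % 2 = 0)) := by
      intro k hk
      rw [List.mem_map, eq_iff_iff]
      constructor
      · rintro ⟨i, hi, rfl⟩
        rw [mem_evenTuple m hh hm] at hi
        omega
      · intro hk'
        exact ⟨k, by rw [mem_evenTuple m hh hm]; omega, by omega⟩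
    simp only [ofLvl, tri, Matrix.of_apply, e _ hp, e _ hq, theta]
    generalize lvl p = k
    generalize lvl q = l
    split_ifs <;> first | omega | simp
  · intro i hi k hk h
    rw [mem_evenTuple m hh hm] at hi
    simp only [elemDiag, coeffP]
    rcases h with h | h
    · rw [if_pos (by omega), if_pos h, if_pos (by omega), if_pos (by omega), h]
    · rw [if_neg (by omega), if_neg (by omega), if_neg (by omega), if_pos h, if_pos (by omega)]
  · intro k hk h
    by_cases h1 : k % 2 = 0
    · exfalso
      exact (h (k : ℤ) (by rw [mem_evenTuple m hh hm]; omega)).1 (by omega)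
    · by_cases h2 : k + 1 = m
      · rw [if_neg h1, if_pos h2]
      · exfalso
        exact (h ((k : ℤ) + 1) (by rw [mem_evenTuple m hh hm]; omega)).2 (by omega)
  · rw [mem_evenTuple m hh hm] at hi
    omega

/-- Multiplication by $M_{-m}(A_m)$ from the left scales only the top block row. For even $m$ this
puts $A_m$ at the place $(m-1,m-2)$ but not at $(m-2,m-1)$, which explains the asymmetry in `theta`.
-/
theorem fiedlerP_mul_prodP_oddTuple : fiedlerP m a (-m) * prodP m a (oddTuple m h) =
    compRingEquiv (Fin m) (Fin n) ℂ (ofLvl m (theta m (1 : ℂ) 0 a)) := by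
  have e : fiedlerP m a (-m) = compRingEquiv (Fin m) (Fin n) ℂ
      (Matrix.diagonal fun p => if lvl p + 1 = m then a m else 1) := by
    rw [fiedlerP, ← compRingEquiv_elemB]
    congr 1
    ext1 p q
    have hp := p.2
    have : (lvl p + 1 = m) = ((p : ℕ) = 0) := by
      rw [eq_iff_iff]
      unfold lvl
      omega
    rw [Matrix.diagonal_apply]
    simp only [elemB, elemBlock, this]
    have c2 : m ≠ 0 := by omega
    simp [c2]
  rw [e, prodP_oddTuple m a hh hm, ← map_mul]
  congr 1
  ext1 p q
  rw [Matrix.diagonal_mul]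
  have hp := lvl_lt p
  have hq := lvl_lt q
  simp only [ofLvl, tri, Matrix.of_apply, theta]
  generalize lvl p = k at *
  generalize lvl q = l at *
  split_ifs with g0 <;> first | omega | skip
  all_goals first | (rw [g0]; simp) | simp [*]

omit hh hm in
theorem det_prodP_ne_zero (t : List ℤ) (ht : ∀ i ∈ t, i ≠ 0 ∧ (i = -m → (a m).det ≠ 0)) :
    (prodP m a t).det ≠ 0 := by
  rw [prodP, ← Matrix.coe_detMonoidHom, map_list_prod]
  refine List.prod_ne_zero fun h0 => ?_
  simp only [List.mem_map, Matrix.coe_detMonoidHom] at h0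
  obtain ⟨_, ⟨i, hi, rfl⟩, h0⟩ := h0
  refine det_elemM_ne_zero m i _ (fun h => ?_) h0
  rcases h with h | h
  · exact absurd h (ht i hi).1
  · have hi0 := (ht i hi).1
    have c : ¬ 0 ≤ i := by omega
    rw [if_neg c, h]
    simpa using (ht i hi).2 h

end explicit

/-! ### Block columns annihilated by all but one row of the tridiagonal pencil. -/

section columns
variable {R : Type*} [CommRing R] {n : ℕ} (m : ℕ) (s t : R) (a : ℕ → Matrix (Fin n) (Fin n) R)

theorem theta_eq_zero {k l : ℕ} (h1 : l ≠ k) (h2 : l + 1 ≠ k) (h3 : l ≠ k + 1) :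
    theta m s t a k l = 0 := by
  unfold theta
  rw [if_neg (by omega), if_neg (by omega), if_neg (by omega)]

/-- The Horner shift `A_d + λ A_{d+1} + ⋯ + λ^{m-d} A_m`. -/
def hornerUp (d : ℕ) : Matrix (Fin n) (Fin n) R :=
  ∑ i ∈ Finset.range (m + 1 - d), s ^ i • a (d + i)

theorem hornerUp_eq {d : ℕ} (hd : d ≤ m) :
    hornerUp m s a d = a d + s • hornerUp m s a (d + 1) := by
  unfold hornerUp
  rw [show m + 1 - d = (m + 1 - (d + 1)) + 1 by omega, Finset.sum_range_succ', Finset.smul_sum,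
    add_comm]
  congr 1
  · simp
  · refine Finset.sum_congr rfl fun i _ => ?_
    rw [smul_smul, pow_succ', show d + (i + 1) = d + 1 + i by ring]

theorem hornerUp_top : hornerUp m s a (m + 1) = 0 := by
  simp [hornerUp]

/-- The column annihilated by all rows of the pencil but the one at level `0`. -/
def colUp (k : ℕ) : Matrix (Fin n) (Fin n) R :=
  if k % 2 = 0 then s ^ (k / 2) • 1 else s ^ ((k + 1) / 2) • hornerUp m s a (k + 1)

/-- With $H_d$ the Horner shifts, the levels $2j$ and $2j+1$ contribute
$s^j(A_{2j}+sA_{2j+1}+s^2H_{2j+2})=s^jH_{2j}$ to row $2j$, and level $2j-1$ contributes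
$-s^jH_{2j}$. Level $0$ has no lower neighbour, so $H_0$ survives. In odd rows the two neighbours
cancel, except at an odd top level, where the diagonal term cancels the $A_m$ term. -/
theorem sum_theta_mul_colUp {k : ℕ} (hk : k < m) :
    ∑ l ∈ Finset.range m, theta m s 1 a k l * colUp m s a l =
      if k = 0 then hornerUp m s a 0 else 0 := by
  rw [sum_tridiagonal m _ _ hk fun l h1 h2 h3 => theta_eq_zero m s 1 a h1 h2 h3]
  obtain ⟨j, rfl | rfl⟩ : ∃ j, k = 2 * j ∨ k = 2 * j + 1 := ⟨k / 2, by omega⟩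
  · have hH : hornerUp m s a (2 * j) = a (2 * j) + s • a (2 * j + 1) +
        s ^ 2 • hornerUp m s a (2 * j + 2) := by
      rw [hornerUp_eq m s a (by omega), hornerUp_eq m s a (by omega), smul_add, smul_smul, sq,
        ← add_assoc]
    have e1 : theta m s 1 a (2 * j) (2 * j) = s • a (2 * j + 1) + (1 : R) • a (2 * j) := by
      unfold theta; rw [if_pos rfl, if_pos (by omega)]
    have e2 : colUp m s a (2 * j) = s ^ j • 1 := by
      unfold colUp; rw [if_pos (by omega)]; congr 2; omega
    have e3 : (if 2 * j + 1 < m then theta m s 1 a (2 * j) (2 * j + 1) * colUp m s a (2 * j + 1)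
        else 0) = (s * s ^ (j + 1)) • hornerUp m s a (2 * j + 2) := by
      by_cases hj : 2 * j + 1 < m
      · unfold theta colUp
        rw [if_pos hj, if_neg (by omega), if_neg (by omega), if_pos rfl, if_neg (by omega),
          if_neg (by omega), show (2 * j + 1 + 1) / 2 = j + 1 by omega, smul_mul_smul_comm,
          one_mul]
      -- If $2j$ is the top level, the neighbour above is missing, and so is its contribution
      -- because $H_{m+1}$ is an empty sum.
      · rw [if_neg hj, show 2 * j + 2 = m + 1 by omega, hornerUp_top, smul_zero]
    rw [e1, e2, e3]
    rcases j with _ | j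
    · rw [if_neg (by omega), if_pos rfl, show 0 = 2 * 0 by rfl, hH]
      simp only [mul_smul_comm, mul_one]
      module
    · rw [if_pos (by omega), if_neg (by omega)]
      have e4 : theta m s 1 a (2 * (j + 1)) (2 * (j + 1) - 1) = (-1 : R) • 1 := by
        unfold theta; rw [if_neg (by omega), if_pos (by omega), if_pos (by omega)]
      have e5 : colUp m s a (2 * (j + 1) - 1) = s ^ (j + 1) • hornerUp m s a (2 * (j + 1)) := by
        unfold colUp
        rw [if_neg (by omega), show (2 * (j + 1) - 1 + 1) / 2 = j + 1 by omega,
          show 2 * (j + 1) - 1 + 1 = 2 * (j + 1) by omega]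
      rw [e4, e5, hH, smul_mul_smul_comm]
      simp only [mul_smul_comm, mul_one, one_mul]
      module
  · have e1 : theta m s 1 a (2 * j + 1) (2 * j + 1) =
        if 2 * j + 1 + 1 = m then (-1 : R) • 1 else 0 := by
      unfold theta; rw [if_pos rfl, if_neg (by omega)]
    have e2 : colUp m s a (2 * j + 1 - 1) = s ^ j • 1 := by
      unfold colUp; rw [if_pos (by omega)]; congr 2; omega
    have e3 : theta m s 1 a (2 * j + 1) (2 * j + 1 - 1) =
        if 2 * j + 1 + 1 = m then s • a (2 * j + 1 + 1) else s • 1 := by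
      unfold theta; rw [if_neg (by omega), if_pos (by omega), if_neg (by omega)]
    have c1 : 1 ≤ 2 * j + 1 := by omega
    have c2 : ¬ 2 * j + 1 = 0 := by omega
    rw [e1, e2, e3, if_pos c1, if_neg c2]
    by_cases hj : 2 * j + 1 + 1 = m
    · have e4 : colUp m s a (2 * j + 1) = s ^ (j + 1) • a (2 * j + 2) := by
        unfold colUp
        rw [if_neg (by omega), hornerUp_eq m s a (by omega), hj, hornerUp_top, smul_zero, add_zero,
          show m / 2 = j + 1 by omega, ← hj]
      have c3 : ¬ 2 * j + 1 + 1 < m := by omega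
      rw [if_pos hj, if_neg c3, if_pos hj, e4, smul_mul_smul_comm, smul_mul_smul_comm]
      simp only [mul_one, one_mul]
      module
    · have e4 : colUp m s a (2 * j + 1 + 1) = s ^ (j + 1) • 1 := by
        unfold colUp; rw [if_pos (by omega)]; congr 2; omega
      have e5 : theta m s 1 a (2 * j + 1) (2 * j + 1 + 1) = (-1 : R) • 1 := by
        unfold theta; rw [if_neg (by omega), if_neg (by omega), if_pos rfl, if_pos (by omega)]
      have c3 : 2 * j + 1 + 1 < m := by omega
      rw [if_neg hj, if_pos c3, if_neg hj, e4, e5, smul_mul_smul_comm, smul_mul_smul_comm]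
      simp only [mul_one, zero_mul]
      module

/-- The truncation `A_k + μ A_{k-1} + ⋯ + μ^k A_0`. -/
def hornerDown (k : ℕ) : Matrix (Fin n) (Fin n) R :=
  ∑ i ∈ Finset.range (k + 1), t ^ (k - i) • a i

theorem hornerDown_succ (k : ℕ) :
    hornerDown t a (k + 1) = a (k + 1) + t • hornerDown t a k := by
  unfold hornerDown
  rw [Finset.sum_range_succ, Finset.smul_sum, add_comm]
  congr 1
  · simp
  · refine Finset.sum_congr rfl fun i hi => ?_
    have := Finset.mem_range.1 hi
    rw [smul_smul, ← pow_succ', show k + 1 - i = k - i + 1 by omega]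

/-- The column annihilated by all rows of the pencil but the one at the highest level `2 q`. -/
def colDown (q k : ℕ) : Matrix (Fin n) (Fin n) R :=
  if k % 2 = 0 then t ^ (q - k / 2) • 1 else (-t ^ (q - k / 2)) • hornerDown t a k

/-- The mirror image, based on $D_{2j+1}=A_{2j+1}+tA_{2j}+t^2D_{2j-1}$: each row cancels against its
upper neighbour, and the top row, having none, retains $D_m$. Oddness of $m$ makes the top level
even, as this pattern requires. -/
theorem sum_theta_mul_colDown {q k : ℕ} (hq : m = 2 * q + 1) (hk : k < m) :
    ∑ l ∈ Finset.range m, theta m 1 t a k l * colDown t a q l =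
      if k + 1 = m then hornerDown t a m else 0 := by
  rw [sum_tridiagonal m _ _ hk fun l h1 h2 h3 => theta_eq_zero m 1 t a h1 h2 h3]
  obtain ⟨j, rfl | rfl⟩ : ∃ j, k = 2 * j ∨ k = 2 * j + 1 := ⟨k / 2, by omega⟩
  · have e1 : theta m 1 t a (2 * j) (2 * j) = (1 : R) • a (2 * j + 1) + t • a (2 * j) := by
      unfold theta; rw [if_pos rfl, if_pos (by omega)]
    have e2 : colDown t a q (2 * j) = t ^ (q - j) • 1 := by
      unfold colDown; rw [if_pos (by omega)]; congr 3; omega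
    have e3 : hornerDown t a (2 * j + 1) = a (2 * j + 1) + t • a (2 * j) +
        if 1 ≤ 2 * j then t ^ 2 • hornerDown t a (2 * j - 1) else 0 := by
      rw [hornerDown_succ]
      rcases j with _ | j
      · simp [hornerDown]
      · rw [if_pos (by omega), show 2 * (j + 1) = 2 * j + 1 + 1 by ring, hornerDown_succ,
          smul_add, smul_smul, sq, Nat.add_sub_cancel, ← add_assoc]
    have e4 : (if 1 ≤ 2 * j then theta m 1 t a (2 * j) (2 * j - 1) * colDown t a q (2 * j - 1)
        else 0) = t ^ (q - j) • (if 1 ≤ 2 * j then t ^ 2 • hornerDown t a (2 * j - 1) else 0) := by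
      by_cases hj : 1 ≤ 2 * j
      · unfold theta colDown
        rw [if_pos hj, if_pos hj, if_neg (by omega), if_pos (by omega), if_pos (by omega),
          if_neg (by omega), smul_mul_smul_comm, smul_smul, one_mul,
          show q - (2 * j - 1) / 2 = q - j + 1 by omega]
        congr 1
        ring
      · rw [if_neg hj, if_neg hj, smul_zero]
    rw [e1, e2, e4]
    by_cases hj : 2 * j + 1 = m
    · have c1 : ¬ 2 * j + 1 < m := by omega
      rw [if_neg c1, if_pos hj, ← hj, e3, show q - j = 0 by omega]
      simp only [pow_zero, one_smul, mul_one, add_zero]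
    · have e5 : theta m 1 t a (2 * j) (2 * j + 1) = (1 : R) • 1 := by
        unfold theta; rw [if_neg (by omega), if_neg (by omega), if_pos rfl, if_neg (by omega)]
      have e6 : colDown t a q (2 * j + 1) = (-t ^ (q - j)) • hornerDown t a (2 * j + 1) := by
        unfold colDown; rw [if_neg (by omega)]; congr 3; omega
      have c1 : 2 * j + 1 < m := by omega
      rw [if_pos c1, if_neg hj, e5, e6, e3]
      simp only [mul_smul_comm, mul_one, one_mul, one_smul]
      module
  · have e1 : theta m 1 t a (2 * j + 1) (2 * j + 1) = 0 := by
      unfold theta; rw [if_pos rfl, if_neg (by omega), if_neg (by omega)]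
    have e2 : colDown t a q (2 * j + 1 - 1) = t ^ (q - j) • 1 := by
      unfold colDown; rw [if_pos (by omega)]; congr 3; omega
    have e3 : theta m 1 t a (2 * j + 1) (2 * j + 1 - 1) = (1 : R) • 1 := by
      unfold theta; rw [if_neg (by omega), if_pos (by omega), if_neg (by omega), if_neg (by omega)]
    have e4 : colDown t a q (2 * j + 1 + 1) = t ^ (q - (j + 1)) • 1 := by
      unfold colDown; rw [if_pos (by omega)]; congr 3; omega
    have e5 : theta m 1 t a (2 * j + 1) (2 * j + 1 + 1) = (-t) • 1 := by
      unfold theta; rw [if_neg (by omega), if_neg (by omega), if_pos rfl, if_pos (by omega)]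
    have c1 : 1 ≤ 2 * j + 1 := by omega
    have c2 : ¬ 2 * j + 1 + 1 = m := by omega
    have c3 : 2 * j + 1 + 1 < m := by omega
    rw [e1, e2, e3, e4, e5, if_pos c1, if_neg c2, if_pos c3,
      smul_mul_smul_comm, smul_mul_smul_comm, show q - j = q - (j + 1) + 1 by omega]
    simp only [mul_one, zero_mul]
    module

end columns

/-! ### Unimodular equivalence -/

/-- A matrix that is upper triangular with respect to a ranking of its indices, with units on the
diagonal, is invertible. -/
theorem isUnit_det_of_triangular {R ι : Type*} [CommRing R] [Fintype ι] [DecidableEq ι]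
    (M : Matrix ι ι R) (key : ι → ℕ) (h1 : ∀ i, IsUnit (M i i))
    (h2 : ∀ i j, i ≠ j → key j ≤ key i → M i j = 0) : IsUnit M.det := by
  have hb : M.BlockTriangular key := fun i j hij =>
    h2 i j (fun e => by rw [e] at hij; exact lt_irrefl _ hij) hij.le
  rw [hb.det]
  refine IsUnit.prod_iff.2 fun k _ => ?_
  have : M.toSquareBlock key k = Matrix.diagonal fun i : {i // key i = k} => M i i := by
    ext i j
    rw [Matrix.diagonal_apply, Matrix.toSquareBlock_def, Matrix.of_apply]
    split_ifs with h
    · rw [h]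
    · exact h2 i j (fun e => h (Subtype.ext e)) (by rw [i.2, j.2])
  rw [this, Matrix.det_diagonal]
  exact IsUnit.prod_iff.2 fun i _ => h1 i

/-- The common mechanism of both equivalences, at finite points and at infinity: a block column sent
by `Z` to a multiple of a unit column lets that multiple be split off as a diagonal factor, whatever
its invertibility. -/
theorem mul_updateCol_one {R ι : Type*} [Ring R] [Fintype ι] [DecidableEq ι] (Z : Matrix ι ι R)
    (f : ι → R) (p₀ : ι) (P : R) (hf : ∀ p, ∑ k, Z p k * f k = if p = p₀ then P else 0) :
    Z * updateCol 1 p₀ f =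
      updateCol Z p₀ (Pi.single p₀ 1) * diagonal fun p => if p = p₀ then P else 1 := by
  ext p q
  rw [Matrix.mul_diagonal, Matrix.mul_apply]
  by_cases hq : q = p₀
  · subst hq
    simp only [updateCol_self, hf, if_true]
    by_cases hp : p = q
    · subst hp; simp
    · rw [Pi.single_eq_of_ne hp, zero_mul, if_neg hp]
  · simp only [updateCol_ne hq, if_neg hq, mul_one, Matrix.one_apply]
    simp

theorem isUnit_det_updateCol_one {R : Type*} [CommRing R] {m n : ℕ}
    (f : Fin m → Matrix (Fin n) (Fin n) R) (p₀ : Fin m) (hf : f p₀ = 1) :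
    IsUnit (compRingEquiv (Fin m) (Fin n) R (updateCol 1 p₀ f)).det := by
  refine isUnit_det_of_triangular _ (fun p => if p.1 = p₀ then 1 else 0) ?_ ?_
  · rintro ⟨p, c⟩
    change IsUnit (updateCol 1 p₀ f p p c c)
    by_cases hp : p = p₀
    · subst hp
      simp [hf]
    · simp [updateCol_ne hp]
  · rintro ⟨p, c⟩ ⟨q, d⟩ h1 h2
    change updateCol 1 p₀ f p q c d = 0
    dsimp only at h2
    by_cases hq : q = p₀
    · subst hq
      have hp : p = q := by
        by_contra hp
        simp [hp] at h2
      subst hp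
      have : c ≠ d := fun e => h1 (by rw [e])
      simp [hf, this]
    · rw [updateCol_ne hq]
      by_cases hp : p = q
      · subst hp
        have : c ≠ d := fun e => h1 (by rw [e])
        simp [this]
      · simp [hp]

/-- The involution of the levels that exchanges `2 j - 1` and `2 j`. -/
def swapLvl (m k : ℕ) : ℕ :=
  -- Level `0` is fixed through truncated subtraction, and an odd top level is fixed because its
  -- partner is missing.
  if k % 2 = 1 then (if k + 1 = m then k else k + 1) else k - 1

theorem swapLvl_lt {m k : ℕ} (h : k < m) : swapLvl m k < m := by
  unfold swapLvl
  split_ifs <;> omega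

theorem swapLvl_swapLvl {m k : ℕ} (h : k < m) : swapLvl m (swapLvl m k) = k := by
  unfold swapLvl
  split_ifs <;> omega

/-- The block number with a given level. -/
def ofLevel {m : ℕ} (k : ℕ) (h : k < m) : Fin m := ⟨m - 1 - k, by omega⟩

theorem lvl_ofLevel {m k : ℕ} (h : k < m) : lvl (ofLevel k h) = k := by
  unfold lvl ofLevel
  dsimp only
  omega

/-- The permutation of the blocks given by `swapLvl`. -/
def swapPerm (m : ℕ) : Equiv.Perm (Fin m) :=
  Function.Involutive.toPerm (fun p => ofLevel (swapLvl m (lvl p)) (swapLvl_lt (lvl_lt p)))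
    fun p => by
      rw [← lvl_inj, lvl_ofLevel, lvl_ofLevel, swapLvl_swapLvl (lvl_lt p)]

theorem lvl_swapPerm {m : ℕ} (p : Fin m) : lvl (swapPerm m p) = swapLvl m (lvl p) :=
  lvl_ofLevel (swapLvl_lt (lvl_lt p))

section
variable {R : Type*} [CommRing R] {m n : ℕ}

theorem isUnit_det_updateCol_theta (s : R) (a : ℕ → Matrix (Fin n) (Fin n) R) (p₀ : Fin m)
    (hp₀ : lvl p₀ = 0) : IsUnit (compRingEquiv (Fin m) (Fin n) R
      (updateCol (ofLvl m (theta m s 1 a)) p₀ (Pi.single p₀ 1))).det := by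
  set Y := updateCol (ofLvl m (theta m s 1 a)) p₀ (Pi.single p₀ 1) with hY
  have hY0 : ∀ p, Y p p₀ = if lvl p = 0 then 1 else 0 := by
    intro p
    rw [hY, updateCol_self, ← hp₀]
    by_cases h : p = p₀
    · subst h; simp
    · rw [Pi.single_eq_of_ne h, if_neg (fun e => h (lvl_inj.1 e))]
  have hY1 : ∀ p q, lvl q ≠ 0 → Y p q = theta m s 1 a (lvl p) (lvl q) := by
    intro p q hq
    rw [hY, updateCol_ne]
    · rfl
    · rintro rfl
      exact hq hp₀
  let σ : Equiv.Perm (Fin m × Fin n) := (swapPerm m).prodCongr (Equiv.refl _)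
  -- The permutation brings the blocks $-I$ of the pairs $\{2j-1,2j\}$, and the block $-I$ at an odd
  -- top level, to the diagonal. Ranking the even levels upwards and then the odd levels downwards
  -- makes the matrix upper triangular.
  have hdet : IsUnit ((compRingEquiv (Fin m) (Fin n) R Y).submatrix id σ).det := by
    refine isUnit_det_of_triangular _
      (fun p => if lvl p.1 % 2 = 0 then lvl p.1 else 2 * m - lvl p.1) ?_ ?_
    · rintro ⟨p, c⟩
      change IsUnit (Y p (swapPerm m p) c c)
      have hp := lvl_lt p
      by_cases h0 : lvl p = 0
      · have : swapPerm m p = p₀ := by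
          rw [← lvl_inj, lvl_swapPerm, hp₀, h0]; rfl
        rw [this, hY0, if_pos h0]
        simp
      · have e : theta m s 1 a (lvl p) (swapLvl m (lvl p)) = (-1 : R) • 1 := by
          unfold theta swapLvl
          split_ifs <;> first | rfl | omega
        rw [hY1, lvl_swapPerm, e]
        · simp
        · rw [lvl_swapPerm]
          unfold swapLvl
          split_ifs <;> omega
    · rintro ⟨p, c⟩ ⟨q, d⟩ h1 h2
      change Y p (swapPerm m q) c d = 0
      dsimp only at h2
      have hp := lvl_lt p
      have hq := lvl_lt q
      have hcd : lvl p = lvl q → (1 : Matrix (Fin n) (Fin n) R) c d = 0 := by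
        intro e
        refine Matrix.one_apply_ne fun e' => h1 ?_
        rw [lvl_inj.1 e, e']
      by_cases h0 : lvl q = 0
      · have : swapPerm m q = p₀ := by
          rw [← lvl_inj, lvl_swapPerm, hp₀, h0]; rfl
        rw [this, hY0]
        split_ifs with h
        · exact hcd (by rw [h, h0])
        · rfl
      · rw [hY1, lvl_swapPerm]
        · by_cases hpq : lvl p = lvl q
          · have e : theta m s 1 a (lvl p) (swapLvl m (lvl q)) = (-1 : R) • 1 := by
              rw [hpq]
              unfold theta swapLvl
              split_ifs <;> first | rfl | omega
            rw [e, Matrix.smul_apply, hcd hpq, smul_zero]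
          · have e : theta m s 1 a (lvl p) (swapLvl m (lvl q)) = 0 := by
              revert h2
              unfold theta swapLvl
              split_ifs <;> first | (intro; rfl) | omega
            rw [e]; rfl
        · rw [lvl_swapPerm]
          unfold swapLvl
          split_ifs <;> omega
  rw [Matrix.det_permute'] at hdet
  exact isUnit_of_mul_isUnit_right hdet

theorem diagLast_eq {R : Type} [CommRing R] {m n : ℕ} (p₀ : Fin m) (hp₀ : lvl p₀ = 0)
    (X : Matrix (Fin n) (Fin n) R) : diagLast m X =
      compRingEquiv (Fin m) (Fin n) R (diagonal fun p => if p = p₀ then X else 1) := by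
  ext ⟨p, c⟩ ⟨q, d⟩
  change (if p = q then (if (p : ℕ) + 1 = m then X else 1) c d else 0) =
    (diagonal fun p => if p = p₀ then X else 1) p q c d
  have : ((p : ℕ) + 1 = m) ↔ p = p₀ := by
    rw [← lvl_inj, hp₀, ← val_add_eq_iff_lvl, add_zero]
  rw [Matrix.diagonal_apply]
  simp only [this]
  split_ifs <;> rfl

/-- The block column with `W` in the block `p₀`. -/
def blockCol {κ : Type*} (p₀ : Fin m) (W : Matrix (Fin n) κ R) : Matrix (Fin m × Fin n) κ R :=
  Matrix.of fun p j => if p.1 = p₀ then W p.2 j else 0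

/-- The block row with `W` in the block `p₀`. -/
def blockRow {κ : Type*} (p₀ : Fin m) (W : Matrix κ (Fin n) R) : Matrix κ (Fin m × Fin n) R :=
  Matrix.of fun i p => if p.1 = p₀ then W i p.2 else 0

/-- A unit column in `Y` transports `W` without altering it. The case `p₁ = p₀` expresses
invariance, the case `p₁ ≠ p₀` a move between levels. -/
theorem comp_mul_blockCol {κ : Type*} (p₀ p₁ : Fin m) (W : Matrix (Fin n) κ R)
    (Y : Matrix (Fin m) (Fin m) (Matrix (Fin n) (Fin n) R))
    (hY : ∀ p, Y p p₀ = if p = p₁ then 1 else 0) :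
    compRingEquiv (Fin m) (Fin n) R Y * blockCol p₀ W = blockCol p₁ W := by
  ext ⟨p, c⟩ j
  rw [Matrix.mul_apply, Fintype.sum_prod_type, Finset.sum_eq_single p₀]
  · have : ∀ d, compRingEquiv (Fin m) (Fin n) R Y (p, c) (p₀, d) = Y p p₀ c d := fun d => rfl
    simp only [this, hY, blockCol, Matrix.of_apply, if_true]
    by_cases hp : p = p₁
    · simp only [if_pos hp, Matrix.one_apply]
      simp
    · simp [if_neg hp]
  · intro q _ hq
    simp [blockCol, hq]
  · simp

theorem blockRow_mul_comp {κ : Type*} (p₀ : Fin m) (W : Matrix κ (Fin n) R)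
    (Y : Matrix (Fin m) (Fin m) (Matrix (Fin n) (Fin n) R))
    (hY : ∀ p, Y p₀ p = if p = p₀ then 1 else 0) :
    blockRow p₀ W * compRingEquiv (Fin m) (Fin n) R Y = blockRow p₀ W := by
  ext i ⟨p, c⟩
  rw [Matrix.mul_apply, Fintype.sum_prod_type, Finset.sum_eq_single p₀]
  · have : ∀ d, compRingEquiv (Fin m) (Fin n) R Y (p₀, d) (p, c) = Y p₀ p d c := fun d => rfl
    simp only [this, hY, blockRow, Matrix.of_apply, if_true]
    by_cases hp : p = p₀
    · simp only [if_pos hp, Matrix.one_apply]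
      simp
    · simp [if_neg hp]
  · intro q _ hq
    simp [blockRow, hq]
  · simp

/-- The tridiagonal pencil is equivalent to `diag(I, P)`, by transformations that fix the last
block column and the last block row. -/
theorem exists_equiv_diagLast {R : Type} [CommRing R] {m n : ℕ} (s : R)
    (a : ℕ → Matrix (Fin n) (Fin n) R) (p₀ : Fin m) (hp₀ : lvl p₀ = 0) :
    ∃ U V : Matrix (Fin m × Fin n) (Fin m × Fin n) R, IsUnit U.det ∧ IsUnit V.det ∧
      U * compRingEquiv (Fin m) (Fin n) R (ofLvl m (theta m s 1 a)) * V =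
        diagLast m (hornerUp m s a 0) ∧
      (∀ (κ : Type) (W : Matrix (Fin n) κ R), U * blockCol p₀ W = blockCol p₀ W) ∧
      (∀ (κ : Type) (W : Matrix κ (Fin n) R), blockRow p₀ W * V = blockRow p₀ W) := by
  set Y := updateCol (ofLvl m (theta m s 1 a)) p₀ (Pi.single p₀ 1) with hY
  have hYdet := isUnit_det_updateCol_theta s a p₀ hp₀
  set f : Fin m → Matrix (Fin n) (Fin n) R := fun p => colUp m s a (lvl p) with hf
  have hf0 : f p₀ = 1 := by
    simp [hf, hp₀, colUp]
  have hmul : ofLvl m (theta m s 1 a) * updateCol 1 p₀ f =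
      Y * diagonal fun p => if p = p₀ then hornerUp m s a 0 else 1 := by
    refine mul_updateCol_one _ f p₀ _ fun p => ?_
    have := sum_theta_mul_colUp m s a (lvl_lt p)
    rw [← sum_lvl (fun l => theta m s 1 a (lvl p) l * colUp m s a l)] at this
    have e : (p = p₀) = (lvl p = 0) := by rw [← hp₀, lvl_inj]
    simp only [e]
    exact this
  have hYi : (compRingEquiv (Fin m) (Fin n) R Y)⁻¹ * compRingEquiv (Fin m) (Fin n) R Y = 1 :=
    Matrix.nonsing_inv_mul _ hYdet
  refine ⟨(compRingEquiv (Fin m) (Fin n) R Y)⁻¹, compRingEquiv (Fin m) (Fin n) R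
    (updateCol 1 p₀ f), Matrix.isUnit_nonsing_inv_det _ hYdet, isUnit_det_updateCol_one f p₀ hf0,
    ?_, fun κ W => ?_, fun κ W => ?_⟩
  · rw [mul_assoc, ← map_mul, hmul, map_mul, ← mul_assoc, hYi, one_mul, diagLast_eq p₀ hp₀]
  -- `Y` itself fixes the block column, hence so does its inverse.
  · conv_lhs => rw [← comp_mul_blockCol p₀ p₀ W Y fun p => by
      rw [hY, updateCol_self, Pi.single_apply]]
    rw [← Matrix.mul_assoc, hYi, Matrix.one_mul]
  · refine blockRow_mul_comp p₀ W _ fun p => ?_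
    by_cases hp : p = p₀
    · rw [hp, updateCol_self, hf0, if_pos rfl]
    · rw [updateCol_ne hp, if_neg hp, Matrix.one_apply_ne (Ne.symm hp)]

end

/-! ### Consecutive inversions -/

/-- The state reached from `s` by reading a tuple from the right, where an entry that is one more
than the current state replaces it. -/
def track (s : ℤ) : List ℤ → ℤ
  | [] => s
  | i :: t => if i = track s t + 1 then i else track s t

/-- No entry of the tuple equals the state at the time when it is read. -/
def Avoids (s : ℤ) : List ℤ → Prop
  | [] => True
  | i :: t => i ≠ track s t ∧ Avoids s t

theorem track_append (s : ℤ) (t u : List ℤ) : track s (t ++ u) = track (track s u) t := by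
  induction t with
  | nil => rfl
  | cons i t ih => simp only [List.cons_append, track, ih]

theorem avoids_append {s : ℤ} {t u : List ℤ} :
    Avoids s (t ++ u) ↔ Avoids (track s u) t ∧ Avoids s u := by
  induction t with
  | nil => simp [Avoids]
  | cons i t ih => simp only [List.cons_append, Avoids, track_append, ih, and_assoc]

theorem le_track (s : ℤ) (t : List ℤ) : s ≤ track s t := by
  induction t with
  | nil => rfl
  | cons i t ih =>
    simp only [track]
    split_ifs <;> omega

theorem track_le_add_length (s : ℤ) (t : List ℤ) : track s t ≤ s + t.length := by
  induction t with
  | nil => simp [track]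
  | cons i t ih =>
    simp only [track, List.length_cons]
    push_cast
    split_ifs <;> omega

theorem str_of_lt {k l : ℤ} (h : l < k) : str k l = [] := by
  have : (l - k + 1).toNat = 0 := by omega
  simp [str, this]

theorem str_cons {k l : ℤ} (h : k ≤ l) : str k l = k :: str (k + 1) l := by
  have e1 : (l - k + 1).toNat = (l - (k + 1) + 1).toNat + 1 := by omega
  have e : ∀ k l : ℤ, str k l = (List.range (l - k + 1).toNat).map fun s : ℕ => k + (s : ℤ) :=
    fun k l => by simp [str, ← List.map_eq_flatMap, Function.comp_def]
  rw [e, e, e1, List.range_succ_eq_map, List.map_cons, List.map_map]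
  congr 1
  · simp
  · congr 1
    ext1 j
    simp only [Function.comp_apply]
    push_cast
    ring

theorem str_concat {k l : ℤ} (h : k ≤ l + 1) : str k (l + 1) = str k l ++ [l + 1] := by
  obtain ⟨d, hd⟩ : ∃ d : ℕ, l + 1 - k = d := ⟨(l + 1 - k).toNat, by omega⟩
  induction d generalizing k with
  | zero =>
    rw [str_cons h, str_of_lt (by omega), str_of_lt (by omega : l < k)]
    simp
    omega
  | succ d ih =>
    rw [str_cons h, ih (by omega) (by push_cast at hd; omega), str_cons (by push_cast at hd; omega : k ≤ l)]
    rfl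

/-- Greedy matching from the right is optimal: taking the first available $0$, then the first $1$
met after it, and so on, reaches every chain that is a subtuple. The start $-1$ stands for the empty
chain. -/
theorem reverse_str_sublist_iff (t : List ℤ) (s : ℕ) :
    (str 0 (0 + s)).reverse.Sublist t ↔ (s : ℤ) ≤ track (-1) t := by
  have h0 : (str 0 (0 + ((0 : ℕ) : ℤ))).reverse = [0] := by
    rw [str_cons (by simp), str_of_lt (by simp)]; rfl
  have h1 : ∀ s : ℕ, (str 0 (0 + ((s + 1 : ℕ) : ℤ))).reverse =
      ((s : ℤ) + 1) :: (str 0 (0 + (s : ℤ))).reverse := by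
    intro s
    have := str_concat (k := 0) (l := s) (by omega)
    push_cast
    rw [zero_add, zero_add, this, List.reverse_append]
    rfl
  induction t generalizing s with
  | nil =>
    simp only [List.sublist_nil, List.reverse_eq_nil_iff, track]
    constructor
    · intro h
      rw [str_cons (by omega)] at h
      cases h
    · intro h
      omega
  | cons i t ih =>
    have hg := le_track (-1) t
    have ih' : (str 0 (0 + (s : ℤ))).reverse.Sublist t ↔ (s : ℤ) ≤ track (-1) t := ih s
    rw [List.sublist_cons_iff, ih']
    simp only [track]
    rcases s with _ | s
    · rw [h0]
      simp only [List.cons.injEq, exists_and_left, exists_eq_left', List.nil_sublist, and_true,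
        and_assoc]
      split_ifs with h <;> push_cast <;> omega
    · rw [h1]
      have : (∃ r, ((s : ℤ) + 1) :: (str 0 (0 + (s : ℤ))).reverse = i :: r ∧ r.Sublist t) ↔
          (s : ℤ) + 1 = i ∧ (s : ℤ) ≤ track (-1) t := by
        have ih' : (str 0 (0 + (s : ℤ))).reverse.Sublist t ↔ (s : ℤ) ≤ track (-1) t := ih s
        rw [← ih']
        constructor
        · rintro ⟨r, hr, hrt⟩
          rw [List.cons.injEq] at hr
          exact ⟨hr.1, by rw [hr.2]; exact hrt⟩
        · rintro ⟨hs, ht⟩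
          exact ⟨_, by rw [hs], ht⟩
      rw [this]
      push_cast
      split_ifs with h <;> omega

theorem inversionsAt_zero (t : List ℤ) : inversionsAt 0 t = track (-1) t := by
  have hm : 0 ∈ t ↔ 0 ≤ track (-1) t := by
    rw [← List.singleton_sublist]
    have := reverse_str_sublist_iff t 0
    rw [str_cons (by simp), str_of_lt (by simp)] at this
    simpa using this
  have h1 := le_track (-1) t
  have h2 := track_le_add_length (-1) t
  unfold inversionsAt
  split_ifs with h
  · rw [hm] at h
    have : Nat.findGreatest (fun s : ℕ => (str 0 (0 + s)).reverse.Sublist t) t.length =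
        (track (-1) t).toNat := by
      rw [Nat.findGreatest_eq_iff]
      simp only [reverse_str_sublist_iff]
      refine ⟨by omega, fun _ => by omega, fun k hk _ => by omega⟩
    rw [this]
    omega
  · rw [hm] at h
    omega

/-- A string is read downwards, so once $s+1$ is met no larger entry follows and the state rises at
most once. For $b>s$ the entry $s$, if present, comes only after $s+1$ has changed the state; for
$b<s$ no entry reaches $s$. -/
theorem track_str {s a b : ℤ} (h : b < s ∨ s < b) :
    Avoids s (str a b) ∧ track s (str a b) = if a ≤ s + 1 ∧ s < b then s + 1 else s := by
  obtain ⟨d, hd⟩ : ∃ d : ℕ, (b + 1 - a).toNat = d := ⟨_, rfl⟩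
  induction d generalizing a with
  | zero =>
    rw [str_of_lt (by omega), if_neg (by omega)]
    exact ⟨trivial, rfl⟩
  | succ d ih =>
    rw [str_cons (by omega)]
    obtain ⟨h1, h2⟩ := ih (a := a + 1) (by omega)
    simp only [Avoids, track, h2]
    refine ⟨⟨?_, h1⟩, ?_⟩ <;> split_ifs <;> omega

/-! ### Inversions of canonical and simple tuples. -/

theorem canonical_succ (q : ℕ) (c : ℕ → ℕ) :
    ((List.range ((2 * (q + 1)) / 2)).flatMap fun k =>
      str (c k) (((2 * (q + 1) : ℕ) : ℤ) - 2 * ((k : ℤ) + 1))) =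
    str (c 0) (2 * q) ++ ((List.range ((2 * q) / 2)).flatMap fun k =>
      str (c (k + 1)) (((2 * q : ℕ) : ℤ) - 2 * ((k : ℤ) + 1))) := by
  have e1 : 2 * (q + 1) / 2 = q + 1 := by omega
  have e2 : 2 * q / 2 = q := by omega
  rw [e1, e2, List.range_succ_eq_map, List.flatMap_cons, List.flatMap_map]
  congr 2
  · push_cast; ring
  · ext1 k
    congr 1
    push_cast; ring

/-- The upper ends are met in the order $0,2,4,\dots$ while the state rises by at most one per
string. Started at $1$, it is at most $\max(j,1)$ when the upper end $2j$ is met, so the two never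
coincide. -/
theorem track_canonical (q : ℕ) (t : List ℤ) (ht : IsCanonical (2 * q) t) :
    Avoids 1 t ∧ track 1 t ≤ max q 1 := by
  obtain ⟨c, rfl⟩ := ht
  induction q generalizing c with
  | zero => simp [Avoids, track]
  | succ q ih =>
    rw [canonical_succ]
    obtain ⟨h1, h2⟩ := ih fun k => c (k + 1)
    have h3 := le_track 1 ((List.range ((2 * q) / 2)).flatMap fun k =>
      str (c (k + 1)) (((2 * q : ℕ) : ℤ) - 2 * ((k : ℤ) + 1)))
    rw [avoids_append, track_append]
    generalize ((List.range ((2 * q) / 2)).flatMap fun k =>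
      str (c (k + 1)) (((2 * q : ℕ) : ℤ) - 2 * ((k : ℤ) + 1))) = u at *
    obtain ⟨h4, h5⟩ := track_str (s := track 1 u) (a := c 0) (b := 2 * q) (by omega)
    refine ⟨⟨h4, h1⟩, ?_⟩
    rw [h5]
    push_cast
    split_ifs <;> omega

theorem mem_str {k l i : ℤ} : i ∈ str k l ↔ k ≤ i ∧ i ≤ l := by
  obtain ⟨d, hd⟩ : ∃ d : ℕ, (l + 1 - k).toNat = d := ⟨_, rfl⟩
  induction d generalizing k with
  | zero =>
    rw [str_of_lt (by omega)]
    simp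
    omega
  | succ d ih =>
    rw [str_cons (by omega), List.mem_cons, ih (by omega)]
    omega

theorem IsCanonical.mem_bounds {h : ℕ} {t : List ℤ} (ht : IsCanonical h t) {i : ℤ} (hi : i ∈ t) :
    0 ≤ i ∧ i + 2 ≤ h := by
  obtain ⟨c, rfl⟩ := ht
  rw [List.mem_flatMap] at hi
  obtain ⟨k, -, hi⟩ := hi
  rw [mem_str] at hi
  omega

theorem track_simpleTuple (q : ℕ) :
    track (-1) (simpleTuple (2 * q)) = if q = 0 then 0 else 1 := by
  rw [simpleTuple_two_mul, track_append]
  have : track (-1) [0] = 0 := by simp [track]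
  rw [this]
  induction q with
  | zero => simp [simpleInit, track]
  | succ q ih =>
    simp only [simpleInit, track, ih]
    rcases q with _ | q
    · simp
    · rw [if_neg (by omega), if_neg (by omega)]
      push_cast

/-- From state $0$ the tuple $(h-1,\dots,3,1)$ ends in the same state as $\mathbf w$ read from $-1$.
Thus the factor that actually acts on the block column may replace $\mathbf w$ in the count of
inversions. -/
theorem track_altTuple (q : ℕ) :
    Avoids 0 (altTuple (2 * q - 1)) ∧ track 0 (altTuple (2 * q - 1)) = if q = 0 then 0 else 1 := by
  induction q with
  | zero => simp [altTuple, track, Avoids]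
  | succ q ih =>
    rw [show 2 * (q + 1) - 1 = 2 * q + 1 by omega, altTuple_succ]
    obtain ⟨h1, h2⟩ := ih
    simp only [Avoids, track, h2]
    refine ⟨⟨?_, h1⟩, ?_⟩
    · push_cast; split_ifs <;> omega
    · push_cast; split_ifs <;> omega

/-! ### The action of elementary matrices on block columns -/

section
variable {n r : ℕ} (m : ℕ)

theorem colKron_eq_blockCol {m : ℕ} (p : Fin m) (W : Matrix (Fin n) (Fin r) ℂ) :
    colKron m (m - lvl p) W = blockCol p W := by
  ext ⟨q, c⟩ j
  have : (((q : ℕ) : ℤ) + 1 = m - lvl p) = (q = p) := by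
    have := q.2
    have := p.2
    rw [← lvl_inj, eq_iff_iff]
    unfold lvl
    omega
  simp only [colKron, blockCol, Matrix.of_apply, this]

theorem colKron_eq_blockCol' {m : ℕ} {s : ℤ} (h0 : 0 ≤ s) (hs : s < m)
    (W : Matrix (Fin n) (Fin r) ℂ) :
    colKron m (m - s) W = blockCol (ofLevel s.toNat (by omega)) W := by
  rw [← colKron_eq_blockCol, lvl_ofLevel, Int.toNat_of_nonneg h0]

theorem elemM_mul_colKron_of_far {i s : ℤ} (h1 : -(m : ℤ) ≤ i) (h2 : i < m) (hs : 0 ≤ s)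
    (hsm : s < m) (h3 : s ≠ i.natAbs) (h4 : s + 1 ≠ i.natAbs) (X : Matrix (Fin n) (Fin n) ℂ)
    (W : Matrix (Fin n) (Fin r) ℂ) :
    elemM m i X * colKron m (m - s) W = colKron m (m - s) W := by
  rw [colKron_eq_blockCol' hs hsm, ← compRingEquiv_elemB, elemB_eq m i X h1 h2]
  refine comp_mul_blockCol _ _ W _ fun p => ?_
  simp only [ofLvl, tri, Matrix.of_apply, ← lvl_inj, lvl_ofLevel]
  have c1 : s.toNat ≠ i.natAbs := by omega
  have c2 : s.toNat + 1 ≠ i.natAbs := by omega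
  by_cases h : lvl p = s.toNat
  · simp [h, elemDiag, c1, c2]
  · rw [if_neg h, if_neg h, if_neg (by omega)]

/-- The second block column of $\begin{bmatrix}X&I\\I&0\end{bmatrix}$ does not contain $X$. -/
theorem elemM_mul_colKron_of_succ {s : ℤ} (hs : 0 ≤ s) (hsm : s + 1 < m)
    (X : Matrix (Fin n) (Fin n) ℂ) (W : Matrix (Fin n) (Fin r) ℂ) :
    elemM m (s + 1) X * colKron m (m - s) W = colKron m (m - (s + 1)) W := by
  rw [colKron_eq_blockCol' hs (by omega), colKron_eq_blockCol' (by omega) hsm,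
    ← compRingEquiv_elemB, elemB_eq m (s + 1) X (by omega) (by omega)]
  refine comp_mul_blockCol _ _ W _ fun p => ?_
  simp only [ofLvl, tri, Matrix.of_apply, ← lvl_inj, lvl_ofLevel, elemDiag]
  split_ifs <;> first | rfl | omega

theorem prodM_cons (i : ℤ) (t : List ℤ) (X : Matrix (Fin n) (Fin n) ℂ)
    (𝒳 : List (Matrix (Fin n) (Fin n) ℂ)) :
    prodM m (i :: t) (X :: 𝒳) = elemM m i X * prodM m t 𝒳 := by
  simp [prodM]

theorem prodM_nil_right (t : List ℤ) : prodM (n := n) m t [] = 1 := by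
  simp [prodM]

theorem prodM_append {t u : List ℤ} {𝒳 𝒴 : List (Matrix (Fin n) (Fin n) ℂ)}
    (h : 𝒳.length = t.length) : prodM m (t ++ u) (𝒳 ++ 𝒴) = prodM m t 𝒳 * prodM m u 𝒴 := by
  rw [prodM, List.zipWith_append h.symm, List.prod_append]
  rfl

theorem prodP_eq_prodM (a : ℕ → Matrix (Fin n) (Fin n) ℂ) (t : List ℤ) :
    prodP m a t = prodM m t (t.map (coeffP a)) := by
  rw [prodM, List.zipWith_map_right, List.zipWith_self]
  rfl

theorem prodM_mul_colKron_of_far {s : ℤ} (hs : 0 ≤ s) (hsm : s < m) (t : List ℤ)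
    (ht : ∀ i ∈ t, -(m : ℤ) ≤ i ∧ i < m ∧ s ≠ i.natAbs ∧ s + 1 ≠ i.natAbs)
    (𝒳 : List (Matrix (Fin n) (Fin n) ℂ)) (W : Matrix (Fin n) (Fin r) ℂ) :
    prodM m t 𝒳 * colKron m (m - s) W = colKron m (m - s) W := by
  induction t generalizing 𝒳 with
  | nil => simp [prodM]
  | cons i t ih =>
    rcases 𝒳 with _ | ⟨X, 𝒳⟩
    · rw [prodM_nil_right, Matrix.one_mul]
    · obtain ⟨h1, h2, h3, h4⟩ := ht i (by simp)
      rw [prodM_cons, Matrix.mul_assoc, ih (fun j hj => ht j (by simp [hj])),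
        elemM_mul_colKron_of_far m h1 h2 hs hsm h3 h4]

/-- An entry equal to the current state would act through the first block column $(X,I)$ and bring
in the assignment; `Avoids` excludes exactly this. All other entries move the block up one level or
leave it alone. -/
theorem prodM_mul_colKron {s : ℤ} (hs : 0 ≤ s) (hsm : s < m) (t : List ℤ)
    (ht : ∀ i ∈ t, 0 ≤ i ∧ i < m) (hav : Avoids s t) (𝒳 : List (Matrix (Fin n) (Fin n) ℂ))
    (hl : 𝒳.length = t.length) (W : Matrix (Fin n) (Fin r) ℂ) :
    track s t < m ∧ prodM m t 𝒳 * colKron m (m - s) W = colKron m (m - track s t) W := by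
  induction t generalizing 𝒳 with
  | nil => exact ⟨hsm, by simp [prodM, track]⟩
  | cons i t ih =>
    rcases 𝒳 with _ | ⟨X, 𝒳⟩
    · simp at hl
    · have hi := ht i (by simp)
      obtain ⟨h1, h2⟩ := ih (fun j hj => ht j (by simp [hj])) hav.2 𝒳 (by simpa using hl)
      have h3 := le_track s t
      have h4 := hav.1
      simp only [track]
      refine ⟨by split_ifs <;> omega, ?_⟩
      rw [prodM_cons, Matrix.mul_assoc, h2]
      split_ifs with h
      · rw [h, elemM_mul_colKron_of_succ m (by omega) (by omega)]
      · exact elemM_mul_colKron_of_far m (by omega) (by omega) (by omega) h1 (by omega) (by omega)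
          X W

theorem prodM_transpose {t : List ℤ} {𝒳 : List (Matrix (Fin n) (Fin n) ℂ)}
    (hl : 𝒳.length = t.length) (hs : ∀ M ∈ 𝒳, M.IsSymm) :
    (prodM m t 𝒳)ᵀ = prodM m t.reverse 𝒳.reverse := by
  rw [prodM, Matrix.transpose_list_prod, prodM, ← List.reverse_zipWith hl.symm, List.map_zipWith]
  congr 2
  induction t generalizing 𝒳 with
  | nil => simp
  | cons i t ih =>
    rcases 𝒳 with _ | ⟨X, 𝒳⟩
    · simp
    · rw [List.zipWith_cons_cons, List.zipWith_cons_cons, ih (by simpa using hl)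
        (fun M hM => hs M (by simp [hM])), elemM_transpose, hs X (by simp)]

theorem det_prodM_ne_zero {t : List ℤ} {𝒳 : List (Matrix (Fin n) (Fin n) ℂ)}
    (h : IsNonsingularAssignment m t 𝒳) : (prodM m t 𝒳).det ≠ 0 := by
  obtain ⟨hl, h⟩ := h
  induction t generalizing 𝒳 with
  | nil => simp [prodM]
  | cons i t ih =>
    rcases 𝒳 with _ | ⟨X, 𝒳⟩
    · simp at hl
    · rw [prodM_cons, Matrix.det_mul]
      exact mul_ne_zero (det_elemM_ne_zero m i X (h (i, X) (by simp)))
        (ih (by simpa using hl) fun x hx => h x (by simp [hx]))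

end

/-! ### Block structure of the pencils -/

section extend
variable {m n r : ℕ}

theorem extendOne_mul (M N : Matrix (Fin m × Fin n) (Fin m × Fin n) ℂ) :
    extendOne r (M * N) = extendOne r M * extendOne r N := by
  simp [extendOne, fromBlocks_multiply]

theorem extendOne_one : extendOne r (1 : Matrix (Fin m × Fin n) (Fin m × Fin n) ℂ) = 1 := by
  simp [extendOne]

/-- `extendOne` as a monoid homomorphism. -/
def extendHom (m n r : ℕ) : Matrix (Fin m × Fin n) (Fin m × Fin n) ℂ →*
    Matrix ((Fin m × Fin n) ⊕ Fin r) ((Fin m × Fin n) ⊕ Fin r) ℂ where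
  toFun := extendOne r
  map_one' := extendOne_one
  map_mul' := extendOne_mul

theorem prodMM_eq (t : List ℤ) (𝒳 : List (Matrix (Fin n) (Fin n) ℂ)) :
    prodMM m r t 𝒳 = extendOne r (prodM m t 𝒳) := by
  have := map_list_prod (extendHom m n r) (List.zipWith (fun i X => elemM m i X) t 𝒳)
  rw [List.map_zipWith] at this
  exact this.symm

theorem prodPP_eq (a : ℕ → Matrix (Fin n) (Fin n) ℂ) (t : List ℤ) :
    prodPP m r a t = extendOne r (prodP m a t) := by
  have := map_list_prod (extendHom m n r) (t.map (fiedlerP m a))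
  rw [List.map_map] at this
  exact this.symm

theorem fiedlerP_mul_neg (a : ℕ → Matrix (Fin n) (Fin n) ℂ) {i : ℤ} (h0 : i ≠ 0)
    (h1 : i.natAbs < m) : fiedlerP m a i * fiedlerP m a (-i) = 1 := by
  have := prodP_mul_invTuple m a (t := [i]) (by simpa using ⟨h0, h1⟩)
  simpa [prodP, invTuple] using this

variable (a : ℕ → Matrix (Fin n) (Fin n) ℂ) (A : Matrix (Fin r) (Fin r) ℂ)
  (B : Matrix (Fin r) (Fin n) ℂ) (C : Matrix (Fin n) (Fin r) ℂ) (E : Matrix (Fin r) (Fin r) ℂ)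

theorem fiedlerS_of_neg {i : ℤ} (h1 : -(m : ℤ) < i) (h2 : i < 0) :
    fiedlerS m a A B C E i = extendOne r (fiedlerP m a i) := by
  unfold fiedlerS
  rw [if_neg (by omega), if_neg (by omega), if_neg (by omega)]
  refine Matrix.inv_eq_right_inv ?_
  have := fiedlerP_mul_neg (m := m) a (i := -i) (by omega) (by omega)
  rw [neg_neg] at this
  rw [← extendOne_mul, this, extendOne_one]

/-- Among the negative indices only $-m$ acts on the state coordinates, so its multiplicity is all
that the lower right block records. -/
theorem prodSS_of_neg (t : List ℤ) (ht : ∀ i ∈ t, -(m : ℤ) ≤ i ∧ i < 0) :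
    prodSS m a A B C E t = fromBlocks (prodP m a t) 0 0 ((-E) ^ t.count (-(m : ℤ))) := by
  induction t with
  | nil => simp [prodSS, prodP]
  | cons i t ih =>
    have hi := ht i (by simp)
    have e1 : prodSS m a A B C E (i :: t) = fiedlerS m a A B C E i * prodSS m a A B C E t := by
      simp [prodSS]
    have e2 : prodP m a (i :: t) = fiedlerP m a i * prodP m a t := by
      simp [prodP]
    rw [e1, e2, ih fun j hj => ht j (by simp [hj])]
    by_cases h : i = -(m : ℤ)
    · have : fiedlerS m a A B C E i = fromBlocks (fiedlerP m a i) 0 0 (-E) := by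
        unfold fiedlerS
        rw [if_neg (by omega), if_pos h, h]
      rw [this, fromBlocks_multiply, h, List.count_cons_self, pow_succ']
      simp
    · rw [fiedlerS_of_neg a A B C E (by omega) hi.2, extendOne, fromBlocks_multiply,
        List.count_cons_of_ne h]
      simp

theorem prodSS_shift_simpleTuple {k : ℕ} (hk : k < m) :
    prodSS m a A B C E (shift (-m) (simpleTuple k)) =
      fromBlocks (prodP m a (shift (-m) (simpleTuple k))) 0 0 (-E) := by
  rw [prodSS_of_neg]
  · have : (shift (-m) (simpleTuple k)).count (-(m : ℤ)) = 1 := by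
      have := List.count_map_of_injective (simpleTuple k) (fun i : ℤ => i + -(m : ℤ))
        (add_left_injective _) 0
      rw [zero_add, count_zero_simpleTuple] at this
      exact this
    rw [this, pow_one]
  · intro i hi
    rw [mem_shift, mem_simpleTuple] at hi
    omega

/-- For even $h$ the index $0$ stands last in $\mathbf w$. All other factors are of the form
$\operatorname{diag}(M,I_r)$ and multiply its upper block row from the left, leaving the lower one
intact. -/
theorem prodSS_simpleTuple (q : ℕ) :
    prodSS m a A B C E (simpleTuple (2 * q)) =
      fromBlocks (prodP m a (simpleTuple (2 * q))) (-(prodP m a (simpleInit q) * colKron m m C))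
        (-rowKron m m B) (-A) := by
  have h1 : prodSS m a A B C E (simpleInit q) = extendOne r (prodP m a (simpleInit q)) := by
    rw [← prodPP_eq, prodSS, prodPP]
    congr 1
    refine List.map_congr_left fun i hi => ?_
    rw [mem_simpleInit] at hi
    unfold fiedlerS
    rw [if_neg (by omega), if_neg (by omega), if_pos (by omega)]
  have h2 : prodSS m a A B C E (simpleInit q ++ [0]) =
      prodSS m a A B C E (simpleInit q) * fiedlerS m a A B C E 0 := by
    simp [prodSS]
  rw [simpleTuple_two_mul, h2, h1, prodP_append, prodP_singleton, fiedlerS, if_pos rfl, extendOne,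
    fromBlocks_multiply]
  simp

end extend

/-! ### Constant matrix polynomials. -/

section cPoly
variable {ι κ : Type}

theorem cPoly_mul {ν : Type} [Fintype κ] (M : Matrix ι κ ℂ) (N : Matrix κ ν ℂ) :
    cPoly (M * N) = cPoly M * cPoly N :=
  Matrix.map_mul

theorem cPoly_neg (M : Matrix ι κ ℂ) : cPoly (-M) = -cPoly M := by
  ext i j : 2
  simp [cPoly]

theorem cPoly_zero : cPoly (0 : Matrix ι κ ℂ) = 0 := by
  ext i j : 2
  simp [cPoly]

theorem cPoly_one [DecidableEq ι] : cPoly (1 : Matrix ι ι ℂ) = 1 :=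
  Matrix.map_one _ (by simp) (by simp)

theorem cPoly_transpose (M : Matrix ι κ ℂ) : (cPoly M)ᵀ = cPoly Mᵀ := rfl

theorem cPoly_fromBlocks {ι' κ' : Type} (M : Matrix ι κ ℂ) (N : Matrix ι κ' ℂ)
    (K : Matrix ι' κ ℂ) (L : Matrix ι' κ' ℂ) :
    cPoly (fromBlocks M N K L) = fromBlocks (cPoly M) (cPoly N) (cPoly K) (cPoly L) :=
  fromBlocks_map ..

end cPoly

/-! ### Block form, symmetry and strict equivalence of the pencils. -/

section pencil
variable {m n r h : ℕ} (hh : Even h) (hm : h < m) (a : ℕ → Matrix (Fin n) (Fin n) ℂ)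
include hh hm

/-- The $\mathbf v$ part is block diagonal, so the coupling blocks come from the $\mathbf w$ part
alone and are constant; the minus sign of the pencil cancels those in $\mathbb M^{\mathcal S}_0$. -/
theorem pencilS_eq_fromBlocks (A : Matrix (Fin r) (Fin r) ℂ)
    (B : Matrix (Fin r) (Fin n) ℂ) (C : Matrix (Fin n) (Fin r) ℂ) (E : Matrix (Fin r) (Fin r) ℂ)
    (tw tv : List ℤ) (𝒳 𝒴 : List (Matrix (Fin n) (Fin n) ℂ)) :
    pencilS m h a A B C E tw tv 𝒳 𝒴 = systemMatrix (pencilP m h a tw tv 𝒳 𝒴) A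
      (rowKron m m B * (prodP m a (simpleComplement h ++ shift (-m) (simpleComplement (m - h - 1)))
        * prodM m (tw.reverse ++ tv.reverse) (𝒳.reverse ++ 𝒴.reverse)))
      (prodM m (tv ++ tw) (𝒴 ++ 𝒳) * (prodP m a (altTuple (h - 1)) * prodP m a (altTuple h)
        * colKron m m C)) E := by
  obtain ⟨q, hq⟩ := hh
  obtain rfl : h = 2 * q := by omega
  have e : prodP m a (simpleInit q) =
      prodP m a (altTuple (2 * q - 1)) * prodP m a (altTuple (2 * q)) :=
    prod_map_simpleInit (fiedlerP m a) q fun i j h1 h2 h3 =>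
      elemM_commute m _ _ (by omega) (by omega) (by omega) (by omega) (by unfold Far; omega)
  unfold pencilS pencilP systemMatrix
  rw [prodSS_simpleTuple a A B C E q, prodSS_shift_simpleTuple a A B C E (by omega), prodMM_eq,
    prodMM_eq, prodPP_eq, extendOne, extendOne, extendOne, e]
  simp only [cPoly_fromBlocks, cPoly_mul, cPoly_neg, cPoly_zero, cPoly_one, fromBlocks_smul,
    sub_eq_add_neg, fromBlocks_neg, fromBlocks_add, fromBlocks_multiply]
  congr 1
  · simp
  · simp [Matrix.mul_assoc]
  · simp [Matrix.mul_assoc]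
  · simp [add_comm]

omit hh hm in
theorem coeffP_isSymm (ha : ∀ j ≤ m, (a j).IsSymm) {i : ℤ} (hi : i.natAbs ≤ m) :
    (coeffP a i).IsSymm := by
  unfold coeffP
  split_ifs
  · exact (ha _ hi).neg
  · exact ha _ hi

omit hh hm in
theorem prodP_transpose (ha : ∀ j ≤ m, (a j).IsSymm) {t : List ℤ}
    (ht : ∀ i ∈ t, -(m : ℤ) ≤ i ∧ i < m) (hf : t.Pairwise Far) :
    (prodP m a t)ᵀ = prodP m a t := by
  induction t with
  | nil => simp [prodP]
  | cons i t ih =>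
    rw [List.pairwise_cons] at hf
    have hi := ht i (by simp)
    have hc : Commute (prodP m a [i]) (prodP m a t) :=
      prodP_commute m a (fun j hj => ht j (by simp_all)) (fun j hj => ht j (by simp [hj]))
        fun j hj k hk => by
          rw [List.mem_singleton] at hj
          exact hj ▸ hf.1 k hk
    have e : (fiedlerP m a i)ᵀ = fiedlerP m a i := by
      change (elemM m i (coeffP a i))ᵀ = elemM m i (coeffP a i)
      rw [elemM_transpose, coeffP_isSymm a ha (by omega)]
    rw [show i :: t = [i] ++ t from rfl, prodP_append, Matrix.transpose_mul,
      ih (fun j hj => ht j (by simp [hj])) hf.2, prodP_singleton, e, ← prodP_singleton, hc.eq]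

omit hh in
theorem mem_shift_simpleComplement {i : ℤ} (hi : i ∈ shift (-m) (simpleComplement (m - h - 1))) :
    -(m : ℤ) ≤ i ∧ i + h + 2 ≤ 0 ∧ (i = -m → (m - h - 1) % 2 = 1) ∧
      (i + m) % 2 = ((m - h - 1 : ℕ) + 1 : ℤ) % 2 := by
  rw [mem_shift, simpleComplement_eq, List.mem_append, mem_altTuple] at hi
  by_cases hk : (m - h - 1) % 2 = 1
  · rw [if_pos hk, List.mem_singleton] at hi
    omega
  · rw [if_neg hk] at hi
    simp only [List.not_mem_nil, or_false] at hi
    omega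

omit hm in
theorem simpleComplement_of_even : simpleComplement h = altTuple (h - 1) := by
  obtain ⟨q, hq⟩ := hh
  rw [simpleComplement_eq, if_neg (by omega), List.append_nil]

omit hh in
theorem pairwise_shift_simpleComplement :
    (shift (-m) (simpleComplement (m - h - 1))).Pairwise Far := by
  rw [simpleComplement_eq, shift, List.map_append, List.pairwise_append]
  refine ⟨pairwise_far_shift m (by omega), by split_ifs <;> simp, fun i hi j hj => ?_⟩
  change i ∈ shift (-m) _ at hi
  rw [mem_shift, mem_altTuple] at hi
  split_ifs at hj with hk
  · simp only [List.map_cons, List.map_nil, List.mem_singleton] at hj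
    unfold Far
    omega
  · simp at hj

theorem pairwise_complement : (simpleComplement h ++
    shift (-m) (simpleComplement (m - h - 1))).Pairwise Far := by
  rw [simpleComplement_of_even hh, List.pairwise_append]
  refine ⟨pairwise_far_altTuple _, pairwise_shift_simpleComplement hm, fun i hi j hj => ?_⟩
  have := mem_shift_simpleComplement hm hj
  rw [mem_altTuple] at hi
  unfold Far
  omega

/-- For even $h$ the complement of $\mathbf w$ does not contain $0$, and that of $\mathbf v$
contains $-m$ only if $m-h-1$ is odd. Hence $A_m$ enters the determinant of the right factor only
for even $m$. -/
theorem mem_complement {i : ℤ} (hi : i ∈ simpleComplement h ++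
    shift (-m) (simpleComplement (m - h - 1))) : -(m : ℤ) ≤ i ∧ i < m ∧ i ≠ 0 ∧
      (i = -m → Even m) := by
  rw [simpleComplement_of_even hh, List.mem_append, mem_altTuple] at hi
  obtain ⟨q, hq⟩ := hh
  rcases hi with hi | hi
  · refine ⟨by omega, by omega, by omega, fun _ => by omega⟩
  · have := mem_shift_simpleComplement hm hi
    refine ⟨by omega, by omega, by omega, fun h' => ?_⟩
    have := this.2.2.1 h'
    rw [Nat.even_iff]
    omega

/-- The coefficients of the pencil `(λ M_v^P - M_w^P) M_{(c_w, c_v)}^P` are symmetric. -/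
theorem isSymm_coefficients (ha : ∀ j ≤ m, (a j).IsSymm) :
    (prodP m a (shift (-m) (simpleTuple (m - h - 1))) *
      prodP m a (simpleComplement h ++ shift (-m) (simpleComplement (m - h - 1)))).IsSymm ∧
    (prodP m a (simpleTuple h) *
      prodP m a (simpleComplement h ++ shift (-m) (simpleComplement (m - h - 1)))).IsSymm := by
  have hCv := prodP_transpose a ha (t := shift (-m) (simpleComplement (m - h - 1)))
    (fun i hi => by have := mem_shift_simpleComplement hm hi; omega)
    (pairwise_shift_simpleComplement hm)
  have hCw := prodP_transpose a ha (t := altTuple (h - 1))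
    (fun i hi => by rw [mem_altTuple] at hi; omega) (pairwise_far_altTuple _)
  have hcomm := fun i j => elemM_commute m (i := i) (j := j) (coeffP a i) (coeffP a j)
  rw [prodP_append, simpleComplement_of_even hh]
  constructor
  -- Write $M_{\mathbf v}=M_{\mathbf c_v}M_D$ with $D$ far from $\mathbf c_w$. Then $M_{\mathbf
  -- v}M_{\mathbf c_w}M_{\mathbf c_v}=M_{\mathbf c_v}(M_DM_{\mathbf c_w})M_{\mathbf c_v}$, whose
  -- middle factor is a product of commuting symmetric matrices. The index $-m$ belongs to $\mathbf
  -- c_v$ or to $D$ according to the parity of $m-h-1$.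
  · obtain ⟨D, hD1, hD2, hD3⟩ : ∃ D : List ℤ, prodP m a (shift (-m) (simpleTuple (m - h - 1))) =
        prodP m a (shift (-m) (simpleComplement (m - h - 1))) * prodP m a D ∧ D.Pairwise Far ∧
        ∀ i ∈ D, -(m : ℤ) ≤ i ∧ i + h + 1 ≤ 0 := by
      have e : ∀ t, prodP m a (shift (-m) t) = (t.map fun i => fiedlerP m a (i + -m)).prod :=
        fun t => by simp [prodP, shift, List.map_map, Function.comp_def]
      have hprod := prod_map_simpleTuple (fun i => fiedlerP m a (i + -m)) (m - h - 1)
        fun i j h1 h2 h3 => hcomm (i + -m) (j + -m) (by omega) (by omega) (by omega) (by omega)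
          (by unfold Far; omega)
      rw [← e, ← e, ← e, zero_add] at hprod
      by_cases hk : (m - h - 1) % 2 = 1
      · refine ⟨shift (-m) (altTuple (m - h - 1)), ?_, pairwise_far_shift m (by omega), ?_⟩
        · rw [hprod, simpleComplement_eq, if_pos hk]
          congr 1
          rw [shift, shift, List.map_append, prodP_append]
          simp [prodP]
        · intro i hi
          rw [mem_shift, mem_altTuple] at hi
          omega
      · refine ⟨[-(m : ℤ)] ++ shift (-m) (altTuple (m - h - 1)), ?_, ?_, ?_⟩
        · rw [hprod, simpleComplement_eq, if_neg hk, List.append_nil, prodP_append,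
            prodP_singleton, mul_assoc]
        · rw [List.pairwise_append]
          refine ⟨by simp, pairwise_far_shift m (by omega), fun i hi j hj => ?_⟩
          rw [mem_shift, mem_altTuple] at hj
          rw [List.mem_singleton] at hi
          unfold Far
          omega
        · intro i hi
          rw [List.mem_append, mem_shift, mem_altTuple, List.mem_singleton] at hi
          omega
    have hDC := prodP_transpose a ha (t := D ++ altTuple (h - 1))
      (fun i hi => by
        rw [List.mem_append, mem_altTuple] at hi
        rcases hi with hi | hi
        · have := hD3 i hi; omega
        · omega)
      (by
        rw [List.pairwise_append]
        refine ⟨hD2, pairwise_far_altTuple _, fun i hi j hj => ?_⟩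
        have := hD3 i hi
        rw [mem_altTuple] at hj
        unfold Far
        omega)
    rw [prodP_append] at hDC
    unfold Matrix.IsSymm
    have e : ∀ X Y Z : Matrix (Fin m × Fin n) (Fin m × Fin n) ℂ,
        X * Y * (Z * X) = X * (Y * Z) * X := fun X Y Z => by simp only [mul_assoc]
    rw [hD1, e, Matrix.transpose_mul, Matrix.transpose_mul, hDC, hCv]
    simp only [mul_assoc]
  · obtain ⟨q, hq⟩ := hh
    obtain rfl : h = 2 * q := by omega
    -- The same shape with the roles exchanged: $M_{\mathbf c_w}$ goes outside, after it has been
    -- commuted past $M_{\mathbf c_v}$.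
    have hW : prodP m a (simpleTuple (2 * q)) =
        prodP m a (altTuple (2 * q - 1)) * prodP m a (altTuple (2 * q) ++ [0]) := by
      rw [simpleTuple_two_mul, prodP_append, prodP_append, ← mul_assoc]
      congr 1
      exact prod_map_simpleInit (fiedlerP m a) q fun i j h1 h2 h3 =>
        hcomm i j (by omega) (by omega) (by omega) (by omega) (by unfold Far; omega)
    have hc : Commute (prodP m a (altTuple (2 * q - 1)))
        (prodP m a (shift (-m) (simpleComplement (m - 2 * q - 1)))) :=
      prodP_commute m a (fun i hi => by rw [mem_altTuple] at hi; omega)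
        (fun i hi => by have := mem_shift_simpleComplement hm hi; omega)
        fun i hi j hj => by
          rw [mem_altTuple] at hi
          have := mem_shift_simpleComplement hm hj
          unfold Far
          omega
    have hDC := prodP_transpose a ha
      (t := (altTuple (2 * q) ++ [0]) ++ shift (-m) (simpleComplement (m - 2 * q - 1)))
      (fun i hi => by
        rw [List.mem_append, List.mem_append, mem_altTuple, List.mem_singleton] at hi
        rcases hi with hi | hi
        · omega
        · have := mem_shift_simpleComplement hm hi; omega)
      (by
        rw [List.pairwise_append, List.pairwise_append]
        refine ⟨⟨pairwise_far_altTuple _, by simp, fun i hi j hj => ?_⟩,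
          pairwise_shift_simpleComplement hm, fun i hi j hj => ?_⟩
        · rw [mem_altTuple] at hi
          rw [List.mem_singleton] at hj
          unfold Far
          omega
        · have := mem_shift_simpleComplement hm hj
          rw [List.mem_append, mem_altTuple, List.mem_singleton] at hi
          unfold Far
          omega)
    rw [prodP_append] at hDC
    unfold Matrix.IsSymm
    have e : ∀ X Y Z : Matrix (Fin m × Fin n) (Fin m × Fin n) ℂ,
        X * Y * (Z * X) = X * (Y * Z) * X := fun X Y Z => by simp only [mul_assoc]
    rw [hW, hc.eq, e, Matrix.transpose_mul, Matrix.transpose_mul, hDC, hCw]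
    simp only [mul_assoc]

/-! ### Pencils with canonical tuples and matrix assignments. -/

section tuples
variable {tw tv : List ℤ} (htw : IsCanonical h tw) (htv : IsCanonical (m - h - 1) (shift m tv))
  {𝒳 𝒴 : List (Matrix (Fin n) (Fin n) ℂ)}
include htw htv

omit htw hh hm in
theorem mem_tv_bounds {i : ℤ} (hi : i ∈ tv) : -(m : ℤ) ≤ i ∧ i + m + 2 ≤ (m - h - 1 : ℕ) := by
  have : i + m ∈ shift m tv := by
    rw [mem_shift]
    simpa using hi
  have := htv.mem_bounds this
  omega

omit htv in
-- The auxiliary `s` is the state after the factors of $\mathbf w$: it is $0$ for $h=0$, where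
-- $\mathbf t_w$ is empty, and $1$ otherwise, which is the start that canonical tuples need. The
-- bound $\alpha\le h$ keeps the block within range.
theorem track_tw {α : ℤ} (hα : α = inversionsAt 0 (tw ++ simpleTuple h)) :
    ∃ s : ℤ, 0 ≤ s ∧ s ≤ 1 ∧ s ≤ h ∧ Avoids s tw ∧ α = track s tw ∧ s ≤ α ∧ α ≤ h ∧
      Avoids 0 (altTuple (h - 1)) ∧ track 0 (altTuple (h - 1)) = s := by
  obtain ⟨q, hq⟩ := hh
  obtain rfl : h = 2 * q := by omega
  rw [inversionsAt_zero, track_append, track_simpleTuple] at hα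
  obtain ⟨h1, h2⟩ := track_canonical q tw htw
  obtain ⟨h3, h4⟩ := track_altTuple q
  have h5 := le_track 1 tw
  rcases q with _ | q
  · have : tw = [] := by
      obtain ⟨c, rfl⟩ := htw
      rfl
    subst this
    exact ⟨0, by omega, by omega, by omega, trivial, by simpa using hα, by simpa [track] using hα.ge,
      by simpa [track] using hα.le, h3, h4⟩
  · rw [if_neg (by omega)] at hα h4
    refine ⟨1, by omega, by omega, by omega, h1, hα, by omega, ?_, h3, h4⟩
    push_cast at h2 ⊢
    omega

/-- The factors of $\mathbf c_w$ lift the block to level $s$ and those of $\mathbf t_w$ to level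
$\alpha\le h$. The entries of $\mathbf t_v$ are at most $-h-3$ and no longer touch it. -/
theorem prodM_mul_prodP_mul_colKron {α : ℤ} (hα : α = inversionsAt 0 (tw ++ simpleTuple h))
    (h𝒳 : 𝒳.length = tw.length) (h𝒴 : 𝒴.length = tv.length) (C : Matrix (Fin n) (Fin r) ℂ) :
    prodM m (tv ++ tw) (𝒴 ++ 𝒳) * (prodP m a (altTuple (h - 1)) * colKron m m C) =
      colKron m (m - α) C := by
  obtain ⟨s, h0, h1, hs, h2, h3, h4, h5, h6, h7⟩ := track_tw hh hm htw hα
  have e1 := (prodM_mul_colKron m le_rfl (by omega) (altTuple (h - 1))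
    (fun i hi => by rw [mem_altTuple] at hi; omega) h6 ((altTuple (h - 1)).map (coeffP a))
    (by simp) C).2
  rw [← prodP_eq_prodM, h7, sub_zero] at e1
  have e2 := (prodM_mul_colKron m h0 (by omega) tw
    (fun i hi => by have := htw.mem_bounds hi; omega) h2 𝒳 h𝒳 C).2
  rw [← h3] at e2
  rw [e1, prodM_append m h𝒴, Matrix.mul_assoc, e2]
  exact prodM_mul_colKron_of_far m (by omega) (by omega) tv
    (fun i hi => by have := mem_tv_bounds htv hi; omega) 𝒴 C

omit hh hm htw htv in
theorem prodP_mul_colKron_of_far (t : List ℤ) (hm : 0 < m)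
    (ht : ∀ i ∈ t, -(m : ℤ) ≤ i ∧ i < m ∧ 2 ≤ i.natAbs) (C : Matrix (Fin n) (Fin r) ℂ) :
    prodP m a t * colKron m m C = colKron m m C := by
  have := prodM_mul_colKron_of_far m (s := 0) le_rfl (by omega) t
    (fun i hi => by have := ht i hi; omega) (t.map (coeffP a)) C
  rwa [← prodP_eq_prodM, sub_zero] at this

theorem left_mul_colKron {α : ℤ} (hα : α = inversionsAt 0 (tw ++ simpleTuple h))
    (h𝒳 : 𝒳.length = tw.length) (h𝒴 : 𝒴.length = tv.length) (C : Matrix (Fin n) (Fin r) ℂ) :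
    prodM m (tv ++ tw) (𝒴 ++ 𝒳) * outerFactor m a h * colKron m m C = colKron m (m - α) C := by
  rw [outerFactor, Matrix.mul_assoc, Matrix.mul_assoc, prodP_mul_colKron_of_far a _ (by omega),
    prodM_mul_prodP_mul_colKron hh hm a htw htv hα h𝒳 h𝒴]
  intro i hi
  rw [mem_shift, mem_altTuple] at hi
  omega

omit hh hm htw htv in
theorem rowKron_transpose (k : ℤ) (B : Matrix (Fin r) (Fin n) ℂ) :
    (rowKron m k B)ᵀ = colKron m k Bᵀ := rfl

omit hh hm htw htv in
-- With symmetric assignments the outer factors are transposes of each other, so they act by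
-- congruence, and statements about rows reduce to statements about columns.
theorem prodM_reverse_transpose (h𝒳 : 𝒳.length = tw.length) (h𝒴 : 𝒴.length = tv.length)
    (h𝒳s : ∀ M ∈ 𝒳, M.IsSymm) (h𝒴s : ∀ M ∈ 𝒴, M.IsSymm) :
    (prodM m (tw.reverse ++ tv.reverse) (𝒳.reverse ++ 𝒴.reverse)) =
      (prodM m (tv ++ tw) (𝒴 ++ 𝒳))ᵀ := by
  rw [prodM_transpose m (by simp [h𝒳, h𝒴]), List.reverse_append, List.reverse_append]
  intro M hM
  rcases List.mem_append.1 hM with hM | hM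
  · exact h𝒴s M hM
  · exact h𝒳s M hM

theorem rowKron_mul_right (ha : ∀ j ≤ m, (a j).IsSymm) {α : ℤ}
    (hα : α = inversionsAt 0 (tw ++ simpleTuple h))
    (h𝒳 : 𝒳.length = tw.length) (h𝒴 : 𝒴.length = tv.length)
    (h𝒳s : ∀ M ∈ 𝒳, M.IsSymm) (h𝒴s : ∀ M ∈ 𝒴, M.IsSymm) (B : Matrix (Fin r) (Fin n) ℂ) :
    rowKron m m B * (prodP m a (simpleComplement h ++ shift (-m) (simpleComplement (m - h - 1)))
        * prodM m (tw.reverse ++ tv.reverse) (𝒳.reverse ++ 𝒴.reverse)) =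
      rowKron m (m - α) B := by
  rw [← Matrix.transpose_inj, Matrix.transpose_mul, Matrix.transpose_mul, rowKron_transpose,
    rowKron_transpose, prodM_reverse_transpose h𝒳 h𝒴 h𝒳s h𝒴s, Matrix.transpose_transpose,
    prodP_transpose a ha (fun i hi => by have := mem_complement hh hm hi; omega)
      (pairwise_complement hh hm), prodP_append, simpleComplement_of_even hh, Matrix.mul_assoc,
    Matrix.mul_assoc, prodP_mul_colKron_of_far a _ (by omega),
    prodM_mul_prodP_mul_colKron hh hm a htw htv hα h𝒳 h𝒴]
  intro i hi
  have := mem_shift_simpleComplement hm hi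
  omega

/-- The block form of the pencil `𝕃_𝒮`. -/
theorem pencilS_eq_systemMatrix (ha : ∀ j ≤ m, (a j).IsSymm) {α : ℤ}
    (hα : α = inversionsAt 0 (tw ++ simpleTuple h))
    (h𝒳 : 𝒳.length = tw.length) (h𝒴 : 𝒴.length = tv.length)
    (h𝒳s : ∀ M ∈ 𝒳, M.IsSymm) (h𝒴s : ∀ M ∈ 𝒴, M.IsSymm) (A E : Matrix (Fin r) (Fin r) ℂ)
    (B : Matrix (Fin r) (Fin n) ℂ) (C : Matrix (Fin n) (Fin r) ℂ) :
    pencilS m h a A B C E tw tv 𝒳 𝒴 =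
      systemMatrix (pencilP m h a tw tv 𝒳 𝒴) A (rowKron m (m - α) B) (colKron m (m - α) C) E := by
  rw [pencilS_eq_fromBlocks hh hm, rowKron_mul_right hh hm a htw htv ha hα h𝒳 h𝒴 h𝒳s h𝒴s,
    Matrix.mul_assoc (prodP m a (altTuple (h - 1))), prodP_mul_colKron_of_far a (altTuple h)
    (by omega), prodM_mul_prodP_mul_colKron hh hm a htw htv hα h𝒳 h𝒴]
  intro i hi
  obtain ⟨q, hq⟩ := hh
  rw [mem_altTuple] at hi
  omega

omit htw htv in
theorem pencilP_isSymm (ha : ∀ j ≤ m, (a j).IsSymm)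
    (h𝒳 : 𝒳.length = tw.length) (h𝒴 : 𝒴.length = tv.length)
    (h𝒳s : ∀ M ∈ 𝒳, M.IsSymm) (h𝒴s : ∀ M ∈ 𝒴, M.IsSymm) :
    (pencilP m h a tw tv 𝒳 𝒴).IsSymm := by
  obtain ⟨h1, h2⟩ := isSymm_coefficients hh hm a ha
  rw [pencilP, prodM_reverse_transpose h𝒳 h𝒴 h𝒳s h𝒴s, ← cPoly_transpose]
  generalize prodM m (tv ++ tw) (𝒴 ++ 𝒳) = N
  generalize prodP m a (simpleComplement h ++ shift (-m) (simpleComplement (m - h - 1))) = M at *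
  have e : cPoly N * ((X : ℂ[X]) • cPoly (prodP m a (shift (-m) (simpleTuple (m - h - 1))))
      - cPoly (prodP m a (simpleTuple h))) * cPoly M = cPoly N *
      ((X : ℂ[X]) • cPoly (prodP m a (shift (-m) (simpleTuple (m - h - 1))) * M)
      - cPoly (prodP m a (simpleTuple h) * M)) := by
    rw [Matrix.mul_assoc, Matrix.sub_mul, Matrix.smul_mul, cPoly_mul, cPoly_mul]
  rw [e]
  unfold Matrix.IsSymm
  rw [Matrix.transpose_mul, Matrix.transpose_mul, Matrix.transpose_transpose, Matrix.transpose_sub,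
    Matrix.transpose_smul, cPoly_transpose, cPoly_transpose, h1, h2, Matrix.mul_assoc]

/-- The pencil `L_P` is strictly equivalent to the tridiagonal pencil. -/
theorem exists_strict_equiv (ha : ∀ j ≤ m, (a j).IsSymm) {α : ℤ}
    (hα : α = inversionsAt 0 (tw ++ simpleTuple h))
    (h𝒳 : IsNonsingularAssignment m tw 𝒳) (h𝒴 : IsNonsingularAssignment m tv 𝒴)
    (h𝒳s : ∀ M ∈ 𝒳, M.IsSymm) (h𝒴s : ∀ M ∈ 𝒴, M.IsSymm) (hns : Even m → (a m).det ≠ 0) :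
    ∃ N₁ N₂ : Matrix (Fin m × Fin n) (Fin m × Fin n) ℂ, N₁.det ≠ 0 ∧ N₂.det ≠ 0 ∧
      pencilP m h a tw tv 𝒳 𝒴 = cPoly N₁ * ((X : ℂ[X]) • cPoly (compRingEquiv (Fin m) (Fin n) ℂ
        (ofLvl m (theta m (1 : ℂ) 0 a))) - cPoly (compRingEquiv (Fin m) (Fin n) ℂ
        (ofLvl m (theta m (0 : ℂ) (-1) a)))) * cPoly N₂ ∧
      (∀ (C : Matrix (Fin n) (Fin r) ℂ), N₁ * colKron m m C = colKron m (m - α) C) ∧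
      (∀ (B : Matrix (Fin r) (Fin n) ℂ), rowKron m m B * N₂ = rowKron m (m - α) B) := by
  have hN : (prodM m (tv ++ tw) (𝒴 ++ 𝒳)).det ≠ 0 := by
    rw [prodM_append m h𝒴.1, Matrix.det_mul]
    exact mul_ne_zero (det_prodM_ne_zero m h𝒴) (det_prodM_ne_zero m h𝒳)
  -- Only the left factor absorbs the factor pulled out of the bracket; the right one is the
  -- unchanged product of complement and assignments.
  refine ⟨prodM m (tv ++ tw) (𝒴 ++ 𝒳) * outerFactor m a h, _, ?_, ?_, ?_,
    left_mul_colKron hh hm a htw htv hα h𝒳.1 h𝒴.1,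
    rowKron_mul_right hh hm a htw htv ha hα h𝒳.1 h𝒴.1 h𝒳s h𝒴s⟩
  · rw [Matrix.det_mul, outerFactor, Matrix.det_mul]
    refine mul_ne_zero hN (mul_ne_zero (det_prodP_ne_zero m a _ fun i hi => ?_)
      (det_prodP_ne_zero m a _ fun i hi => ?_))
    · rw [mem_altTuple] at hi
      exact ⟨by omega, fun _ => by omega⟩
    · rw [mem_shift, mem_altTuple] at hi
      exact ⟨by omega, fun _ => by omega⟩
  · rw [Matrix.det_mul, prodM_reverse_transpose h𝒳.1 h𝒴.1 h𝒳s h𝒴s, Matrix.det_transpose]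
    refine mul_ne_zero (det_prodP_ne_zero m a _ fun i hi => ?_) hN
    have := mem_complement hh hm hi
    exact ⟨this.2.2.1, fun h => hns (this.2.2.2 h)⟩
  · rw [pencilP, prodP_shift_simpleTuple m a hh hm, prodP_simpleTuple m a hh hm,
      fiedlerP_mul_prodP_oddTuple m a hh hm, prodP_evenTuple m a hh hm]
    simp only [cPoly_mul, Matrix.mul_assoc, Matrix.mul_sub, Matrix.sub_mul, Matrix.mul_smul,
      Matrix.smul_mul]

end tuples
end pencil

/-! ### Limits at infinity of rational matrices -/

/-- The rational function `f` tends to `c` at infinity. -/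
def HasLim (f : RatFunc ℂ) (c : ℂ) : Prop :=
  Tendsto (fun z => RatFunc.eval (RingHom.id ℂ) z f) (Bornology.cobounded ℂ) (𝓝 c)

/-- Evaluation of rational functions respects sums and products away from the zeros of the
denominators. These are finitely many, hence irrelevant for limits at infinity. -/
theorem eventually_denom_ne_zero (f : RatFunc ℂ) :
    ∀ᶠ z in Bornology.cobounded ℂ, Polynomial.eval₂ (RingHom.id ℂ) z (RatFunc.denom f) ≠ 0 := by
  have hfin : {z : ℂ | (RatFunc.denom f).IsRoot z}.Finite :=
    Polynomial.finite_setOfPred_isRoot (RatFunc.denom_ne_zero f)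
  have := Bornology.isBounded_def.1 hfin.isBounded
  filter_upwards [this] with z hz h
  exact hz (by simpa [Polynomial.IsRoot, Polynomial.eval₂_id] using h)

theorem HasLim.add {f g : RatFunc ℂ} {c d : ℂ} (hf : HasLim f c) (hg : HasLim g d) :
    HasLim (f + g) (c + d) := by
  refine (Tendsto.add hf hg).congr' ?_
  filter_upwards [eventually_denom_ne_zero f, eventually_denom_ne_zero g] with z h1 h2
  exact (RatFunc.eval_add _ _ h1 h2).symm

theorem HasLim.mul {f g : RatFunc ℂ} {c d : ℂ} (hf : HasLim f c) (hg : HasLim g d) :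
    HasLim (f * g) (c * d) := by
  refine (Tendsto.mul hf hg).congr' ?_
  filter_upwards [eventually_denom_ne_zero f, eventually_denom_ne_zero g] with z h1 h2
  exact (RatFunc.eval_mul _ _ h1 h2).symm

theorem hasLim_C (c : ℂ) : HasLim (RatFunc.C c) c := by
  simp [HasLim]

theorem hasLim_zero : HasLim 0 0 := by
  simpa using hasLim_C 0

theorem hasLim_one : HasLim 1 1 := by
  simpa using hasLim_C 1

theorem HasLim.neg {f : RatFunc ℂ} {c : ℂ} (hf : HasLim f c) : HasLim (-f) (-c) := by
  simpa using (hasLim_C (-1)).mul hf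

theorem eventually_eval_inv (f : RatFunc ℂ) (hf : f ≠ 0) : ∀ᶠ z in Bornology.cobounded ℂ,
    RatFunc.eval (RingHom.id ℂ) z f⁻¹ = (RatFunc.eval (RingHom.id ℂ) z f)⁻¹ := by
  filter_upwards [eventually_denom_ne_zero f, eventually_denom_ne_zero f⁻¹] with z h1 h2
  have := RatFunc.eval_mul (f := RingHom.id ℂ) (a := z) h2 h1
  rw [inv_mul_cancel₀ hf, RatFunc.eval_one] at this
  exact eq_inv_of_mul_eq_one_left this.symm

theorem HasLim.ne_zero {f : RatFunc ℂ} {c : ℂ} (hf : HasLim f c) (hc : c ≠ 0) : f ≠ 0 := by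
  rintro rfl
  exact hc (tendsto_nhds_unique hf hasLim_zero)

theorem HasLim.inv {f : RatFunc ℂ} {c : ℂ} (hf : HasLim f c) (hc : c ≠ 0) : HasLim f⁻¹ c⁻¹ := by
  refine (Tendsto.inv₀ hf hc).congr' ?_
  filter_upwards [eventually_eval_inv f (hf.ne_zero hc)] with z hz using hz.symm

theorem hasLim_X_inv : HasLim (RatFunc.X : RatFunc ℂ)⁻¹ 0 := by
  refine (tendsto_inv₀_cobounded (α := ℂ)).congr' ?_
  filter_upwards [eventually_eval_inv (RatFunc.X : RatFunc ℂ) RatFunc.X_ne_zero] with z hz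
  rw [hz, RatFunc.eval_X]

theorem HasLim.sum {ι : Type*} (s : Finset ι) {f : ι → RatFunc ℂ} {c : ι → ℂ}
    (h : ∀ i ∈ s, HasLim (f i) (c i)) : HasLim (∑ i ∈ s, f i) (∑ i ∈ s, c i) := by
  classical
  induction s using Finset.induction_on with
  | empty => simpa using hasLim_zero
  | insert i s hi ih =>
    rw [Finset.sum_insert hi, Finset.sum_insert hi]
    exact (h i (by simp)).add (ih fun j hj => h j (by simp [hj]))

theorem HasLim.prod {ι : Type*} (s : Finset ι) {f : ι → RatFunc ℂ} {c : ι → ℂ}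
    (h : ∀ i ∈ s, HasLim (f i) (c i)) : HasLim (∏ i ∈ s, f i) (∏ i ∈ s, c i) := by
  classical
  induction s using Finset.induction_on with
  | empty => simpa using hasLim_one
  | insert i s hi ih =>
    rw [Finset.prod_insert hi, Finset.prod_insert hi]
    exact (h i (by simp)).mul (ih fun j hj => h j (by simp [hj]))

theorem HasLim.pow {f : RatFunc ℂ} {c : ℂ} (hf : HasLim f c) (k : ℕ) : HasLim (f ^ k) (c ^ k) := by
  simpa using HasLim.prod (Finset.range k) fun _ _ => hf

/-- The rational matrix `F` tends to `D` at infinity. -/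
def MatLim {ι κ : Type*} (F : Matrix ι κ (RatFunc ℂ)) (D : Matrix ι κ ℂ) : Prop :=
  ∀ i j, HasLim (F i j) (D i j)

section MatLim
variable {ι κ ν : Type*}

theorem MatLim.add {F G : Matrix ι κ (RatFunc ℂ)} {D K : Matrix ι κ ℂ} (hF : MatLim F D)
    (hG : MatLim G K) : MatLim (F + G) (D + K) := fun i j => (hF i j).add (hG i j)

theorem MatLim.neg {F : Matrix ι κ (RatFunc ℂ)} {D : Matrix ι κ ℂ} (hF : MatLim F D) :
    MatLim (-F) (-D) := fun i j => (hF i j).neg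

theorem MatLim.smul {F : Matrix ι κ (RatFunc ℂ)} {D : Matrix ι κ ℂ} {f : RatFunc ℂ} {c : ℂ}
    (hf : HasLim f c) (hF : MatLim F D) : MatLim (f • F) (c • D) := fun i j => hf.mul (hF i j)

theorem MatLim.mul [Fintype κ] {F : Matrix ι κ (RatFunc ℂ)} {D : Matrix ι κ ℂ}
    {G : Matrix κ ν (RatFunc ℂ)} {K : Matrix κ ν ℂ} (hF : MatLim F D) (hG : MatLim G K) :
    MatLim (F * G) (D * K) := fun i j => HasLim.sum _ fun k _ => (hF i k).mul (hG k j)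

theorem matLim_cRat {ι κ : Type} (D : Matrix ι κ ℂ) : MatLim (cRat D) D := fun _ _ => hasLim_C _

theorem matLim_zero : MatLim (0 : Matrix ι κ (RatFunc ℂ)) 0 := fun _ _ => hasLim_zero

theorem matLim_one [DecidableEq ι] : MatLim (1 : Matrix ι ι (RatFunc ℂ)) 1 := fun i j => by
  rw [Matrix.one_apply, Matrix.one_apply]
  split_ifs
  · exact hasLim_one
  · exact hasLim_zero

variable [Fintype ι] [DecidableEq ι]

theorem MatLim.det {F : Matrix ι ι (RatFunc ℂ)} {D : Matrix ι ι ℂ} (hF : MatLim F D) :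
    HasLim F.det D.det := by
  rw [Matrix.det_apply', Matrix.det_apply']
  refine HasLim.sum _ fun σ _ => HasLim.mul ?_ (HasLim.prod _ fun i _ => hF _ _)
  simpa using hasLim_C ((Equiv.Perm.sign σ : ℤ) : ℂ)

/-- By Cramer's rule the inverse is a scalar inverse times determinants of entries, so entrywise
limits suffice. -/
theorem MatLim.inv {F : Matrix ι ι (RatFunc ℂ)} {D : Matrix ι ι ℂ} (hF : MatLim F D)
    (hD : D.det ≠ 0) : MatLim F⁻¹ D⁻¹ := by
  rw [Matrix.inv_def, Matrix.inv_def, Ring.inverse_eq_inv', Ring.inverse_eq_inv']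
  refine MatLim.smul (hF.det.inv hD) fun i j => ?_
  rw [Matrix.adjugate_apply, Matrix.adjugate_apply]
  refine MatLim.det fun k l => ?_
  rw [Matrix.updateRow_apply, Matrix.updateRow_apply, Pi.single_apply, Pi.single_apply]
  split_ifs
  · exact hasLim_one
  · exact hasLim_zero
  · exact hF k l

theorem MatLim.isUnit_det {F : Matrix ι ι (RatFunc ℂ)} {D : Matrix ι ι ℂ} (hF : MatLim F D)
    (hD : D.det ≠ 0) : IsUnit F.det :=
  isUnit_iff_ne_zero.2 (hF.det.ne_zero hD)

theorem MatLim.isBiproper {ι : Type} [Fintype ι] [DecidableEq ι] {F : Matrix ι ι (RatFunc ℂ)}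
    {D : Matrix ι ι ℂ} (hF : MatLim F D) (hD : D.det ≠ 0) : IsBiproper F :=
  ⟨D, hD, tendsto_pi_nhds.2 fun i => tendsto_pi_nhds.2 fun j => hF i j⟩

end MatLim

/-! ### Rational matrices -/

section rational
variable {ι κ : Type}

theorem cRat_mul {ν : Type} [Fintype κ] (M : Matrix ι κ ℂ) (N : Matrix κ ν ℂ) :
    cRat (M * N) = cRat M * cRat N :=
  Matrix.map_mul

theorem cRat_one [DecidableEq ι] : cRat (1 : Matrix ι ι ℂ) = 1 :=
  Matrix.map_one _ (by simp) (by simp)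

theorem polyToRat_mul {ν : Type} [Fintype κ] (M : Matrix ι κ ℂ[X]) (N : Matrix κ ν ℂ[X]) :
    polyToRat (M * N) = polyToRat M * polyToRat N :=
  Matrix.map_mul

theorem polyToRat_add (M N : Matrix ι κ ℂ[X]) :
    polyToRat (M + N) = polyToRat M + polyToRat N := by
  ext1 i j; simp [polyToRat]

theorem polyToRat_sub (M N : Matrix ι κ ℂ[X]) :
    polyToRat (M - N) = polyToRat M - polyToRat N := by
  ext1 i j; simp [polyToRat]

theorem polyToRat_cPoly (M : Matrix ι κ ℂ) : polyToRat (cPoly M) = cRat M := by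
  ext1 i j; simp [polyToRat, cPoly, cRat, RatFunc.algebraMap_C]

theorem polyToRat_X_pow_smul (k : ℕ) (M : Matrix ι κ ℂ[X]) :
    polyToRat ((X : ℂ[X]) ^ k • M) = (RatFunc.X : RatFunc ℂ) ^ k • polyToRat M := by
  ext1 i j; simp [polyToRat, RatFunc.algebraMap_X]

theorem polyToRat_X_smul (M : Matrix ι κ ℂ[X]) :
    polyToRat ((X : ℂ[X]) • M) = (RatFunc.X : RatFunc ℂ) • polyToRat M := by
  ext1 i j; simp [polyToRat, RatFunc.algebraMap_X]

theorem polyToRat_injective : Function.Injective (polyToRat (ι := ι) (κ := κ)) :=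
  Matrix.map_injective (RatFunc.algebraMap_injective ℂ)

theorem polyToRat_sum {σ : Type*} (s : Finset σ) (F : σ → Matrix ι κ ℂ[X]) :
    polyToRat (∑ k ∈ s, F k) = ∑ k ∈ s, polyToRat (F k) := by
  ext1 i j
  simp [polyToRat, Matrix.sum_apply, map_sum]

variable {r : ℕ}

/-- The strictly proper part `C (λ E - A)⁻¹ B`. -/
noncomputable def properPart (A : Matrix (Fin r) (Fin r) ℂ) (B : Matrix (Fin r) κ ℂ)
    (C : Matrix ι (Fin r) ℂ) (E : Matrix (Fin r) (Fin r) ℂ) : Matrix ι κ (RatFunc ℂ) :=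
  cRat C * ((RatFunc.X : RatFunc ℂ) • cRat E - cRat A)⁻¹ * cRat B

theorem transferFunction_eq (P : Matrix ι ι ℂ[X]) (A : Matrix (Fin r) (Fin r) ℂ)
    (B : Matrix (Fin r) ι ℂ) (C : Matrix ι (Fin r) ℂ) (E : Matrix (Fin r) (Fin r) ℂ) :
    transferFunction P A B C E = polyToRat P + properPart A B C E := rfl

/-- Factor out $\lambda$: the inverse equals $\lambda^{-1}(E-\lambda^{-1}A)^{-1}$, and the second
factor tends to $E^{-1}$. -/
theorem matLim_resolvent (A : Matrix (Fin r) (Fin r) ℂ) {E : Matrix (Fin r) (Fin r) ℂ}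
    (hE : E.det ≠ 0) : MatLim ((RatFunc.X : RatFunc ℂ) • cRat E - cRat A)⁻¹ 0 := by
  have hX : (RatFunc.X : RatFunc ℂ) ≠ 0 := RatFunc.X_ne_zero
  have h1 : MatLim (cRat E + -((RatFunc.X : RatFunc ℂ)⁻¹ • cRat A)) E := by
    simpa using (matLim_cRat E).add (MatLim.smul hasLim_X_inv (matLim_cRat A)).neg
  have h2 : (RatFunc.X : RatFunc ℂ) • cRat E - cRat A =
      (RatFunc.X : RatFunc ℂ) • (cRat E + -((RatFunc.X : RatFunc ℂ)⁻¹ • cRat A)) := by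
    rw [smul_add, smul_neg, smul_smul, mul_inv_cancel₀ hX, one_smul, sub_eq_add_neg]
  have h3 : ((RatFunc.X : RatFunc ℂ) • cRat E - cRat A)⁻¹ = (RatFunc.X : RatFunc ℂ)⁻¹ •
      (cRat E + -((RatFunc.X : RatFunc ℂ)⁻¹ • cRat A))⁻¹ := by
    refine Matrix.inv_eq_right_inv ?_
    rw [h2, Matrix.smul_mul, Matrix.mul_smul, smul_smul, mul_inv_cancel₀ hX, one_smul,
      Matrix.mul_nonsing_inv _ (h1.isUnit_det hE)]
  rw [h3]
  simpa using MatLim.smul hasLim_X_inv (h1.inv hE)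

theorem matLim_properPart (A : Matrix (Fin r) (Fin r) ℂ) (B : Matrix (Fin r) κ ℂ)
    (C : Matrix ι (Fin r) ℂ) {E : Matrix (Fin r) (Fin r) ℂ} (hE : E.det ≠ 0) :
    MatLim (properPart A B C E) 0 := by
  unfold properPart
  simpa using ((matLim_cRat C).mul (matLim_resolvent A hE)).mul (matLim_cRat B)

theorem properPart_isSymm {A E : Matrix (Fin r) (Fin r) ℂ} (hA : A.IsSymm) (hE : E.IsSymm)
    (B : Matrix (Fin r) ι ℂ) : (properPart A B Bᵀ E).IsSymm := by
  have h1 : (cRat A)ᵀ = cRat A := by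
    change cRat Aᵀ = cRat A
    rw [hA]
  have h2 : (cRat E)ᵀ = cRat E := by
    change cRat Eᵀ = cRat E
    rw [hE]
  unfold properPart Matrix.IsSymm
  rw [Matrix.transpose_mul, Matrix.transpose_mul, Matrix.transpose_nonsing_inv,
    Matrix.transpose_sub, Matrix.transpose_smul, h1, h2, Matrix.mul_assoc]
  rfl

end rational

/-! ### Properties of the linearization -/

section linearization
variable {m n r : ℕ} (a : ℕ → Matrix (Fin n) (Fin n) ℂ)

theorem coeff_matPoly {j : ℕ} (hj : j ≤ m) (c d : Fin n) :
    (matPoly m a c d).coeff j = a j c d := by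
  simp only [matPoly, Matrix.sum_apply, Polynomial.finsetSum_coeff, Matrix.smul_apply, cPoly,
    Matrix.map_apply, smul_eq_mul, Polynomial.coeff_X_pow_mul', Polynomial.coeff_C]
  rw [Finset.sum_eq_single j]
  · simp
  · intro i _ hi
    split_ifs with h1 h2
    · omega
    · rfl
    · rfl
  · intro h
    exact absurd (Finset.mem_range.2 (by omega)) h

/-- The strictly proper part is symmetric because $A$ and $E$ are, so it cancels from $G=G^T$ and
leaves $P=P^T$. -/
theorem coefficients_isSymm {A E : Matrix (Fin r) (Fin r) ℂ} (hA : A.IsSymm) (hE : E.IsSymm)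
    (B : Matrix (Fin r) (Fin n) ℂ) (h : (transferFunction (matPoly m a) A B Bᵀ E).IsSymm) :
    ∀ j ≤ m, (a j).IsSymm := by
  have h1 : (matPoly m a)ᵀ = matPoly m a := by
    apply polyToRat_injective
    have h2 := h
    unfold Matrix.IsSymm at h2
    rw [transferFunction_eq, Matrix.transpose_add, properPart_isSymm hA hE B] at h2
    exact add_right_cancel h2
  intro j hj
  ext c d
  rw [Matrix.transpose_apply, ← coeff_matPoly a hj, ← coeff_matPoly a hj, ← h1,
    Matrix.transpose_apply, h1]

theorem systemMatrix_isSymm {ι : Type} {P : Matrix ι ι ℂ[X]} (hP : P.IsSymm)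
    {A E : Matrix (Fin r) (Fin r) ℂ} (hA : A.IsSymm) (hE : E.IsSymm) (B : Matrix (Fin r) ι ℂ) :
    (systemMatrix P A B Bᵀ E).IsSymm := by
  unfold systemMatrix Matrix.IsSymm
  rw [fromBlocks_transpose, hP, Matrix.transpose_sub, Matrix.transpose_smul, cPoly_transpose,
    cPoly_transpose, cPoly_transpose, cPoly_transpose, hA, hE, Matrix.transpose_transpose]

/-- The diagonal block of the large transfer function at the place of $B$ and $C$ differs from $G$
by a matrix polynomial. Restricting any realization to this block therefore realizes $G$ with the
same state size. -/
theorem isMinimalRealization_of_block {L : Matrix (Fin m × Fin n) (Fin m × Fin n) ℂ[X]}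
    {G : Matrix (Fin n) (Fin n) (RatFunc ℂ)} {P : Matrix (Fin n) (Fin n) ℂ[X]}
    {A E : Matrix (Fin r) (Fin r) ℂ} {B : Matrix (Fin r) (Fin n) ℂ} {C : Matrix (Fin n) (Fin r) ℂ}
    (h : IsMinimalRealization G P A B C E) {s : ℤ} (h0 : 0 ≤ s) (hs : s < m) :
    IsMinimalRealization
      (transferFunction L A (rowKron m (m - s) B) (colKron m (m - s) C) E) L A
      (rowKron m (m - s) B) (colKron m (m - s) C) E := by
  refine ⟨⟨h.1.1, rfl⟩, fun r' P' A' B' C' E' h' => ?_⟩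
  set p : Fin m := ofLevel s.toNat (by omega) with hp
  let e : Fin n → Fin m × Fin n := fun c => (p, c)
  have hpv : ((p : ℕ) : ℤ) + 1 = m - s := by
    simp only [hp, ofLevel]
    omega
  refine h.2 r' (P'.submatrix e e - L.submatrix e e + P) A' (B'.submatrix id e) (C'.submatrix e id)
    E' ⟨h'.1, ?_⟩
  have hB : (rowKron m (m - s) B).submatrix id e = B := by
    ext i c
    simp [rowKron, e, hpv]
  have hC : (colKron m (m - s) C).submatrix e id = C := by
    ext c i
    simp [colKron, e, hpv]
  have h2 := congrArg (fun M => M.submatrix e e) h'.2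
  have h3 : (transferFunction L A (rowKron m (m - s) B) (colKron m (m - s) C) E).submatrix e e =
      polyToRat (L.submatrix e e) + properPart A ((rowKron m (m - s) B).submatrix id e)
        ((colKron m (m - s) C).submatrix e id) E := rfl
  have h4 : (transferFunction P' A' B' C' E').submatrix e e =
      polyToRat (P'.submatrix e e) + properPart A' (B'.submatrix id e)
        (C'.submatrix e id) E' := rfl
  rw [h3, h4, hB, hC] at h2
  rw [h.1.2, transferFunction_eq, transferFunction_eq, polyToRat_add, polyToRat_sub,
    eq_sub_of_add_eq' h2]
  abel

end linearization

/-! ### Unimodular equivalence of the full system pencil. -/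

section linearization
variable {m n r : ℕ} (a : ℕ → Matrix (Fin n) (Fin n) ℂ)

theorem compRingEquiv_apply_apply {R : Type*} [CommRing R]
    (Y : Matrix (Fin m) (Fin m) (Matrix (Fin n) (Fin n) R)) (p q : Fin m × Fin n) :
    compRingEquiv (Fin m) (Fin n) R Y p q = Y p.1 q.1 p.2 q.2 := rfl

theorem theta_cPoly : (X : ℂ[X]) • cPoly (compRingEquiv (Fin m) (Fin n) ℂ
      (ofLvl m (theta m (1 : ℂ) 0 a))) - cPoly (compRingEquiv (Fin m) (Fin n) ℂ
      (ofLvl m (theta m (0 : ℂ) (-1) a))) =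
    compRingEquiv (Fin m) (Fin n) ℂ[X] (ofLvl m (theta m X 1 fun j => cPoly (a j))) := by
  ext1 ⟨p, c⟩ ⟨q, d⟩
  simp only [Matrix.sub_apply, Matrix.smul_apply, cPoly, Matrix.map_apply,
    compRingEquiv_apply_apply, ofLvl, Matrix.of_apply, theta]
  split_ifs <;> simp [Matrix.one_apply] <;> split_ifs <;> simp

theorem hornerUp_cPoly : hornerUp m (X : ℂ[X]) (fun j => cPoly (a j)) 0 = matPoly m a := by
  simp only [hornerUp, matPoly, zero_add, Nat.sub_zero]

theorem cPoly_colKron {p₀ : Fin m} (hp₀ : lvl p₀ = 0) (C : Matrix (Fin n) (Fin r) ℂ) :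
    cPoly (colKron m m C) = blockCol p₀ (cPoly C) := by
  have := colKron_eq_blockCol p₀ C
  rw [hp₀, Nat.cast_zero, sub_zero] at this
  rw [this]
  ext1 p j
  simp only [cPoly, blockCol, Matrix.map_apply, Matrix.of_apply]
  split_ifs <;> simp

theorem cPoly_rowKron {p₀ : Fin m} (hp₀ : lvl p₀ = 0) (B : Matrix (Fin r) (Fin n) ℂ) :
    cPoly (rowKron m m B) = blockRow p₀ (cPoly B) := by
  have := cPoly_colKron hp₀ Bᵀ
  rw [← rowKron_transpose, ← cPoly_transpose, ← Matrix.transpose_inj] at this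
  rw [Matrix.transpose_transpose] at this
  rw [this]
  rfl

theorem cPoly_inv_mul {ι : Type} [Fintype ι] [DecidableEq ι] {N : Matrix ι ι ℂ} (hN : N.det ≠ 0) :
    cPoly N⁻¹ * cPoly N = 1 ∧ cPoly N * cPoly N⁻¹ = 1 := by
  have h := isUnit_iff_ne_zero.2 hN
  rw [← cPoly_mul, ← cPoly_mul, Matrix.nonsing_inv_mul _ h, Matrix.mul_nonsing_inv _ h, cPoly_one]
  exact ⟨rfl, rfl⟩

theorem isUnimodular_of_isUnit {ι : Type} [Fintype ι] [DecidableEq ι] {U : Matrix ι ι ℂ[X]}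
    (h : IsUnit U.det) : IsUnimodular U := by
  obtain ⟨c, hc, h⟩ := Polynomial.isUnit_iff.1 h
  exact ⟨c, hc.ne_zero, h.symm⟩

theorem isUnit_det_of_mul_eq_one {ι R : Type*} [CommRing R] [Fintype ι] [DecidableEq ι]
    {U V : Matrix ι ι R} (h : U * V = 1) : IsUnit U.det ∧ IsUnit V.det := by
  have := congrArg Matrix.det h
  rw [Matrix.det_mul, Matrix.det_one] at this
  exact ⟨IsUnit.of_mul_eq_one _ this, IsUnit.of_mul_eq_one_right _ this⟩

/-- The finite part of the linearization property. -/
theorem exists_unimodular {L : Matrix (Fin m × Fin n) (Fin m × Fin n) ℂ[X]}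
    {N₁ N₂ : Matrix (Fin m × Fin n) (Fin m × Fin n) ℂ} (h₁ : N₁.det ≠ 0) (h₂ : N₂.det ≠ 0)
    (hL : L = cPoly N₁ * compRingEquiv (Fin m) (Fin n) ℂ[X]
      (ofLvl m (theta m X 1 fun j => cPoly (a j))) * cPoly N₂) (hm : 0 < m)
    (A E : Matrix (Fin r) (Fin r) ℂ) (B : Matrix (Fin r) (Fin n) ℂ) (C : Matrix (Fin n) (Fin r) ℂ) :
    ∃ U V : Matrix (Fin m × Fin n) (Fin m × Fin n) ℂ[X], IsUnimodular U ∧ IsUnimodular V ∧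
      fromBlocks U 0 0 1 * systemMatrix L A (rowKron m m B * N₂) (N₁ * colKron m m C) E *
        fromBlocks V 0 0 1 =
        systemMatrix (diagLast m (matPoly m a)) A (rowKron m m B) (colKron m m C) E := by
  set p₀ : Fin m := ofLevel 0 hm
  have hp₀ : lvl p₀ = 0 := lvl_ofLevel hm
  obtain ⟨U, V, hU, hV, hUV, hUc, hVr⟩ :=
    exists_equiv_diagLast (X : ℂ[X]) (fun j => cPoly (a j)) p₀ hp₀
  obtain ⟨e1, e1'⟩ := cPoly_inv_mul h₁
  obtain ⟨e2, e2'⟩ := cPoly_inv_mul h₂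
  refine ⟨U * cPoly N₁⁻¹, cPoly N₂⁻¹ * V, isUnimodular_of_isUnit ?_, isUnimodular_of_isUnit ?_, ?_⟩
  · rw [Matrix.det_mul]
    exact hU.mul (isUnit_det_of_mul_eq_one e1).1
  · rw [Matrix.det_mul]
    exact (isUnit_det_of_mul_eq_one e2).1.mul hV
  · rw [hornerUp_cPoly] at hUV
    have f1 : U * cPoly N₁⁻¹ * L * (cPoly N₂⁻¹ * V) = diagLast m (matPoly m a) := by
      rw [← hUV, hL]
      calc _ = U * (cPoly N₁⁻¹ * cPoly N₁) * compRingEquiv (Fin m) (Fin n) ℂ[X]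
            (ofLvl m (theta m X 1 fun j => cPoly (a j))) * (cPoly N₂ * cPoly N₂⁻¹) * V := by
              simp only [Matrix.mul_assoc]
        _ = _ := by rw [e1, e2', Matrix.mul_one, Matrix.mul_one]
    have f2 : U * cPoly N₁⁻¹ * cPoly (N₁ * colKron m m C) = cPoly (colKron m m C) := by
      rw [cPoly_mul, Matrix.mul_assoc, ← Matrix.mul_assoc (cPoly N₁⁻¹), e1, Matrix.one_mul,
        cPoly_colKron hp₀, hUc]
    have f3 : cPoly (rowKron m m B * N₂) * (cPoly N₂⁻¹ * V) = cPoly (rowKron m m B) := by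
      rw [cPoly_mul, Matrix.mul_assoc, ← Matrix.mul_assoc (cPoly N₂), e2', Matrix.one_mul,
        cPoly_rowKron hp₀, hVr]
    unfold systemMatrix
    rw [fromBlocks_multiply, fromBlocks_multiply]
    simp only [Matrix.mul_zero, Matrix.zero_mul, add_zero, zero_add, Matrix.one_mul,
      Matrix.mul_one]
    rw [f1, f2, f3]

/-! ### The structure at infinity -/

/-- The coefficients of `G(λ)` regarded as a polynomial with the constant coefficient
`A₀ + C (λ E - A)⁻¹ B`. -/
noncomputable def ratCoeff (Z : Matrix (Fin n) (Fin n) (RatFunc ℂ)) (j : ℕ) :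
    Matrix (Fin n) (Fin n) (RatFunc ℂ) :=
  if j = 0 then cRat (a 0) + Z else cRat (a j)

/-- The coefficient $A_0$ occurs only in the block at level $(0,0)$, divided by $\lambda$. The
strictly proper part, when located in that block, can thus be added to it. -/
theorem theta_ratCoeff_apply (Z : Matrix (Fin n) (Fin n) (RatFunc ℂ)) (k l : ℕ) (c d : Fin n) :
    (RatFunc.X : RatFunc ℂ)⁻¹ * (RatFunc.X * RatFunc.C (theta m (1 : ℂ) 0 a k l c d) -
      RatFunc.C (theta m (0 : ℂ) (-1) a k l c d) + if k = 0 ∧ l = 0 then Z c d else 0) =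
    theta m 1 (RatFunc.X : RatFunc ℂ)⁻¹ (ratCoeff a Z) k l c d := by
  have hX : (RatFunc.X : RatFunc ℂ) ≠ 0 := RatFunc.X_ne_zero
  by_cases h1 : k = l
  · subst h1
    by_cases h2 : k = 0
    · subst h2
      simp [theta, ratCoeff, cRat]
      field_simp
      ring
    · by_cases h3 : k % 2 = 0
      · simp [theta, ratCoeff, cRat, h2, h3]
        field_simp
      · by_cases h4 : k + 1 = m <;> simp [theta, h2, h3, h4, Matrix.one_apply]
        split_ifs <;> simp
  · have h2 : ¬ (k = 0 ∧ l = 0) := by omega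
    unfold theta
    rw [if_neg h2]
    split_ifs <;> simp [Matrix.one_apply, ratCoeff, cRat, hX] <;> split_ifs <;> simp

theorem theta_cRat {p₀ : Fin m} (hp₀ : lvl p₀ = 0) (Z : Matrix (Fin n) (Fin n) (RatFunc ℂ)) :
    (RatFunc.X : RatFunc ℂ)⁻¹ • ((RatFunc.X : RatFunc ℂ) • cRat (compRingEquiv (Fin m) (Fin n) ℂ
      (ofLvl m (theta m (1 : ℂ) 0 a))) - cRat (compRingEquiv (Fin m) (Fin n) ℂ
      (ofLvl m (theta m (0 : ℂ) (-1) a))) +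
      Matrix.of fun p q => if p.1 = p₀ ∧ q.1 = p₀ then Z p.2 q.2 else 0) =
    compRingEquiv (Fin m) (Fin n) (RatFunc ℂ)
      (ofLvl m (theta m 1 (RatFunc.X : RatFunc ℂ)⁻¹ (ratCoeff a Z))) := by
  ext1 ⟨p, c⟩ ⟨q, d⟩
  have h := theta_ratCoeff_apply (m := m) a Z (lvl p) (lvl q) c d
  rw [← hp₀] at h
  simp only [lvl_inj] at h
  exact h

theorem hornerDown_ratCoeff (A E : Matrix (Fin r) (Fin r) ℂ) (B : Matrix (Fin r) (Fin n) ℂ)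
    (C : Matrix (Fin n) (Fin r) ℂ) :
    hornerDown (RatFunc.X : RatFunc ℂ)⁻¹ (ratCoeff a (properPart A B C E)) m =
      (RatFunc.X : RatFunc ℂ)⁻¹ ^ m • transferFunction (matPoly m a) A B C E := by
  have hX : (RatFunc.X : RatFunc ℂ) ≠ 0 := RatFunc.X_ne_zero
  have h1 : hornerDown (RatFunc.X : RatFunc ℂ)⁻¹ (ratCoeff a (properPart A B C E)) m =
      ∑ i ∈ Finset.range (m + 1), ((RatFunc.X : RatFunc ℂ)⁻¹ ^ m •
        ((RatFunc.X : RatFunc ℂ) ^ i • cRat (a i)) +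
        if i = 0 then (RatFunc.X : RatFunc ℂ)⁻¹ ^ m • properPart A B C E else 0) := by
    refine Finset.sum_congr rfl fun i hi => ?_
    have hi' : i ≤ m := by
      have := Finset.mem_range.1 hi
      omega
    have hpow : (RatFunc.X : RatFunc ℂ)⁻¹ ^ m * (RatFunc.X : RatFunc ℂ) ^ i =
        (RatFunc.X : RatFunc ℂ)⁻¹ ^ (m - i) := by
      have e : m = (m - i) + i := by omega
      conv_lhs => rw [e]
      rw [pow_add, mul_assoc, ← mul_pow, inv_mul_cancel₀ hX, one_pow, mul_one]
    rw [smul_smul, hpow]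
    unfold ratCoeff
    split_ifs with h
    · subst h
      rw [smul_add, Nat.sub_zero]
    · rw [add_zero]
  rw [h1, Finset.sum_add_distrib, ← Finset.smul_sum, Finset.sum_ite_eq']
  rw [if_pos (Finset.mem_range.2 (by omega)), transferFunction_eq, smul_add, matPoly,
    polyToRat_sum]
  simp only [polyToRat_X_pow_smul, polyToRat_cPoly]

theorem matLim_ratCoeff {Z : Matrix (Fin n) (Fin n) (RatFunc ℂ)} (hZ : MatLim Z 0) (j : ℕ) :
    MatLim (ratCoeff a Z j) (a j) := by
  unfold ratCoeff
  split_ifs with h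
  · subst h
    simpa using (matLim_cRat (a 0)).add hZ
  · exact matLim_cRat _

variable {a' : ℕ → Matrix (Fin n) (Fin n) (RatFunc ℂ)} {t : RatFunc ℂ}

theorem matLim_theta (ha : ∀ j, MatLim (a' j) (a j)) (ht : HasLim t 0) (k l : ℕ) :
    MatLim (theta m 1 t a' k l) (theta m 1 0 a k l) := by
  unfold theta
  have hn : HasLim (-t) (-0) := ht.neg
  split_ifs
  · exact (MatLim.smul hasLim_one (ha _)).add (MatLim.smul ht (ha _))
  · exact MatLim.smul hn matLim_one
  · exact matLim_zero
  · exact MatLim.smul hn matLim_one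
  · exact MatLim.smul hasLim_one (ha _)
  · exact MatLim.smul hasLim_one matLim_one
  · exact MatLim.smul hn matLim_one
  · exact MatLim.smul hasLim_one matLim_one
  · exact matLim_zero

theorem matLim_compRingEquiv {Y : Matrix (Fin m) (Fin m) (Matrix (Fin n) (Fin n) (RatFunc ℂ))}
    {D : Matrix (Fin m) (Fin m) (Matrix (Fin n) (Fin n) ℂ)} (h : ∀ p q, MatLim (Y p q) (D p q)) :
    MatLim (compRingEquiv (Fin m) (Fin n) (RatFunc ℂ) Y) (compRingEquiv (Fin m) (Fin n) ℂ D) :=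
  fun p q => h p.1 q.1 p.2 q.2

theorem matLim_hornerDown (ha : ∀ j, MatLim (a' j) (a j)) (ht : HasLim t 0) (k : ℕ) :
    MatLim (hornerDown t a' k) (a k) := by
  induction k with
  | zero => simpa [hornerDown] using ha 0
  | succ k ih =>
    rw [hornerDown_succ]
    simpa using (ha (k + 1)).add (MatLim.smul ht ih)

theorem matLim_diagLast {K : Matrix (Fin n) (Fin n) (RatFunc ℂ)} {D : Matrix (Fin n) (Fin n) ℂ}
    (h : MatLim K D) : MatLim (diagLast m K) (diagLast m D) := by
  rintro ⟨p, c⟩ ⟨q, d⟩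
  simp only [diagLast, Matrix.of_apply]
  split_ifs
  · exact h c d
  · exact matLim_one c d
  · exact hasLim_zero

theorem diagLast_eq_elemM (D : Matrix (Fin n) (Fin n) ℂ) : diagLast m D = elemM m 0 D := by
  ext ⟨p, c⟩ ⟨q, d⟩
  simp only [diagLast, elemM, elemBlock, Matrix.of_apply, if_true]
  split_ifs <;> rfl

theorem matLim_colDown (ha : ∀ j, MatLim (a' j) (a j)) (ht : HasLim t 0) {q k : ℕ}
    (hk : k < 2 * q + 1) : MatLim (colDown t a' q k) (if k = 2 * q then 1 else 0) := by
  unfold colDown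
  by_cases h1 : k % 2 = 0
  · rw [if_pos h1]
    have := MatLim.smul (ht.pow (q - k / 2)) (matLim_one (ι := Fin n))
    by_cases h2 : k = 2 * q
    · rw [if_pos h2]
      simpa [show q - k / 2 = 0 by omega] using this
    · rw [if_neg h2]
      simpa [show q - k / 2 ≠ 0 by omega] using this
  · rw [if_neg h1, if_neg (by omega)]
    have := MatLim.smul (ht.pow (q - k / 2)).neg (matLim_hornerDown a ha ht k)
    simpa [show q - k / 2 ≠ 0 by omega] using this

/-- The array at $(1,0)$ is $M^P_{-m}\mathcal O$, a product of elementary matrices; only the first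
needs $A_m$ nonsingular. -/
theorem det_theta_ne_zero (hm : 0 < m) (ham : (a m).det ≠ 0) :
    (compRingEquiv (Fin m) (Fin n) ℂ (ofLvl m (theta m (1 : ℂ) 0 a))).det ≠ 0 := by
  rw [← fiedlerP_mul_prodP_oddTuple m a (h := 0) (by simp) hm, ← prodP_singleton, ← prodP_append]
  refine det_prodP_ne_zero m a _ fun i hi => ?_
  rw [List.mem_append, List.mem_singleton, mem_oddTuple m (by simp) hm] at hi
  exact ⟨by omega, fun _ => ham⟩

/-- For odd $m$ the array at $(1,0)$ has $A_m$ alone in its top column. Replacing that column by a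
unit column removes the factor $M^P_{-m}$ and leaves $\mathcal O$, which is always nonsingular. -/
theorem det_updateCol_theta_ne_zero (hm : Odd m) {p₁ : Fin m} (hp₁ : lvl p₁ + 1 = m) :
    (compRingEquiv (Fin m) (Fin n) ℂ
      (updateCol (ofLvl m (theta m (1 : ℂ) 0 a)) p₁ (Pi.single p₁ 1))).det ≠ 0 := by
  have e : compRingEquiv (Fin m) (Fin n) ℂ
      (updateCol (ofLvl m (theta m (1 : ℂ) 0 a)) p₁ (Pi.single p₁ 1)) =
      prodP m a (oddTuple m 0) := by
    rw [prodP_oddTuple m a (by simp) hm.pos]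
    congr 1
    ext1 p q
    rw [Matrix.updateCol_apply, Pi.single_apply]
    have hp := lvl_lt p
    have hq := lvl_lt q
    simp only [← lvl_inj, ofLvl, theta, tri, Matrix.of_apply]
    rw [Nat.odd_iff] at hm
    generalize lvl p = k at *
    generalize lvl q = l at *
    generalize lvl p₁ = j at *
    split_ifs <;> first | omega | simp
  rw [e]
  refine det_prodP_ne_zero m a _ fun i hi => ?_
  rw [mem_oddTuple m (by simp) hm.pos] at hi
  exact ⟨by omega, fun _ => by omega⟩

theorem MatLim.submatrix {ι κ ι' κ' : Type*} {F : Matrix ι κ (RatFunc ℂ)} {D : Matrix ι κ ℂ}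
    (h : MatLim F D) (e : ι' → ι) (f : κ' → κ) : MatLim (F.submatrix e f) (D.submatrix e f) :=
  fun i j => h (e i) (f j)

theorem cRat_inv_mul {ι : Type} [Fintype ι] [DecidableEq ι] {N : Matrix ι ι ℂ} (hN : N.det ≠ 0) :
    cRat N⁻¹ * cRat N = 1 ∧ cRat N * cRat N⁻¹ = 1 := by
  have h := isUnit_iff_ne_zero.2 hN
  rw [← cRat_mul, ← cRat_mul, Matrix.nonsing_inv_mul _ h, Matrix.mul_nonsing_inv _ h, cRat_one]
  exact ⟨rfl, rfl⟩

/-- The part at infinity of the linearization property, for the tridiagonal pencil. -/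
theorem exists_biproper_theta (hm : 0 < m) (hodd : Odd m ∨ (a m).det ≠ 0)
    (ha : ∀ j, MatLim (a' j) (a j)) (ht : HasLim t 0) :
    ∃ (F K : Matrix (Fin m × Fin n) (Fin m × Fin n) (RatFunc ℂ)),
      (∀ N : Matrix (Fin m × Fin n) (Fin m × Fin n) ℂ, N.det ≠ 0 → IsBiproper (F * cRat N)) ∧
      (∀ N : Matrix (Fin m × Fin n) (Fin m × Fin n) ℂ, N.det ≠ 0 → IsBiproper (cRat N * K)) ∧
      F * compRingEquiv (Fin m) (Fin n) (RatFunc ℂ) (ofLvl m (theta m 1 t a')) * K =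
        diagLast m (hornerDown t a' m) := by
  -- Asking for nonsingular limits makes it possible to absorb any constant nonsingular factor `N`
  -- afterwards.
  suffices h : ∃ (F K : Matrix (Fin m × Fin n) (Fin m × Fin n) (RatFunc ℂ))
      (D₁ D₂ : Matrix (Fin m × Fin n) (Fin m × Fin n) ℂ), MatLim F D₁ ∧ D₁.det ≠ 0 ∧
      MatLim K D₂ ∧ D₂.det ≠ 0 ∧
      F * compRingEquiv (Fin m) (Fin n) (RatFunc ℂ) (ofLvl m (theta m 1 t a')) * K =
        diagLast m (hornerDown t a' m) by
    obtain ⟨F, K, D₁, D₂, hF, hD₁, hK, hD₂, h⟩ := h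
    refine ⟨F, K, fun N hN => ?_, fun N hN => ?_, h⟩
    · refine (hF.mul (matLim_cRat N)).isBiproper ?_
      rw [Matrix.det_mul]
      exact mul_ne_zero hD₁ hN
    · refine ((matLim_cRat N).mul hK).isBiproper ?_
      rw [Matrix.det_mul]
      exact mul_ne_zero hN hD₂
  set Θ := compRingEquiv (Fin m) (Fin n) (RatFunc ℂ) (ofLvl m (theta m 1 t a')) with hΘ
  rcases hodd with hodd | hdet
  · obtain ⟨q, hq⟩ := hodd
    set p₀ : Fin m := ofLevel 0 hm
    have hp₀ : lvl p₀ = 0 := lvl_ofLevel hm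
    set p₁ : Fin m := ofLevel (2 * q) (by omega)
    have hp₁ : lvl p₁ = 2 * q := lvl_ofLevel (by omega)
    set f : Fin m → Matrix (Fin n) (Fin n) (RatFunc ℂ) := fun p => colDown t a' q (lvl p) with hf
    set Y := updateCol (ofLvl m (theta m 1 t a')) p₁ (Pi.single p₁ 1) with hY
    have hYlim : MatLim (compRingEquiv (Fin m) (Fin n) (RatFunc ℂ) Y) (compRingEquiv (Fin m) (Fin n) ℂ
        (updateCol (ofLvl m (theta m (1 : ℂ) 0 a)) p₁ (Pi.single p₁ 1))) := by
      refine matLim_compRingEquiv fun p q => ?_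
      rw [hY, Matrix.updateCol_apply, Matrix.updateCol_apply, Pi.single_apply, Pi.single_apply]
      split_ifs
      · exact matLim_one
      · exact matLim_zero
      · exact matLim_theta a ha ht _ _
    have hYdet := det_updateCol_theta_ne_zero a ⟨q, hq⟩ (p₁ := p₁) (by omega)
    -- The replaced column has entries of positive order in $t$ except at the top, where it is the
    -- identity; so this factor tends to the identity.
    have hVlim : MatLim (compRingEquiv (Fin m) (Fin n) (RatFunc ℂ) (updateCol 1 p₁ f))
        (compRingEquiv (Fin m) (Fin n) ℂ 1) := by
      refine matLim_compRingEquiv fun p p' => ?_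
      rw [Matrix.updateCol_apply]
      split_ifs with h
      · have := matLim_colDown a ha ht (q := q) (k := lvl p) (by have := lvl_lt p; omega)
        rw [h, Matrix.one_apply]
        have e : (p = p₁) = (lvl p = 2 * q) := by rw [← hp₁, lvl_inj]
        simp only [e]
        exact this
      · rw [Matrix.one_apply, Matrix.one_apply]
        split_ifs
        · exact matLim_one
        · exact matLim_zero
    have hmul : ofLvl m (theta m 1 t a') * updateCol 1 p₁ f =
        Y * diagonal fun p => if p = p₁ then hornerDown t a' m else 1 := by
      refine mul_updateCol_one _ f p₁ _ fun p => ?_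
      have := sum_theta_mul_colDown m t a' hq (lvl_lt p)
      rw [← sum_lvl (fun l => theta m 1 t a' (lvl p) l * colDown t a' q l)] at this
      have e : (p = p₁) = (lvl p + 1 = m) := by
        rw [← lvl_inj, hp₁, eq_iff_iff]
        omega
      simp only [e]
      exact this
    -- The reversed polynomial appears at the top level, whereas it is required in the last block; a
    -- swap of these two blocks repairs this.
    let σ : Equiv.Perm (Fin m × Fin n) := (Equiv.swap p₀ p₁).prodCongr (Equiv.refl _)
    refine ⟨(compRingEquiv (Fin m) (Fin n) (RatFunc ℂ) Y)⁻¹.submatrix σ id,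
      (compRingEquiv (Fin m) (Fin n) (RatFunc ℂ) (updateCol 1 p₁ f)).submatrix id σ, _, _,
      (hYlim.inv hYdet).submatrix _ _, ?_, hVlim.submatrix _ _, ?_, ?_⟩
    · rw [Matrix.det_permute]
      refine mul_ne_zero (by simp) ?_
      rw [Matrix.det_nonsing_inv, Ring.inverse_eq_inv']
      exact inv_ne_zero hYdet
    · rw [Matrix.det_permute']
      refine mul_ne_zero (by simp) ?_
      rw [map_one, Matrix.det_one]
      exact one_ne_zero
    · have h1 : (compRingEquiv (Fin m) (Fin n) (RatFunc ℂ) Y)⁻¹ * Θ *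
          compRingEquiv (Fin m) (Fin n) (RatFunc ℂ) (updateCol 1 p₁ f) =
          compRingEquiv (Fin m) (Fin n) (RatFunc ℂ)
            (diagonal fun p => if p = p₁ then hornerDown t a' m else 1) := by
        rw [Matrix.mul_assoc, hΘ, ← map_mul, hmul, map_mul, ← Matrix.mul_assoc,
          Matrix.nonsing_inv_mul _ (hYlim.isUnit_det hYdet), Matrix.one_mul]
      have h2 := congrArg (fun M => M.submatrix σ σ) h1
      refine Eq.trans ?_ (h2.trans ?_)
      · rfl
      · rw [diagLast_eq p₀ hp₀]
        ext ⟨p, c⟩ ⟨p', d⟩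
        change (diagonal fun p => if p = p₁ then hornerDown t a' m else 1)
          (Equiv.swap p₀ p₁ p) (Equiv.swap p₀ p₁ p') c d =
          (diagonal fun p => if p = p₀ then hornerDown t a' m else 1) p p' c d
        rw [Matrix.diagonal_apply, Matrix.diagonal_apply]
        simp only [(Equiv.swap p₀ p₁).injective.eq_iff, Equiv.swap_apply_eq_iff,
          Equiv.swap_apply_right]
  -- If $A_m$ is nonsingular, the array and the target both have nonsingular limits, so their
  -- quotient alone serves as the left factor.
  · have hlim : MatLim Θ (compRingEquiv (Fin m) (Fin n) ℂ (ofLvl m (theta m (1 : ℂ) 0 a))) :=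
      matLim_compRingEquiv fun p q => matLim_theta a ha ht _ _
    have hd := det_theta_ne_zero a hm hdet
    refine ⟨diagLast m (hornerDown t a' m) * Θ⁻¹, 1, _, 1,
      (matLim_diagLast (matLim_hornerDown a ha ht m)).mul (hlim.inv hd), ?_, matLim_one, ?_, ?_⟩
    · rw [Matrix.det_mul, diagLast_eq_elemM, Matrix.det_nonsing_inv, Ring.inverse_eq_inv']
      exact mul_ne_zero (det_elemM_ne_zero m 0 _ fun _ => hdet) (inv_ne_zero hd)
    · rw [Matrix.det_one]
      exact one_ne_zero
    · rw [Matrix.mul_one, Matrix.mul_assoc, Matrix.nonsing_inv_mul _ (hlim.isUnit_det hd),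
        Matrix.mul_one]

theorem properPart_kron {p₀ : Fin m} (hp₀ : lvl p₀ = 0)
    (A E : Matrix (Fin r) (Fin r) ℂ) (B : Matrix (Fin r) (Fin n) ℂ) (C : Matrix (Fin n) (Fin r) ℂ) :
    properPart A (rowKron m m B) (colKron m m C) E =
      Matrix.of fun p q => if p.1 = p₀ ∧ q.1 = p₀ then properPart A B C E p.2 q.2 else 0 := by
  have hk : ∀ p : Fin m, (((p : ℕ) : ℤ) + 1 = m) = (p = p₀) := fun p => by
    rw [← lvl_inj, hp₀, ← val_add_eq_iff_lvl, eq_iff_iff]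
    omega
  unfold properPart
  generalize ((RatFunc.X : RatFunc ℂ) • cRat E - cRat A)⁻¹ = R
  ext1 ⟨p, c⟩ ⟨q, d⟩
  simp only [Matrix.mul_apply, cRat, Matrix.map_apply, colKron, rowKron, Matrix.of_apply, hk]
  by_cases hp : p = p₀ <;> by_cases hq : q = p₀ <;> simp [hp, hq]

/-- The part at infinity of the linearization property. -/
theorem exists_biproper {L : Matrix (Fin m × Fin n) (Fin m × Fin n) ℂ[X]}
    {N₁ N₂ : Matrix (Fin m × Fin n) (Fin m × Fin n) ℂ} (h₁ : N₁.det ≠ 0) (h₂ : N₂.det ≠ 0)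
    (hL : L = cPoly N₁ * ((X : ℂ[X]) • cPoly (compRingEquiv (Fin m) (Fin n) ℂ
        (ofLvl m (theta m (1 : ℂ) 0 a))) - cPoly (compRingEquiv (Fin m) (Fin n) ℂ
        (ofLvl m (theta m (0 : ℂ) (-1) a)))) * cPoly N₂) (hm : 0 < m)
    (hodd : Odd m ∨ (a m).det ≠ 0) (A : Matrix (Fin r) (Fin r) ℂ) {E : Matrix (Fin r) (Fin r) ℂ}
    (hE : E.det ≠ 0) (B : Matrix (Fin r) (Fin n) ℂ) (C : Matrix (Fin n) (Fin r) ℂ) :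
    ∃ Oₗ Oᵣ : Matrix (Fin m × Fin n) (Fin m × Fin n) (RatFunc ℂ),
      IsBiproper Oₗ ∧ IsBiproper Oᵣ ∧
      Oₗ * ((RatFunc.X : RatFunc ℂ)⁻¹ •
        transferFunction L A (rowKron m m B * N₂) (N₁ * colKron m m C) E) * Oᵣ =
        diagLast m (((RatFunc.X : RatFunc ℂ)⁻¹ ^ m) •
          transferFunction (matPoly m a) A B C E) := by
  have hp₀ : lvl (ofLevel 0 hm) = 0 := lvl_ofLevel hm
  obtain ⟨F, K, hF, hK, hFK⟩ := exists_biproper_theta (m := m) a hm hodd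
    (matLim_ratCoeff a (matLim_properPart A B C hE)) hasLim_X_inv
  obtain ⟨e1, e1'⟩ := cRat_inv_mul h₁
  obtain ⟨e2, e2'⟩ := cRat_inv_mul h₂
  have hinv : ∀ {N : Matrix (Fin m × Fin n) (Fin m × Fin n) ℂ}, N.det ≠ 0 → N⁻¹.det ≠ 0 := by
    intro N hN
    rw [Matrix.det_nonsing_inv, Ring.inverse_eq_inv']
    exact inv_ne_zero hN
  refine ⟨F * cRat N₁⁻¹, cRat N₂⁻¹ * K, hF _ (hinv h₁), hK _ (hinv h₂), ?_⟩
  have hG : (RatFunc.X : RatFunc ℂ)⁻¹ •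
      transferFunction L A (rowKron m m B * N₂) (N₁ * colKron m m C) E =
      cRat N₁ * compRingEquiv (Fin m) (Fin n) (RatFunc ℂ) (ofLvl m
        (theta m 1 (RatFunc.X : RatFunc ℂ)⁻¹ (ratCoeff a (properPart A B C E)))) * cRat N₂ := by
    rw [← theta_cRat a hp₀, ← properPart_kron hp₀ A E B C, transferFunction_eq, hL,
      polyToRat_mul, polyToRat_mul, polyToRat_sub, polyToRat_X_smul]
    simp only [polyToRat_cPoly]
    unfold properPart
    rw [cRat_mul, cRat_mul, Matrix.mul_smul, Matrix.smul_mul]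
    congr 1
    simp only [Matrix.mul_add, Matrix.add_mul, Matrix.mul_assoc]
  rw [hG, ← hornerDown_ratCoeff, ← hFK]
  calc _ = F * (cRat N₁⁻¹ * cRat N₁) * compRingEquiv (Fin m) (Fin n) (RatFunc ℂ) (ofLvl m
        (theta m 1 (RatFunc.X : RatFunc ℂ)⁻¹ (ratCoeff a (properPart A B C E)))) *
        (cRat N₂ * cRat N₂⁻¹) * K := by simp only [Matrix.mul_assoc]
    _ = _ := by rw [e1, e2', Matrix.mul_one, Matrix.mul_one]

end linearization

/-! ### Assembly of the linearization property. -/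

section main
variable {m n r h : ℕ} {a : ℕ → Matrix (Fin n) (Fin n) ℂ} {tw tv : List ℤ}
  {𝒳 𝒴 : List (Matrix (Fin n) (Fin n) ℂ)}

theorem transferFunction_isSymm {ι : Type} {P : Matrix ι ι ℂ[X]} (hP : P.IsSymm)
    {A E : Matrix (Fin r) (Fin r) ℂ} (hA : A.IsSymm) (hE : E.IsSymm) (B : Matrix (Fin r) ι ℂ) :
    (transferFunction P A B Bᵀ E).IsSymm := by
  have h : (polyToRat P).IsSymm := congrArg polyToRat hP
  rw [transferFunction_eq]
  exact h.add (properPart_isSymm hA hE B)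

theorem isRosenbrockStrongLinearization_of_strict_equiv (hm : 0 < m)
    (hodd : Odd m ∨ (a m).det ≠ 0) {G : Matrix (Fin n) (Fin n) (RatFunc ℂ)}
    {A E : Matrix (Fin r) (Fin r) ℂ} {B : Matrix (Fin r) (Fin n) ℂ} {C : Matrix (Fin n) (Fin r) ℂ}
    (hmin : IsMinimalRealization G (matPoly m a) A B C E) {α : ℤ} (h0 : 0 ≤ α) (hα : α < m)
    {N₁ N₂ : Matrix (Fin m × Fin n) (Fin m × Fin n) ℂ} (h₁ : N₁.det ≠ 0) (h₂ : N₂.det ≠ 0)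
    {L : Matrix (Fin m × Fin n) (Fin m × Fin n) ℂ[X]}
    (hL : L = cPoly N₁ * ((X : ℂ[X]) • cPoly (compRingEquiv (Fin m) (Fin n) ℂ
        (ofLvl m (theta m (1 : ℂ) 0 a))) - cPoly (compRingEquiv (Fin m) (Fin n) ℂ
        (ofLvl m (theta m (0 : ℂ) (-1) a)))) * cPoly N₂)
    (hC : N₁ * colKron m m C = colKron m (m - α) C)
    (hB : rowKron m m B * N₂ = rowKron m (m - α) B) :
    IsRosenbrockStrongLinearization
      (systemMatrix L A (rowKron m (m - α) B) (colKron m (m - α) C) E) G (matPoly m a) A B C E := by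
  obtain ⟨T₁, hT₁⟩ : ∃ T, T = compRingEquiv (Fin m) (Fin n) ℂ (ofLvl m (theta m (1 : ℂ) 0 a)) :=
    ⟨_, rfl⟩
  obtain ⟨T₀, hT₀⟩ : ∃ T, T = compRingEquiv (Fin m) (Fin n) ℂ (ofLvl m (theta m (0 : ℂ) (-1) a)) :=
    ⟨_, rfl⟩
  have hL' : cPoly (-(N₁ * T₀ * N₂)) - (X : ℂ[X]) • cPoly (-(N₁ * T₁ * N₂)) = L := by
    rw [hL, ← hT₁, ← hT₀, cPoly_neg, cPoly_neg, cPoly_mul, cPoly_mul, cPoly_mul, cPoly_mul,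
      Matrix.mul_sub, Matrix.sub_mul, Matrix.mul_smul, Matrix.smul_mul, smul_neg]
    abel
  -- The required shape is $X_1-\lambda Y_1$ whereas the pencil is $\lambda N_1T_1N_2-N_1T_0N_2$,
  -- hence the signs.
  refine ⟨-(N₁ * T₀ * N₂), -(N₁ * T₁ * N₂), colKron m (m - α) C, rowKron m (m - α) B, A, E, _,
    ?_, rfl, ?_, ?_, ?_⟩
  · rw [hL']
  · rw [hL']
    exact isMinimalRealization_of_block hmin h0 hα
  · obtain ⟨U, V, hU, hV, h⟩ := exists_unimodular (L := L) a h₁ h₂ (by rw [hL, theta_cPoly]) hm A E B C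
    rw [hC, hB] at h
    refine ⟨U, V, 1, 1, hU, hV, by simp, by simp, ?_⟩
    rw [cPoly_one]
    exact h
  · rw [hL', ← hC, ← hB, hmin.1.2]
    exact exists_biproper a h₁ h₂ hL hm hodd A hmin.1.1 B C

end main

end RosenbrockGFPR

theorem corollary4p7 (m n r h : ℕ)
    -- `P(λ) = ∑_{j=0}^m λ^j A_j` with `A_j = a j` and `A_m ≠ 0`
    (a : ℕ → Matrix (Fin n) (Fin n) ℂ) (ham : a m ≠ 0)
    -- `G(λ) = P(λ) + Bᵀ (λ E - A)⁻¹ B` is symmetric, with a minimal symmetric realization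
    (A E : Matrix (Fin r) (Fin r) ℂ) (B : Matrix (Fin r) (Fin n) ℂ)
    (hA : A.IsSymm) (hE : E.IsSymm)
    (G : Matrix (Fin n) (Fin n) (RatFunc ℂ)) (hG : G.IsSymm)
    (hmin : IsMinimalRealization G (matPoly m a) A B Bᵀ E)
    -- `0 ≤ h ≤ m - 1` is even
    (hh : Even h) (hm : h < m)
    -- `t_w` and `t_v + m` are in canonical form for `h` and `m - h - 1`
    (tw tv : List ℤ) (htw : IsCanonical h tw) (htv : IsCanonical (m - h - 1) (shift m tv))
    -- nonsingular matrix assignments consisting of symmetric matrices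
    (𝒳 𝒴 : List (Matrix (Fin n) (Fin n) ℂ))
    (h𝒳 : IsNonsingularAssignment m tw 𝒳) (h𝒴 : IsNonsingularAssignment m tv 𝒴)
    (h𝒳s : ∀ M ∈ 𝒳, M.IsSymm) (h𝒴s : ∀ M ∈ 𝒴, M.IsSymm)
    (α : ℤ) (hα : α = inversionsAt 0 (tw ++ simpleTuple h))
    (𝕃 : Matrix ((Fin m × Fin n) ⊕ Fin r) ((Fin m × Fin n) ⊕ Fin r) ℂ[X])
    (h𝕃 : 𝕃 = pencilS m h a A B Bᵀ E tw tv 𝒳 𝒴) :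
    -- the block form of `𝕃(λ)`
    𝕃 = systemMatrix (pencilP m h a tw tv 𝒳 𝒴) A (rowKron m (m - α) B) (colKron m (m - α) Bᵀ) E ∧
    -- `𝕃(λ)` is symmetric, and it is a Rosenbrock strong linearization of `G(λ)`
    𝕃.IsSymm ∧
    (Odd m → IsRosenbrockStrongLinearization 𝕃 G (matPoly m a) A B Bᵀ E) ∧
    (Even m → (a m).det ≠ 0 →
      IsRosenbrockStrongLinearization 𝕃 G (matPoly m a) A B Bᵀ E) ∧
    -- the transfer function of `𝕃(λ)` is symmetric
    (transferFunction (pencilP m h a tw tv 𝒳 𝒴) A (rowKron m (m - α) B)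
      (colKron m (m - α) Bᵀ) E).IsSymm := by
  subst h𝕃
  have hmin' := hmin
  obtain ⟨⟨-, rfl⟩, -⟩ := hmin'
  have ha := coefficients_isSymm a hA hE B hG
  have hL := pencilP_isSymm hh hm a ha h𝒳.1 h𝒴.1 h𝒳s h𝒴s
  have e := pencilS_eq_systemMatrix hh hm a htw htv ha hα h𝒳.1 h𝒴.1 h𝒳s h𝒴s A E B Bᵀ
  obtain ⟨s, hs0, -, -, -, -, hsα, hαh, -⟩ := track_tw hh hm htw hα
  -- The two hypotheses serve different ends: `hns` makes the right constant factor nonsingular,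
  -- `hodd` selects the argument at infinity.
  have key (hns : Even m → (a m).det ≠ 0) (hodd : Odd m ∨ (a m).det ≠ 0) :
      IsRosenbrockStrongLinearization (pencilS m h a A B Bᵀ E tw tv 𝒳 𝒴)
        (transferFunction (matPoly m a) A B Bᵀ E) (matPoly m a) A B Bᵀ E := by
    obtain ⟨N₁, N₂, h₁, h₂, hN, hC, hB⟩ :=
      exists_strict_equiv (r := r) hh hm a htw htv ha hα h𝒳 h𝒴 h𝒳s h𝒴s hns
    rw [e]
    exact isRosenbrockStrongLinearization_of_strict_equiv (by omega) hodd hmin (by omega)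
      (by omega) h₁ h₂ hN (hC Bᵀ) (hB B)
  refine ⟨e, ?_, fun h1 => ?_, fun h1 h2 => ?_, transferFunction_isSymm hL hA hE _⟩
  · rw [e]
    exact systemMatrix_isSymm hL hA hE (rowKron m (m - α) B)
  · exact key (fun h2 => absurd h2 (Nat.not_even_iff_odd.2 h1)) (Or.inl h1)
  · exact key (fun _ => h2) (Or.inr h2)
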